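/- **Definitions.** A homomorphism $p:\widetilde G\to G$ of topological groups is a *connective covering* if it is a covering of a union of connected components of $G$ (so $p$ need not be surjective) and the preimage of the identity component $G_e$ is connected. A *planar Lie group* is a connective covering $p:G\to O(2)$. Write $e:\mathbb R\to G$ for the continuous one-parameter subgroup with $p(e(t))=$ rotation by $2\pi t$, and $\mathfrak G_0=p^{-1}(O(1))$, where $O(1)\subset O(2)$ is the stabilizer of $1\in S^1$. *The crossed simplicial group $\Delta\mathfrak G$ of $G$.* Its objects are $[n]$, $n\ge 0$. A morphism $[m]\to[n]$ is a class of pairs $(w,f)$ (standing for $w\circ f$), where $w\in\mathfrak G_0$ and $f:\mathbb Z\to\mathbb Z$ is monotone with $f(l+m+1)=f(l)+n+1$, under the identification $(w\,e(k),f)=(w,f+k(n+1))$, $k\in\mathbb Z$. The composite is $(w',f')\circ(w,f)=(w'w,\,f'^{\,w}\circ f)$, where $f'^{\,w}=f'$ if $\det p(w)=1$ and $f'^{\,w}(l)=-f'(-l)$ if $\det p(w)=-1$. The simplex category $\Delta$ embeds by periodic extension of monotone maps, and every morphism is uniquely $\phi\circ g$ with $\phi$ in $\Delta$ and $g\in\mathfrak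 G_m:=\mathrm{Aut}([m])$. The group $\mathfrak G_n$ is $p^{-1}(D_{n+1})$, with $w\circ(l\mapsto l+j)$ corresponding to $w\,e(j/(n+1))$. For $SO(2)$, $O(2)$, their universal, $N$-fold, $\mathrm{Pin}^{+}_N$ and $\mathrm{Pin}^-_{2N}$ coverings these are the cyclic, dihedral, paracyclic, paradihedral, $N$-cyclic, $N$-dihedral and $N$-quaternionic categories. The action of morphisms on $\mathrm{Hom}([0],[n])/\mathfrak G_0=\{0,\dots,n\}$ gives $\lambda_n:\mathfrak G_n\to S_{n+1}$. *Structured sets.* A $\Delta\mathfrak G$-structured set is a finite set $I$ with $n+1\geq 1$ elements, a right $\mathfrak G_n$-torsor $\mathcal O(I)$ and a $\lambda_n$-equivariant map $\mathcal O(I)\to\mathrm{Isom}(\{0,\dots,n\},I)$. A morphism $(I',\mathcal O(I'))\to(I,\mathcal O(I))$ is a family $\psi_{f,f'}\in\mathrm{Hom}_{\Delta\mathfrak G}([n'],[n])$, $f\in\mathcal O(I)$, $f'\in\mathcal O(I')$, with $\psi_{fg,f'g'}=g^{-1}\psi_{f,f'}g'$; composition is $(\psi\psi')_{f,f''}=\psi_{f,f'}\psi'_{f',f''}$.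 Let $\mathcal G$ be the resulting category and $\lambda_{\mathcal G}:\mathcal G\to\mathrm{FSet}$, $(I,\mathcal O(I))\mapsto I$, the forgetful functor to nonempty finite sets. *Structured marked circles.* Let $\mathrm{Homeo}^G(S^1)\to\mathrm{Homeo}(S^1)$ be a connective covering (compact-open topology) together with an isomorphism of its pullback along $O(2)\to\mathrm{Homeo}(S^1)$ with $p:G\to O(2)$. A $G$-structured marked circle consists of a space $C$ homeomorphic to $S^1$, a right torsor $F$ over the topological group $\mathrm{Homeo}^G(S^1)$ with an equivariant map $\rho:F\to\mathrm{Homeo}(S^1,C)$, and a nonempty closed $J\subset C$ homeomorphic to a finite disjoint union of copies of $[0,1]$. Let $\mathrm{Homeo}^G((C,J),(C',J'))$ be the space of pairs $(\varphi,\widetilde\varphi)$ of a homeomorphism $\varphi:C\to C'$ with $\varphi(J)\subset J'$ and an equivariant homeomorphism $\widetilde\varphi:F\to F'$ with $\rho'\widetilde\varphi=\varphi\rho$. The category $\mathcal C^G$ has the $G$-structured marked circles as objects and $\mathrm{Hom}((C,J),(C',J'))=\pi_0\,\mathrm{Homeo}^G((C,J),(C',J'))$. **Theorem.** Let $p:G\to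 O(2)$ be a planar Lie group with corresponding crossed simplicial group $\Delta\mathfrak G$. Then $\mathrm{Homeo}^G(S^1)$ exists, and for every choice of it the functor $$\lambda_{\mathcal C^G}:\mathcal C^G\to\mathrm{FSet},\qquad (C,J)\mapsto\pi_0(J),$$ factors canonically, up to natural isomorphism, as $\lambda_{\mathcal G}\circ\pi$ with an equivalence of categories $\pi:\mathcal C^G\to\mathcal G$. Here, if $J$ has $n+1$ components, the structured frames of $\pi(C,J)$ are in bijection with $\pi_0(F_J)$, where $F_J\subset F$ is the space of those $x$ for which $\rho(x)$ maps exactly one $(n+1)$-st root of unity into each component of $J$ and no root of unity outside $J$; under this bijection the class of $x$ gives the identification $\{0,\dots,n\}\cong\pi_0(J)$ sending $k$ to the component containing $\rho(x)(e^{2\pi i k/(n+1)})$, and $\mathfrak G_n=p^{-1}(D_{n+1})\subset G\subset\mathrm{Homeo}^G(S^1)$ acts through its right action on $F$. In particular, the category $\mathcal C^G$ is equivalent to $\Delta\mathfrak G$. -/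

import Mathlib

open CategoryTheory Topology

universe u w

namespace PlanarCSG

noncomputable section

/-! ### Homeomorphisms of the circle, orthogonal transformations -/

/-- The set of homeomorphisms `X → Y` with the compact-open topology. -/
instance homeoTopology (X Y : Type*) [TopologicalSpace X] [TopologicalSpace Y] :
    TopologicalSpace (X ≃ₜ Y) :=
  TopologicalSpace.induced (fun φ : X ≃ₜ Y => (φ : C(X, Y))) inferInstance

/-- The orthogonal group `O(2)`. -/
abbrev O2 := Matrix.orthogonalGroup (Fin 2) ℝ

namespace O2

theorem sq_sum (A : O2) :
    A.1 0 0 * A.1 0 0 + A.1 1 0 * A.1 1 0 = 1 ∧ A.1 0 0 * A.1 0 1 + A.1 1 0 * A.1 1 1 = 0 ∧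
      A.1 0 1 * A.1 0 1 + A.1 1 1 * A.1 1 1 = 1 := by
  have h : A.1.transpose * A.1 = 1 := by
    have := A.2.1
    rwa [Matrix.star_eq_conjTranspose, Matrix.conjTranspose_eq_transpose_of_trivial] at this
  have h00 := congrFun (congrFun h 0) 0
  have h01 := congrFun (congrFun h 0) 1
  have h11 := congrFun (congrFun h 1) 1
  simp [Matrix.mul_apply, Fin.sum_univ_two] at h00 h01 h11
  exact ⟨h00, h01, h11⟩

/-- The action of an orthogonal matrix on the unit circle of `ℂ = ℝ²`. -/
def act (A : O2) (z : Circle) : Circle :=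
  ⟨⟨A.1 0 0 * (z : ℂ).re + A.1 0 1 * (z : ℂ).im, A.1 1 0 * (z : ℂ).re + A.1 1 1 * (z : ℂ).im⟩, by
    obtain ⟨h1, h2, h3⟩ := sq_sum A
    have hz : (z : ℂ).re * (z : ℂ).re + (z : ℂ).im * (z : ℂ).im = 1 := by
      have := Circle.normSq_coe z
      rwa [Complex.normSq_apply] at this
    refine mem_sphere_zero_iff_norm.2 ?_
    rw [← sq_eq_sq₀ (norm_nonneg _) zero_le_one, ← Complex.normSq_eq_norm_sq,
      Complex.normSq_apply]
    dsimp only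
    linear_combination (z : ℂ).re ^ 2 * h1 + 2 * (z : ℂ).re * (z : ℂ).im * h2 +
      (z : ℂ).im ^ 2 * h3 + hz⟩

theorem act_one (z : Circle) : act 1 z = z := by
  apply Circle.ext
  apply Complex.ext <;> simp [act]

theorem act_mul (A B : O2) (z : Circle) : act (A * B) z = act A (act B z) := by
  apply Circle.ext
  apply Complex.ext <;> simp [act, Matrix.mul_apply, Fin.sum_univ_two] <;> ring

theorem continuous_act (A : O2) : Continuous (act A) := by
  refine Continuous.subtype_mk ?_ _
  have h : Continuous fun z : Circle => (z : ℂ) := continuous_subtype_val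
  have : Continuous fun z : Circle =>
      ((A.1 0 0 * (z : ℂ).re + A.1 0 1 * (z : ℂ).im : ℝ) : ℂ) +
        ((A.1 1 0 * (z : ℂ).re + A.1 1 1 * (z : ℂ).im : ℝ) : ℂ) * Complex.I := by fun_prop
  convert this using 2 with z
  apply Complex.ext <;> simp

/-- The standard homomorphism `O(2) → Homeo(S¹)`. -/
def toHomeo : O2 →* (Circle ≃ₜ Circle) where
  toFun A :=
    { toFun := act A
      invFun := act A⁻¹
      left_inv := fun z => by rw [← act_mul, inv_mul_cancel, act_one]
      right_inv := fun z => by rw [← act_mul, mul_inv_cancel, act_one]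
      continuous_toFun := continuous_act A
      continuous_invFun := continuous_act A⁻¹ }
  map_one' := by ext1 z; exact act_one z
  map_mul' A B := by ext1 z; exact act_mul A B z

theorem det_eq (A : O2) : A.1.det = 1 ∨ A.1.det = -1 := by
  obtain ⟨h1, h2, h3⟩ := sq_sum A
  rw [Matrix.det_fin_two, ← sq_eq_one_iff]
  nlinarith

/-- The sign `±1` of an orthogonal transformation (the sign of its determinant). -/
def sign : O2 →* ℤˣ where
  toFun A := if A.1.det = 1 then 1 else -1
  map_one' := by simp
  map_mul' A B := by
    have h : (A * B).1.det = A.1.det * B.1.det := by simp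
    rw [h]
    rcases det_eq A with hA | hA <;> rcases det_eq B with hB | hB <;> rw [hA, hB] <;> norm_num

theorem sign_cast (A : O2) : (((sign A : ℤˣ) : ℤ) : ℝ) = A.1.det := by
  show (((if A.1.det = 1 then (1 : ℤˣ) else -1 : ℤˣ) : ℤ) : ℝ) = _
  rcases det_eq A with hA | hA <;> rw [hA] <;> norm_num

/-- The rotation by the angle `2πt`. -/
def rotation (t : ℝ) : O2 :=
  ⟨!![Real.cos (2 * Real.pi * t), -Real.sin (2 * Real.pi * t);
      Real.sin (2 * Real.pi * t), Real.cos (2 * Real.pi * t)], by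
    rw [Matrix.mem_orthogonalGroup_iff]
    ext a b
    have := Real.sin_sq_add_cos_sq (2 * Real.pi * t)
    fin_cases a <;> fin_cases b <;>
      simp [Matrix.mul_apply, Fin.sum_univ_two] <;> nlinarith⟩

theorem rotation_int (k : ℤ) : rotation k = 1 := by
  have h1 : Real.cos (2 * Real.pi * k) = 1 := by
    rw [mul_comm]; exact Real.cos_int_mul_two_pi k
  have h2 : Real.sin (2 * Real.pi * k) = 0 := by
    have := Real.sin_int_mul_pi (2 * k)
    push_cast at this
    rwa [show (2 * (k : ℝ)) * Real.pi = 2 * Real.pi * k by ring] at this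
  apply Subtype.ext
  simp only [rotation, h1, h2]
  ext a b
  fin_cases a <;> fin_cases b <;> simp

theorem rotation_add (s t : ℝ) : rotation (s + t) = rotation s * rotation t := by
  apply Subtype.ext
  ext a b
  fin_cases a <;> fin_cases b <;>
    simp [rotation, mul_add, Real.cos_add, Real.sin_add] <;> ring

theorem continuous_rotation : Continuous rotation := by
  refine Continuous.subtype_mk ?_ _
  refine continuous_matrix fun a b => ?_
  fin_cases a <;> fin_cases b <;> simp <;> fun_prop

theorem sign_rotation (t : ℝ) : sign (rotation t) = 1 := by
  have : (rotation t).1.det = 1 := by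
    simp [rotation, Matrix.det_fin_two]
    have := Real.sin_sq_add_cos_sq (2 * Real.pi * t)
    nlinarith
  show (if (rotation t).1.det = 1 then (1 : ℤˣ) else -1) = 1
  rw [if_pos this]

theorem conj_rotation (A : O2) (t : ℝ) :
    A * rotation t = rotation (((sign A : ℤˣ) : ℤ) * t) * A := by
  obtain ⟨h1, h2, h3⟩ := sq_sum A
  rw [sign_cast]
  have hd := Matrix.det_fin_two A.1
  rcases det_eq A with hA | hA
  · rw [hA] at hd ⊢
    have e1 : A.1 1 1 = A.1 0 0 := by
      linear_combination -A.1 0 0 * hd + A.1 1 0 * h2 - A.1 1 1 * h1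
    have e2 : A.1 0 1 = -A.1 1 0 := by
      linear_combination A.1 1 0 * hd + A.1 0 0 * h2 - A.1 0 1 * h1
    apply Subtype.ext
    ext a b
    fin_cases a <;> fin_cases b <;>
      simp [rotation, Matrix.mul_apply, Fin.sum_univ_two, e1, e2] <;> ring
  · rw [hA] at hd ⊢
    have e1 : A.1 1 1 = - A.1 0 0 := by
      linear_combination -A.1 0 0 * hd + A.1 1 0 * h2 - A.1 1 1 * h1
    have e2 : A.1 0 1 = A.1 1 0 := by
      linear_combination A.1 1 0 * hd + A.1 0 0 * h2 - A.1 0 1 * h1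
    apply Subtype.ext
    ext a b
    fin_cases a <;> fin_cases b <;>
      simp [rotation, Matrix.mul_apply, Fin.sum_univ_two, e1, e2] <;> ring

end O2

/-! ### Connective coverings and planar Lie groups -/

/-- A homomorphism of topological groups is a connective covering if it is a covering of a union of
connected components of the target, and the preimage of the identity component is connected.
(Fibres of a covering map are allowed to be empty, so that `p` need not be surjective.) -/
structure IsConnectiveCovering {G H : Type*} [Group G] [TopologicalSpace G] [Group H]
    [TopologicalSpace H] (p : G →* H) : Prop where
  isCoveringMap : IsCoveringMap p
  isConnected_preimage : IsConnected (p ⁻¹' connectedComponent (1 : H))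

/-- A (thin) planar Lie group: a connective covering of `O(2)`. -/
structure PlanarLieGroup where
  carrier : Type u
  [group : Group carrier]
  [topology : TopologicalSpace carrier]
  [isTopologicalGroup : IsTopologicalGroup carrier]
  p : carrier →* O2
  connective : IsConnectiveCovering p

namespace PlanarLieGroup

instance : CoeSort PlanarLieGroup (Type u) := ⟨carrier⟩

attribute [instance] group topology isTopologicalGroup

variable (G : PlanarLieGroup.{u})

theorem exists_lift : ∃ e : C(ℝ, G), e 0 = 1 ∧ ∀ t, G.p (e t) = O2.rotation t := by
  have h0 : O2.rotation 0 = 1 := by simpa using O2.rotation_int 0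
  obtain ⟨e, he, -⟩ := G.connective.isCoveringMap.existsUnique_continuousMap_lifts
    (⟨O2.rotation, O2.continuous_rotation⟩ : C(ℝ, O2)) 0 1 (by simp [h0])
  exact ⟨e, he.1, fun t => congrFun he.2 t⟩

/-- The one-parameter subgroup `e : ℝ → G`: the unique continuous lift, with `e 0 = 1`, of the map
which sends `t` to the rotation by `2πt`. -/
def e : C(ℝ, G) := G.exists_lift.choose

theorem e_zero : G.e 0 = 1 := G.exists_lift.choose_spec.1

theorem p_e (t : ℝ) : G.p (G.e t) = O2.rotation t := G.exists_lift.choose_spec.2 t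

/-- The sign `±1` of an element of `G`. -/
def sign : G →* ℤˣ := O2.sign.comp G.p

theorem sign_e (t : ℝ) : G.sign (G.e t) = 1 := by
  simp [sign, p_e, O2.sign_rotation]

theorem e_add (s t : ℝ) : G.e (s + t) = G.e s * G.e t := by
  have := G.connective.isCoveringMap.eq_of_comp_eq (g₁ := fun t : ℝ => G.e (s + t))
    (g₂ := fun t : ℝ => G.e s * G.e t) (by fun_prop) (by fun_prop)
    (by ext1 t; simp [p_e, O2.rotation_add]) 0 (by simp [e_zero])
  exact congrFun this t

theorem mul_e (g : G) (t : ℝ) : g * G.e t = G.e (((G.sign g : ℤˣ) : ℤ) * t) * g := by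
  have := G.connective.isCoveringMap.eq_of_comp_eq (g₁ := fun t : ℝ => g * G.e t)
    (g₂ := fun t : ℝ => G.e (((G.sign g : ℤˣ) : ℤ) * t) * g) (by fun_prop) (by fun_prop)
    (by ext1 t; simp [p_e, sign, O2.conj_rotation]) 0 (by simp [e_zero])
  exact congrFun this t

/-- The preimage `p⁻¹(O(1))`, where `O(1) ⊂ O(2)` is the stabilizer of the point `1` of the circle. -/
def base : Subgroup G where
  carrier := {g | O2.toHomeo (G.p g) 1 = 1}
  mul_mem' {a b} ha hb := by
    simp only [Set.mem_ofPred_eq, map_mul] at *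
    show O2.toHomeo (G.p a) (O2.toHomeo (G.p b) 1) = 1
    rw [hb, ha]
  one_mem' := by simp
  inv_mem' {a} ha := by
    simp only [Set.mem_ofPred_eq, map_inv] at *
    show (O2.toHomeo (G.p a)).symm 1 = 1
    rw [Homeomorph.symm_apply_eq, ha]

/-- The element `e k`, `k ∈ ℤ` of `p⁻¹(O(1))`: the lift of `k` full turns. -/
def turn (k : ℤ) : G.base := ⟨G.e k, by
  show O2.toHomeo (G.p (G.e k)) 1 = 1
  rw [p_e, O2.rotation_int]; exact O2.act_one 1⟩

theorem turn_zero : G.turn 0 = 1 := Subtype.ext (by simp [turn, e_zero])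

theorem turn_add (j k : ℤ) : G.turn (j + k) = G.turn j * G.turn k :=
  Subtype.ext (by simp [turn, e_add])

theorem sign_turn (k : ℤ) : G.sign (G.turn k : G) = 1 := G.sign_e k

theorem mul_turn (g : G.base) (k : ℤ) :
    g * G.turn k = G.turn (((G.sign (g : G) : ℤˣ) : ℤ) * k) * g :=
  Subtype.ext (by simpa [turn] using G.mul_e g k)

end PlanarLieGroup

/-! ### The paracyclic category -/

/-- Morphisms of the paracyclic category: monotone maps `f : ℤ → ℤ` with
`f (l + (m + 1)) = f l + (n + 1)`. -/
@[ext]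
structure Para (m n : ℕ) where
  toFun : ℤ → ℤ
  monotone' : Monotone toFun
  map_add' : ∀ l, toFun (l + (m + 1)) = toFun l + (n + 1)

namespace Para

instance (m n : ℕ) : FunLike (Para m n) ℤ ℤ where
  coe := toFun
  coe_injective _ _ h := Para.ext h

variable {k m n : ℕ}

theorem ext' {f g : Para m n} (h : ∀ l, f l = g l) : f = g := DFunLike.ext _ _ h

theorem mono (f : Para m n) {a b : ℤ} (h : a ≤ b) : f a ≤ f b := f.monotone' h

theorem map_add (f : Para m n) (l : ℤ) : f (l + (m + 1)) = f l + (n + 1) := f.map_add' l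

theorem map_add_mul (f : Para m n) (l j : ℤ) : f (l + j * (m + 1)) = f l + j * (n + 1) := by
  induction j using Int.induction_on with
  | zero => simp
  | succ i ih =>
    rw [show l + ((i : ℤ) + 1) * (m + 1) = l + i * (m + 1) + (m + 1) by ring, f.map_add, ih]; ring
  | pred i ih =>
    have := f.map_add (l + (-(i : ℤ) - 1) * (m + 1))
    rw [show l + (-(i : ℤ) - 1) * (m + 1) + (m + 1) = l + -(i : ℤ) * (m + 1) by ring, ih] at this
    linarith

/-- The translation `l ↦ l + j`. -/
def trans (n : ℕ) (j : ℤ) : Para n n := ⟨fun l => l + j, fun _ _ h => by dsimp; omega, fun l => by ring⟩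

/-- Composition: first `f`, then `g`. -/
def comp (g : Para m n) (f : Para k m) : Para k n where
  toFun l := g (f l)
  monotone' _ _ h := g.mono (f.mono h)
  map_add' l := by rw [f.map_add, g.map_add]

/-- Addition of `j` full turns: the map `l ↦ f l + j (n + 1)`. -/
def shift (j : ℤ) (f : Para m n) : Para m n where
  toFun l := f l + j * (n + 1)
  monotone' _ _ h := by have := f.mono h; dsimp; omega
  map_add' l := by rw [f.map_add]; ring

/-- The conjugate of `f` by `l ↦ ε l`, `ε = ±1`: for `ε = -1` this is `l ↦ -f (-l)`. -/
def conj (ε : ℤˣ) (f : Para m n) : Para m n where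
  toFun l := ε * f (ε * l)
  monotone' a b h := by
    rcases Int.units_eq_one_or ε with rfl | rfl
    · simpa using f.mono h
    · simpa using f.mono (neg_le_neg h)
  map_add' l := by
    rcases Int.units_eq_one_or ε with rfl | rfl
    · simpa using f.map_add l
    · have := f.map_add (-(l + (m + 1)))
      rw [show -(l + ((m : ℤ) + 1)) + (m + 1) = -l by ring] at this
      simp only [Units.val_neg, Units.val_one, neg_mul, one_mul]
      linarith

@[simp] theorem trans_apply (j l : ℤ) : trans n j l = l + j := rfl
@[simp] theorem comp_apply (g : Para m n) (f : Para k m) (l : ℤ) : g.comp f l = g (f l) := rfl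
@[simp] theorem shift_apply (j : ℤ) (f : Para m n) (l : ℤ) : shift j f l = f l + j * (n + 1) := rfl
@[simp] theorem conj_apply (ε : ℤˣ) (f : Para m n) (l : ℤ) : conj ε f l = ε * f (ε * l) := rfl

/-- The periodic extension of a monotone map `{0, …, m} → {0, …, n}`. -/
def ofOrderHom (φ : Fin (m + 1) →o Fin (n + 1)) : Para m n where
  toFun l := φ ⟨(l % (m + 1)).toNat, by
    have h1 := Int.emod_lt_of_pos l (show (0 : ℤ) < m + 1 by positivity)
    omega⟩ + (l / (m + 1)) * (n + 1)
  monotone' a b h := by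
    have hm : (0 : ℤ) < m + 1 := by positivity
    have hq : a / (m + 1) ≤ b / (m + 1) := Int.ediv_le_ediv hm h
    dsimp only
    rcases hq.eq_or_lt with hq | hq
    · rw [hq]
      have h1 := Int.emod_add_mul_ediv a (m + 1)
      have h2 := Int.emod_add_mul_ediv b (m + 1)
      rw [hq] at h1
      have h3 : a % (m + 1) ≤ b % (m + 1) := by linarith
      have : φ ⟨(a % (m + 1)).toNat, by have := Int.emod_lt_of_pos a hm; omega⟩ ≤
          φ ⟨(b % (m + 1)).toNat, by have := Int.emod_lt_of_pos b hm; omega⟩ :=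
        φ.monotone (Fin.mk_le_mk.2 (Int.toNat_le_toNat h3))
      have h4 : ((φ ⟨(a % (m + 1)).toNat, by have := Int.emod_lt_of_pos a hm; omega⟩ : ℕ) : ℤ) ≤
          (φ ⟨(b % (m + 1)).toNat, by have := Int.emod_lt_of_pos b hm; omega⟩ : ℕ) := by
        exact_mod_cast this
      linarith
    · have h1 := (φ ⟨(a % (m + 1)).toNat, by have := Int.emod_lt_of_pos a hm; omega⟩).2
      have h2 : (a / (m + 1) + 1) * ((n : ℤ) + 1) ≤ b / (m + 1) * (n + 1) :=
        mul_le_mul_of_nonneg_right hq (by positivity)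
      have h5 : ((φ ⟨(a % (m + 1)).toNat, by have := Int.emod_lt_of_pos a hm; omega⟩ : ℕ) : ℤ) <
          n + 1 := by exact_mod_cast h1
      have h6 : (0 : ℤ) ≤
          (φ ⟨(b % (m + 1)).toNat, by have := Int.emod_lt_of_pos b hm; omega⟩ : ℕ) := by positivity
      linarith
  map_add' l := by
    have hm : (m : ℤ) + 1 ≠ 0 := by positivity
    have h1 : (l + (m + 1)) / (m + 1) = l / ((m : ℤ) + 1) + 1 := by
      simpa using Int.add_mul_ediv_right l 1 hm
    have h2 : (l + (m + 1)) % ((m : ℤ) + 1) = l % (m + 1) := by simp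
    simp only [h1, h2]
    ring

/-- A map in the paracyclic category is determined by its values on `{0, …, m}`. -/
theorem ext_fin {f g : Para m n} (h : ∀ a : Fin (m + 1), f (a : ℕ) = g (a : ℕ)) : f = g := by
  refine ext' fun l => ?_
  have hm : (0 : ℤ) < m + 1 := by positivity
  have h1 := Int.emod_add_mul_ediv l (m + 1)
  have h2 := Int.emod_nonneg l hm.ne'
  have h3 := Int.emod_lt_of_pos l hm
  rw [← h1, mul_comm, f.map_add_mul, g.map_add_mul]
  have := h ⟨(l % (m + 1)).toNat, by omega⟩
  simp only [Int.toNat_of_nonneg h2] at this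
  rw [this]

theorem ofOrderHom_apply (φ : Fin (m + 1) →o Fin (n + 1)) (a : Fin (m + 1)) :
    ofOrderHom φ ((a : ℕ) : ℤ) = ((φ a : ℕ) : ℤ) := by
  have ha : ((a : ℕ) : ℤ) < m + 1 := by exact_mod_cast a.2
  have h1 : ((a : ℕ) : ℤ) % (m + 1) = (a : ℕ) := Int.emod_eq_of_lt (by positivity) ha
  have h2 : ((a : ℕ) : ℤ) / (m + 1) = 0 := Int.ediv_eq_zero_of_lt (by positivity) ha
  show ((φ ⟨(((a : ℕ) : ℤ) % (m + 1)).toNat, _⟩ : ℕ) : ℤ) + ((a : ℕ) : ℤ) / (m + 1) * (n + 1) = _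
  simp only [h1, h2]
  simp

theorem ofOrderHom_id : ofOrderHom (OrderHom.id : Fin (n + 1) →o Fin (n + 1)) = trans n 0 :=
  ext_fin fun a => by rw [ofOrderHom_apply]; simp

theorem ofOrderHom_comp (ψ : Fin (m + 1) →o Fin (n + 1)) (φ : Fin (k + 1) →o Fin (m + 1)) :
    ofOrderHom (ψ.comp φ) = (ofOrderHom ψ).comp (ofOrderHom φ) :=
  ext_fin fun a => by rw [ofOrderHom_apply, comp_apply, ofOrderHom_apply, ofOrderHom_apply]; rfl

theorem ofOrderHom_injective {φ ψ : Fin (m + 1) →o Fin (n + 1)} (h : ofOrderHom φ = ofOrderHom ψ) :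
    φ = ψ := by
  ext a
  have := ofOrderHom_apply φ a
  rw [h, ofOrderHom_apply] at this
  exact_mod_cast this.symm

/-- Every morphism is, in a unique way, a translation followed by an extension of a monotone map. -/
theorem exists_factor (f : Para m n) :
    ∃ (φ : Fin (m + 1) →o Fin (n + 1)) (j : ℤ), f = (ofOrderHom φ).comp (trans m j) := by
  obtain ⟨c, hc, hc'⟩ : ∃ c : ℤ, 0 ≤ f c ∧ ∀ z, 0 ≤ f z → c ≤ z := by
    have hm : (0 : ℤ) < m + 1 := by positivity
    refine Int.exists_least_of_bdd ⟨(-(|f 0| + 1)) * (m + 1), fun z hz => ?_⟩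
      ⟨0 + |f 0| * (m + 1), ?_⟩
    · by_contra hlt
      have h1 := f.mono (le_of_lt (not_le.1 hlt))
      have h2 := f.map_add_mul 0 (-(|f 0| + 1))
      rw [zero_add] at h2
      rw [h2] at h1
      have := le_abs_self (f 0)
      nlinarith [abs_nonneg (f 0)]
    · rw [f.map_add_mul]
      have := neg_abs_le (f 0)
      nlinarith [abs_nonneg (f 0)]
  have hlt : ∀ a : Fin (m + 1), f (c + (a : ℕ)) < n + 1 := fun a => by
    have h1 : f (c - 1) < 0 := by
      by_contra h
      have := hc' _ (not_lt.1 h)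
      omega
    have h2 := f.map_add (c - 1)
    have h3 : f (c + (a : ℕ)) ≤ f (c - 1 + (m + 1)) := f.mono (by have := a.2; omega)
    omega
  have hge : ∀ a : Fin (m + 1), 0 ≤ f (c + (a : ℕ)) := fun a => hc.trans (f.mono (by omega))
  refine ⟨⟨fun a => ⟨(f (c + (a : ℕ))).toNat, by have := hlt a; have := hge a; omega⟩,
    fun a b hab => Fin.mk_le_mk.2 (Int.toNat_le_toNat (f.mono (by
      have : (a : ℕ) ≤ b := hab
      omega)))⟩, -c, ?_⟩
  have key : f.comp (trans m c) = ofOrderHom ⟨fun a => ⟨(f (c + (a : ℕ))).toNat, by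
      have := hlt a; have := hge a; omega⟩, fun a b hab => Fin.mk_le_mk.2 (Int.toNat_le_toNat (f.mono (by
      have : (a : ℕ) ≤ b := hab
      omega)))⟩ := by
    refine ext_fin fun a => ?_
    rw [ofOrderHom_apply]
    show f ((a : ℕ) + c) = ((f (c + (a : ℕ))).toNat : ℤ)
    rw [Int.toNat_of_nonneg (hge a), add_comm]
  rw [← key]
  exact ext' fun l => by simp

theorem factor_unique {φ ψ : Fin (m + 1) →o Fin (n + 1)} {i j : ℤ}
    (h : (ofOrderHom φ).comp (trans m i) = (ofOrderHom ψ).comp (trans m j)) : φ = ψ ∧ i = j := by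
  have key : ∀ {φ ψ : Fin (m + 1) →o Fin (n + 1)} {i j : ℤ},
      (ofOrderHom φ).comp (trans m i) = (ofOrderHom ψ).comp (trans m j) → i ≤ j := by
    intro φ ψ i j h
    by_contra hij
    have h1 := DFunLike.congr_fun h (-i)
    simp only [comp_apply, trans_apply, neg_add_cancel] at h1
    have h2 := ofOrderHom_apply φ 0
    have h3 : ofOrderHom ψ (-i + j) ≤ ofOrderHom ψ (-1) := (ofOrderHom ψ).mono (by omega)
    have h4 := ofOrderHom_apply ψ (Fin.last m)
    have h5 := (ofOrderHom ψ).map_add (-1)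
    rw [show (-1 : ℤ) + (m + 1) = ((Fin.last m : ℕ) : ℤ) by simp, h4] at h5
    have h6 := (ψ (Fin.last m)).2
    simp only [Fin.val_zero, Nat.cast_zero] at h2
    omega
  have hij : i = j := le_antisymm (key h) (key h.symm)
  subst hij
  refine ⟨ofOrderHom_injective (ext' fun l => ?_), rfl⟩
  simpa using DFunLike.congr_fun h (l - i)

/-- An invertible morphism is a translation. -/
theorem eq_trans_of_inverse {f : Para m n} {g : Para n m} {a b : ℤ}
    (h1 : ∀ l, g (f l) = l + a) (h2 : ∀ l, f (g l) = l + b) : ∀ l, f l = f 0 + l := by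
  have step : ∀ l, f (l + 1) = f l + 1 := fun l => by
    have hlt : ∀ x y, x < y → f x < f y := fun x y hxy => by
      refine lt_of_le_of_ne (f.mono hxy.le) fun h => ?_
      have := h1 x
      rw [h, h1] at this
      omega
    refine le_antisymm ?_ (hlt l (l + 1) (by omega))
    by_contra h
    push Not at h
    have h3 : f (g (f l + 1 - b)) = f l + 1 := by rw [h2]; ring
    have h4 : l < g (f l + 1 - b) := by
      by_contra hh
      have := f.mono (not_lt.1 hh)
      omega
    have := f.mono (show l + 1 ≤ g (f l + 1 - b) from h4)
    omega
  intro l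
  induction l using Int.induction_on with
  | zero => simp
  | succ i ih => rw [step, ih]; ring
  | pred i ih =>
    have := step (-(i : ℤ) - 1)
    rw [sub_add_cancel, ih] at this
    linarith

end Para

/-! ### Crossed simplicial groups and structured sets -/

/-- A crossed simplicial group: a functor `i : Δ ⥤ ΔG`, bijective on objects, such that every
morphism `i[m] ⟶ i[n]` is uniquely `i(φ) ∘ g` with `φ` in `Δ` and `g` an automorphism of `i[m]`
(in particular `i` is faithful). -/
class IsCrossedSimplicialGroup {D : Type w} [Category.{u} D] (i : SimplexCategory ⥤ D) : Prop where
  bijective_obj : Function.Bijective i.obj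
  existsUnique_factor : ∀ {m n : SimplexCategory} (v : i.obj m ⟶ i.obj n),
    ∃! x : Aut (i.obj m) × (m ⟶ n), v = x.1.hom ≫ i.map x.2

section Structured

variable {D : Type w} [Category.{u} D] (i : SimplexCategory ⥤ D)

/-- The object `[n]` of the crossed simplicial group. -/
abbrev ob (n : ℕ) : D := i.obj (SimplexCategory.mk n)

/-- The group `Aut [n]`; the product is composition, `(g * h).hom = h.hom ≫ g.hom`. -/
abbrev Gen (n : ℕ) := Aut (ob i n)

/-- The `k`-th vertex `[0] ⟶ [n]` in `Δ`. -/
abbrev vertex (n : ℕ) (k : Fin (n + 1)) : SimplexCategory.mk 0 ⟶ SimplexCategory.mk n :=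
  SimplexCategory.const _ _ k

variable [IsCrossedSimplicialGroup i]

/-- The map `{0, …, m} → {0, …, n}` induced by a morphism `v : [m] ⟶ [n]`, under the identification
of `Hom([0], [n]) / Aut [0]` with `Hom_Δ([0], [n]) = {0, …, n}`: the canonical factorization of
`v ∘ k` is `(lam v k) ∘ g` with `g ∈ Aut [0]`. -/
def lam {m n : ℕ} (v : ob i m ⟶ ob i n) (k : Fin (m + 1)) : Fin (n + 1) :=
  (IsCrossedSimplicialGroup.existsUnique_factor (i.map (vertex m k) ≫ v)).choose.2.toOrderHom 0

theorem vertex_lam {m n : ℕ} (v : ob i m ⟶ ob i n) (k : Fin (m + 1)) :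
    ∃ g : Gen i 0, i.map (vertex m k) ≫ v = g.hom ≫ i.map (vertex n (lam i v k)) := by
  refine ⟨(IsCrossedSimplicialGroup.existsUnique_factor (i.map (vertex m k) ≫ v)).choose.1, ?_⟩
  convert (IsCrossedSimplicialGroup.existsUnique_factor
    (i.map (vertex m k) ≫ v)).choose_spec.1 using 3
  ext a
  obtain rfl : a = 0 := Subsingleton.elim (α := Fin 1) _ _
  rfl

theorem lam_eq {m n : ℕ} {v : ob i m ⟶ ob i n} {k : Fin (m + 1)} {l : Fin (n + 1)} {g : Gen i 0}
    (h : i.map (vertex m k) ≫ v = g.hom ≫ i.map (vertex n l)) : lam i v k = l := by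
  have := (IsCrossedSimplicialGroup.existsUnique_factor
    (i.map (vertex m k) ≫ v)).choose_spec.2 (g, vertex n l) h
  rw [lam, ← this]
  rfl

theorem lam_id (n : ℕ) (k : Fin (n + 1)) : lam i (𝟙 (ob i n)) k = k :=
  lam_eq i (g := 1) (by rw [Category.comp_id]; exact (Category.id_comp _).symm)

theorem lam_comp {l m n : ℕ} (v : ob i l ⟶ ob i m) (v' : ob i m ⟶ ob i n) (k : Fin (l + 1)) :
    lam i (v ≫ v') k = lam i v' (lam i v k) := by
  obtain ⟨g, hg⟩ := vertex_lam i v k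
  obtain ⟨g', hg'⟩ := vertex_lam i v' (lam i v k)
  refine lam_eq i (g := g' * g) ?_
  rw [← Category.assoc, hg, Category.assoc, hg', ← Category.assoc]
  rfl

/-- A `ΔG`-structured set: a set `carrier` with `n + 1` elements, and a right torsor `Frame` over
`Aut [n]` with an equivariant map `ρ` to the bijections `{0, …, n} ≃ carrier`. -/
structure StructuredSet where
  carrier : Type u
  n : ℕ
  Frame : Type u
  nonempty_frame : Nonempty Frame
  act : Frame → Gen i n → Frame
  act_one : ∀ f, act f 1 = f
  act_mul : ∀ f g h, act f (g * h) = act (act f g) h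
  existsUnique_act : ∀ f f', ∃! g, act f g = f'
  ρ : Frame → (Fin (n + 1) ≃ carrier)
  ρ_act : ∀ f g k, ρ (act f g) k = ρ f (lam i g.hom k)

namespace StructuredSet

variable {i}

/-- A morphism of structured sets is an equivariant family of morphisms of `ΔG`, indexed by the
frames of the target and of the source. -/
@[ext]
structure Hom (X Y : StructuredSet i) where
  app : Y.Frame → X.Frame → (ob i X.n ⟶ ob i Y.n)
  app_act : ∀ f g f' g', app (Y.act f g) (X.act f' g') = g'.hom ≫ app f f' ≫ g.inv

/-- The unique `g` with `f g = f'`. -/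
def diff (X : StructuredSet i) (f f' : X.Frame) : Gen i X.n := (X.existsUnique_act f f').choose

theorem act_diff (X : StructuredSet i) (f f' : X.Frame) : X.act f (X.diff f f') = f' :=
  (X.existsUnique_act f f').choose_spec.1

theorem diff_eq (X : StructuredSet i) {f f' : X.Frame} {g : Gen i X.n} (h : X.act f g = f') :
    X.diff f f' = g := ((X.existsUnique_act f f').choose_spec.2 g h).symm

/-- A frame of a structured set. -/
def someFrame (X : StructuredSet i) : X.Frame := X.nonempty_frame.some

theorem Hom.app_comp_app {X Y Z : StructuredSet i} (ψ : Hom X Y) (ψ' : Hom Y Z) (f : Z.Frame)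
    (a b : Y.Frame) (f' : X.Frame) : ψ.app a f' ≫ ψ'.app f a = ψ.app b f' ≫ ψ'.app f b := by
  have h1 := ψ.app_act a (Y.diff a b) f' 1
  have h2 := ψ'.app_act f 1 a (Y.diff a b)
  rw [act_diff, act_one] at h1 h2
  rw [h1, h2]
  change _ = (𝟙 _ ≫ _ ≫ _) ≫ _ ≫ _ ≫ 𝟙 _
  simp only [Category.id_comp, Category.comp_id, Category.assoc]
  rw [← Category.assoc (Y.diff a b).inv, (Y.diff a b).inv_hom_id, Category.id_comp]

/-- Composition, `(ψ' ∘ ψ)_{f, f'} = ψ'_{f, a} ∘ ψ_{a, f'}` for any frame `a` of the middle set. -/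
instance : Category.{u} (StructuredSet i) where
  Hom := Hom
  id X :=
    { app := fun f f' => (X.diff f f').hom
      app_act := fun f g f' g' => by
        have : X.diff (X.act f g) (X.act f' g') = g⁻¹ * X.diff f f' * g' := by
          refine X.diff_eq ?_
          rw [← act_mul, mul_assoc, mul_inv_cancel_left, act_mul, act_diff]
        rw [this]
        rfl }
  comp {X Y Z} ψ ψ' :=
    { app := fun f f' => ψ.app Y.someFrame f' ≫ ψ'.app f Y.someFrame
      app_act := fun f g f' g' => by
        have h1 := ψ.app_act Y.someFrame 1 f' g'
        have h2 := ψ'.app_act f g Y.someFrame 1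
        rw [act_one] at h1 h2
        rw [h1, h2]
        change (_ ≫ _ ≫ 𝟙 _) ≫ 𝟙 _ ≫ _ ≫ _ = _
        simp }
  id_comp {X Y} ψ := Hom.ext (funext fun f => funext fun f' => by
    have h := ψ.app_act f 1 X.someFrame (X.diff X.someFrame f')
    rw [act_one, act_diff] at h
    refine Eq.trans ?_ h.symm
    change _ = _ ≫ _ ≫ 𝟙 _
    simp)
  comp_id {X Y} ψ := Hom.ext (funext fun f => funext fun f' => by
    have h := ψ.app_act Y.someFrame (Y.diff Y.someFrame f) f' 1
    rw [act_one, act_diff] at h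
    refine Eq.trans ?_ h.symm
    have : Y.diff f Y.someFrame = (Y.diff Y.someFrame f)⁻¹ := by
      refine Y.diff_eq ?_
      nth_rewrite 1 [← Y.act_diff Y.someFrame f]
      rw [← act_mul, mul_inv_cancel, act_one]
    change ψ.app Y.someFrame f' ≫ (Y.diff f Y.someFrame).hom = 𝟙 _ ≫ _ ≫ _
    rw [this, Category.id_comp]
    rfl)
  assoc ψ ψ' ψ'' := Hom.ext (funext fun f => funext fun f' => Category.assoc _ _ _)

theorem comp_app {X Y Z : StructuredSet i} (ψ : X ⟶ Y) (ψ' : Y ⟶ Z) (f : Z.Frame) (a : Y.Frame)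
    (f' : X.Frame) : Hom.app (ψ ≫ ψ') f f' = Hom.app ψ a f' ≫ Hom.app ψ' f a :=
  Hom.app_comp_app ψ ψ' f _ a f'

theorem id_app (X : StructuredSet i) (f : X.Frame) : Hom.app (𝟙 X) f f = 𝟙 _ := by
  change (X.diff f f).hom = _
  rw [X.diff_eq (X.act_one f)]
  rfl

/-- The map of underlying sets induced by a morphism, computed in the frames `f` and `f'`. -/
def Hom.mapAt {X Y : StructuredSet i} (ψ : Hom X Y) (f : Y.Frame) (f' : X.Frame) :
    X.carrier → Y.carrier :=
  fun x => Y.ρ f (lam i (ψ.app f f') ((X.ρ f').symm x))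

theorem Hom.mapAt_eq {X Y : StructuredSet i} (ψ : Hom X Y) (f₁ f₂ : Y.Frame) (f₁' f₂' : X.Frame) :
    ψ.mapAt f₁ f₁' = ψ.mapAt f₂ f₂' := by
  funext x
  obtain ⟨g, rfl⟩ : ∃ g, Y.act f₁ g = f₂ := ⟨_, Y.act_diff f₁ f₂⟩
  obtain ⟨g', rfl⟩ : ∃ g', X.act f₁' g' = f₂' := ⟨_, X.act_diff f₁' f₂'⟩
  obtain ⟨k, rfl⟩ := (X.ρ (X.act f₁' g')).surjective x
  simp only [mapAt, Equiv.symm_apply_apply, Y.ρ_act, ψ.app_act]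
  rw [X.ρ_act, Equiv.symm_apply_apply, lam_comp, lam_comp, ← lam_comp i g.inv g.hom, g.inv_hom_id,
    lam_id]

/-- The map of underlying sets induced by a morphism. -/
def Hom.map {X Y : StructuredSet i} (ψ : Hom X Y) : X.carrier → Y.carrier :=
  ψ.mapAt Y.someFrame X.someFrame

end StructuredSet

end Structured

/-- The category of nonempty finite sets. -/
abbrev FSet := ObjectProperty.FullSubcategory (fun I : Type u => Finite I ∧ Nonempty I)

/-- The forgetful functor `(I, O(I)) ↦ I`. -/
def StructuredSet.forget {D : Type w} [Category.{u} D] (i : SimplexCategory ⥤ D)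
    [IsCrossedSimplicialGroup i] : StructuredSet i ⥤ FSet.{u} where
  obj X := ⟨X.carrier, Finite.of_equiv _ (X.ρ X.someFrame), ⟨X.ρ X.someFrame 0⟩⟩
  map ψ := ObjectProperty.homMk (TypeCat.ofHom (Hom.map ψ))
  map_id X := by
    apply ObjectProperty.hom_ext
    ext x
    change Hom.map (𝟙 X) x = x
    simp [Hom.map, Hom.mapAt, id_app, lam_id]
  map_comp {X Y Z} ψ ψ' := by
    apply ObjectProperty.hom_ext
    ext x
    change Hom.map (ψ ≫ ψ') x = Hom.map ψ' (Hom.map ψ x)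
    simp [Hom.map, Hom.mapAt, comp_app ψ ψ' _ Y.someFrame, lam_comp]

/-! ### The crossed simplicial group of a planar Lie group -/

/-- Objects of the crossed simplicial group of a planar Lie group: `[n]`, `n ≥ 0`. -/
structure DeltaG (G : PlanarLieGroup.{u}) where
  len : ℕ

namespace DeltaG

variable {G : PlanarLieGroup.{u}}

/-- The identification of `k` full turns in `G` with `k` full turns in the paracyclic category. -/
def homSetoid (G : PlanarLieGroup.{u}) (m n : ℕ) : Setoid (G.base × Para m n) where
  r x y := ∃ k : ℤ, y.1 = x.1 * G.turn k ∧ x.2 = y.2.shift k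
  iseqv :=
    { refl := fun x => ⟨0, by simp [G.turn_zero], Para.ext' fun l => by simp⟩
      symm := by
        rintro ⟨w, f⟩ ⟨w', f'⟩ ⟨k, h1, h2⟩
        dsimp only at h1 h2
        subst h1 h2
        refine ⟨-k, ?_, Para.ext' fun l => by simp⟩
        dsimp only
        rw [mul_assoc, ← G.turn_add, add_neg_cancel, G.turn_zero, mul_one]
      trans := by
        rintro ⟨w, f⟩ ⟨w', f'⟩ ⟨w'', f''⟩ ⟨k, h1, h2⟩ ⟨k', h1', h2'⟩
        dsimp only at h1 h2 h1' h2'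
        subst h1 h2 h1' h2'
        refine ⟨k + k', ?_, Para.ext' fun l => by simp; ring⟩
        dsimp only
        rw [mul_assoc, ← G.turn_add] }

/-- A morphism `[m] ⟶ [n]` is the class of a pair `(w, f)`, standing for `w ∘ f`, where
`w ∈ p⁻¹(O(1))` and `f : [m] ⟶ [n]` is a morphism of the paracyclic category. -/
def Hom (G : PlanarLieGroup.{u}) (m n : ℕ) : Type u := Quotient (homSetoid G m n)

variable {k l m n : ℕ}

/-- The morphism `w ∘ f`. -/
def cls (w : G.base) (f : Para m n) : Hom G m n := Quotient.mk (homSetoid G m n) (w, f)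

theorem cls_eq_iff {w w' : G.base} {f f' : Para m n} :
    cls w f = cls w' f' ↔ ∃ k : ℤ, w' = w * G.turn k ∧ f = f'.shift k := Quotient.eq

theorem exists_cls (v : Hom G m n) : ∃ w f, v = cls w f := by
  obtain ⟨⟨w, f⟩, rfl⟩ := Quotient.exists_rep v
  exact ⟨w, f, rfl⟩

/-- Composition (first `(w, f)`, then `(w', f')`) is `w' ∘ f' ∘ w ∘ f = (w' w) ∘ (f'ʷ ∘ f)`, where
`f'ʷ = w⁻¹ ∘ f' ∘ w` is `f'` or `l ↦ -f' (-l)`, according to the sign of `w`. -/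
def comp (v : Hom G k m) (v' : Hom G m n) : Hom G k n :=
  Quotient.map₂ (fun x y => (y.1 * x.1, (y.2.conj (G.sign (x.1 : G))).comp x.2)) (by
    rintro ⟨w, f⟩ ⟨w₁, f₁⟩ ⟨k, h1, h2⟩ ⟨w', f'⟩ ⟨w₁', f₁'⟩ ⟨k', h1', h2'⟩
    dsimp only at h1 h2 h1' h2'
    subst h1 h2 h1' h2'
    have hs : G.sign ((w * G.turn k : G.base) : G) = G.sign (w : G) := by
      rw [Subgroup.coe_mul, map_mul, G.sign_turn, mul_one]
    refine ⟨((G.sign (w : G) : ℤˣ) : ℤ) * k' + k, ?_, Para.ext' fun l => ?_⟩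
    · dsimp only
      have h := G.mul_turn w (((G.sign (w : G) : ℤˣ) : ℤ) * k')
      have h2 : ((G.sign (w : G) : ℤˣ) : ℤ) * (((G.sign (w : G) : ℤˣ) : ℤ) * k') = k' := by
        rcases Int.units_eq_one_or (G.sign (w : G)) with h | h <;> rw [h] <;> simp
      rw [h2] at h
      rw [G.turn_add, mul_assoc w' w, ← mul_assoc w, h]
      simp only [mul_assoc]
    · dsimp only
      rw [hs]
      rcases Int.units_eq_one_or (G.sign (w : G)) with h | h <;> rw [h]
      · simp [Para.map_add_mul]; ring
      · have := f₁'.map_add_mul (-f₁ l) (-k)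
        simp only [Para.comp_apply, Para.conj_apply, Para.shift_apply, Units.val_neg, Units.val_one]
        rw [show -1 * (f₁ l + k * (m + 1 : ℤ)) = -f₁ l + -k * (m + 1) by ring, this,
          neg_one_mul (f₁ l)]
        ring) v v'

theorem comp_cls (w : G.base) (f : Para k m) (w' : G.base) (f' : Para m n) :
    comp (cls w f) (cls w' f') = cls (w' * w) ((f'.conj (G.sign (w : G))).comp f) := rfl

/-- The identity morphism. -/
def idHom (n : ℕ) : Hom G n n := cls 1 (Para.trans n 0)

theorem id_comp (v : Hom G m n) : comp (idHom m) v = v := by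
  obtain ⟨w, f, rfl⟩ := exists_cls v
  rw [idHom, comp_cls, mul_one]
  congr 1
  exact Para.ext' fun l => by simp

theorem comp_id (v : Hom G m n) : comp v (idHom n) = v := by
  obtain ⟨w, f, rfl⟩ := exists_cls v
  rw [idHom, comp_cls, one_mul]
  congr 1
  refine Para.ext' fun l => ?_
  rcases Int.units_eq_one_or (G.sign (w : G)) with h | h <;> simp [h]

theorem comp_assoc (v : Hom G k l) (v' : Hom G l m) (v'' : Hom G m n) :
    comp (comp v v') v'' = comp v (comp v' v'') := by
  obtain ⟨w, f, rfl⟩ := exists_cls v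
  obtain ⟨w', f', rfl⟩ := exists_cls v'
  obtain ⟨w'', f'', rfl⟩ := exists_cls v''
  simp only [comp_cls, mul_assoc]
  congr 1
  refine Para.ext' fun l => ?_
  rcases Int.units_eq_one_or (G.sign (w : G)) with h | h <;>
    rcases Int.units_eq_one_or (G.sign (w' : G)) with h' | h' <;> simp [h, h']

/-- The morphism of `ΔG` given by a morphism of `Δ`, that is, the class of `(1, f)` where `f` is the
periodic extension. -/
def ofOrderHom (φ : Fin (m + 1) →o Fin (n + 1)) : Hom G m n := cls 1 (Para.ofOrderHom φ)

theorem ofOrderHom_comp (φ : Fin (k + 1) →o Fin (m + 1)) (ψ : Fin (m + 1) →o Fin (n + 1)) :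
    (ofOrderHom (ψ.comp φ) : Hom G k n) = comp (ofOrderHom φ) (ofOrderHom ψ) := by
  rw [ofOrderHom, ofOrderHom, ofOrderHom, comp_cls, mul_one, Para.ofOrderHom_comp]
  refine congrArg (cls 1) (Para.ext' fun l => ?_)
  simp

/-- The morphism `w ∘ τʲ` from `[n]` to `[n]`, where `τ : l ↦ l + 1`. -/
def autHom (n : ℕ) (w : G.base) (j : ℤ) : Hom G n n := cls w (Para.trans n j)

theorem exists_inverse (w : G.base) (j : ℤ) : ∃ v : Hom G n n,
    comp (autHom n w j) v = idHom n ∧ comp v (autHom n w j) = idHom n := by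
  refine ⟨autHom n w⁻¹ (-((G.sign (w : G) : ℤˣ) : ℤ) * j), ?_, ?_⟩
  · rw [autHom, autHom, comp_cls, inv_mul_cancel]
    refine congrArg (cls 1) (Para.ext' fun l => ?_)
    rcases Int.units_eq_one_or (G.sign (w : G)) with h | h <;> simp [h]
  · rw [autHom, autHom, comp_cls, mul_inv_cancel]
    refine congrArg (cls 1) (Para.ext' fun l => ?_)
    rcases Int.units_eq_one_or (G.sign (w : G)) with h | h <;> simp [h]

theorem eq_autHom_of_inverse {g g' : Hom G n n} (h1 : comp g g' = idHom n)
    (h2 : comp g' g = idHom n) : ∃ w j, g = autHom n w j := by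
  obtain ⟨w, f, rfl⟩ := exists_cls g
  obtain ⟨w', f', rfl⟩ := exists_cls g'
  rw [idHom, comp_cls, cls_eq_iff] at h1 h2
  obtain ⟨a, ha, hf⟩ := h1
  obtain ⟨b, hb, hf'⟩ := h2
  have hs : G.sign (w' : G) = G.sign (w : G) := by
    have := congrArg (fun x : G.base => G.sign (x : G)) ha
    simp only [Subgroup.coe_mul, map_mul, G.sign_turn, mul_one, Subgroup.coe_one, map_one] at this
    rcases Int.units_eq_one_or (G.sign (w : G)) with h | h <;>
      rcases Int.units_eq_one_or (G.sign (w' : G)) with h' | h' <;> rw [h, h'] at this ⊢ <;>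
      revert this <;> decide
  have key : ∀ l, f l = f 0 + l := by
    refine Para.eq_trans_of_inverse (g := f'.conj (G.sign (w : G))) (a := a * (n + 1))
      (b := ((G.sign (w : G) : ℤˣ) : ℤ) * b * (n + 1)) (fun l => ?_) (fun l => ?_)
    · simpa using DFunLike.congr_fun hf l
    · have := DFunLike.congr_fun hf' (((G.sign (w : G) : ℤˣ) : ℤ) * l)
      rw [hs] at this
      rcases Int.units_eq_one_or (G.sign (w : G)) with h | h <;> rw [h] at this ⊢ <;>
        simp at this ⊢ <;> linarith
  refine ⟨w, f 0, congrArg (cls w) (Para.ext' fun l => ?_)⟩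
  rw [key, Para.trans_apply, add_comm]

theorem autHom_comp_ofOrderHom (w : G.base) (j : ℤ) (φ : Fin (m + 1) →o Fin (n + 1)) :
    comp (autHom m w j) (ofOrderHom φ) =
      cls w (((Para.ofOrderHom φ).comp
        (Para.trans m (((G.sign (w : G) : ℤˣ) : ℤ) * j))).conj (G.sign (w : G))) := by
  rw [autHom, ofOrderHom, comp_cls, one_mul]
  refine congrArg (cls w) (Para.ext' fun l => ?_)
  rcases Int.units_eq_one_or (G.sign (w : G)) with h | h <;> simp [h, add_comm]

theorem sign_mul_sign_mul (ε : ℤˣ) (j : ℤ) : (ε : ℤ) * ((ε : ℤ) * j) = j := by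
  rcases Int.units_eq_one_or ε with rfl | rfl <;> simp

theorem conj_conj (ε : ℤˣ) (g : Para m n) : (g.conj ε).conj ε = g := by
  refine Para.ext' fun l => ?_
  rcases Int.units_eq_one_or ε with rfl | rfl <;> simp

theorem exists_factor (v : Hom G m n) :
    ∃ w j φ, v = comp (autHom m w j) (ofOrderHom φ) := by
  obtain ⟨w, f, rfl⟩ := exists_cls v
  obtain ⟨φ, j, hφ⟩ := (f.conj (G.sign (w : G))).exists_factor
  refine ⟨w, ((G.sign (w : G) : ℤˣ) : ℤ) * j, φ, ?_⟩
  rw [autHom_comp_ofOrderHom, sign_mul_sign_mul, ← hφ, conj_conj]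

theorem factor_unique {w w' : G.base} {j j' : ℤ} {φ φ' : Fin (m + 1) →o Fin (n + 1)}
    (h : comp (autHom m w j) (ofOrderHom φ) = comp (autHom m w' j') (ofOrderHom φ')) :
    autHom m w j = autHom m w' j' ∧ φ = φ' := by
  rw [autHom_comp_ofOrderHom, autHom_comp_ofOrderHom, cls_eq_iff] at h
  obtain ⟨k, rfl, hk⟩ := h
  have hs : G.sign ((w * G.turn k : G.base) : G) = G.sign (w : G) := by
    rw [Subgroup.coe_mul, map_mul, G.sign_turn, mul_one]
  rw [hs] at hk
  have h1 : (Para.ofOrderHom φ).comp (Para.trans m (((G.sign (w : G) : ℤˣ) : ℤ) * j)) =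
      (Para.ofOrderHom φ').comp
        (Para.trans m (((G.sign (w : G) : ℤˣ) : ℤ) * (j' + k * (m + 1)))) := by
    rw [← conj_conj (G.sign (w : G)) (Para.comp _ _), hk]
    refine Para.ext' fun l => ?_
    have := (Para.ofOrderHom φ').map_add_mul (l + ((G.sign (w : G) : ℤˣ) : ℤ) * j')
      (((G.sign (w : G) : ℤˣ) : ℤ) * k)
    simp only [Para.shift_apply, Para.conj_apply, Para.comp_apply, Para.trans_apply,
      sign_mul_sign_mul]
    rw [show l + ((G.sign (w : G) : ℤˣ) : ℤ) * (j' + k * (m + 1)) =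
      l + ((G.sign (w : G) : ℤˣ) : ℤ) * j' + ((G.sign (w : G) : ℤˣ) : ℤ) * k * (m + 1) by ring, this,
      mul_add, sign_mul_sign_mul]
    ring
  obtain ⟨h2, h3⟩ := Para.factor_unique h1
  have h4 : j = j' + k * (m + 1) := by
    rw [← sign_mul_sign_mul (G.sign (w : G)) j, h3, sign_mul_sign_mul]
  refine ⟨cls_eq_iff.2 ⟨k, rfl, Para.ext' fun l => ?_⟩, h2⟩
  simp only [Para.trans_apply, Para.shift_apply, h4]
  ring

/-- The crossed simplicial group `ΔG` of the planar Lie group `G`: the category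
`(p⁻¹(O(1)) ⋉ Λ_∞) / ℤ`, where `Λ_∞` is the paracyclic category, `p⁻¹(O(1))` acts on it through the
sign and the involution `f ↦ (l ↦ -f (-l))`, and a full turn of `G` is identified with the full turn
`l ↦ l + (n + 1)` of `[n]`. The group `Aut [n]` is `p⁻¹(D_{n + 1})`, by `w ∘ τʲ ↦ w e(j / (n + 1))`.

For the universal covering of `SO(2)` this is `Λ_∞`; for `SO(2)` and its `N`-fold covering it is
`Λ_∞` with `f` and `f + r N (n + 1)` identified, the cyclic category `Λ` and the `N`-cyclic category
`Λ_N`; for `O(2)`, `Pin⁺_N(2)` and the semidirect product of `ℤ/2` and `ℝ` it consists of the maps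
`w ∘ f` which preserve or reverse the order, modulo the same identification (`N = 1`, `N`, none):
the dihedral, `N`-dihedral and paradihedral categories; for `Pin⁻_{2N}(2)`, where
`p⁻¹(O(1))` is the quaternionic group `Q_N` and `Aut [n] = Q_{N(n+1)}`, the `N`-quaternionic
category. -/
instance : Category.{u} (DeltaG G) where
  Hom X Y := Hom G X.len Y.len
  id X := idHom X.len
  comp v v' := comp v v'
  id_comp := id_comp
  comp_id := comp_id
  assoc := comp_assoc

/-- The embedding `Δ → ΔG`; its image consists of the classes of those `(1, f)` for which
`f {0, …, m} ⊆ {0, …, n}`. -/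
def incl (G : PlanarLieGroup.{u}) : SimplexCategory ⥤ DeltaG G where
  obj n := ⟨n.len⟩
  map φ := ofOrderHom φ.toOrderHom
  map_id _ := congrArg (cls 1) Para.ofOrderHom_id
  map_comp φ ψ := ofOrderHom_comp φ.toOrderHom ψ.toOrderHom

instance (G : PlanarLieGroup.{u}) : IsCrossedSimplicialGroup (incl G) where
  bijective_obj := ⟨fun a b h => by
    have : a.len = b.len := congrArg DeltaG.len h
    exact SimplexCategory.ext this, fun X => ⟨SimplexCategory.mk X.len, rfl⟩⟩
  existsUnique_factor {m n} v := by
    obtain ⟨w, j, φ, hv⟩ := exists_factor (G := G) (m := m.len) (n := n.len) v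
    obtain ⟨v', h1, h2⟩ := exists_inverse (n := m.len) w j
    refine ⟨(⟨autHom m.len w j, v', h1, h2⟩, SimplexCategory.Hom.mk φ), hv, ?_⟩
    rintro ⟨g, ψ⟩ hg
    obtain ⟨w', j', hg'⟩ := eq_autHom_of_inverse (G := G) (n := m.len) g.hom_inv_id g.inv_hom_id
    have h3 : comp (autHom m.len w' j') (ofOrderHom ψ.toOrderHom) =
        comp (autHom m.len w j) (ofOrderHom φ) := by
      rw [← hg', ← hv]
      exact hg.symm
    obtain ⟨h4, h5⟩ := factor_unique h3
    refine Prod.ext (Iso.ext (hg'.trans h4)) (SimplexCategory.Hom.ext _ _ h5)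

end DeltaG

/-! ### Planar homeomorphism groups and structured marked circles -/

/-- The planar homeomorphism group `Homeo^G(S¹)` of a planar Lie group `p : G → O(2)`: a connective
covering `q` of `Homeo(S¹)` together with an identification of `G` with its pullback to `O(2)`. It is
determined up to isomorphism by `G`. -/
structure PlanarHomeoGroup (G : PlanarLieGroup.{u}) where
  carrier : Type u
  [group : Group carrier]
  [topology : TopologicalSpace carrier]
  [isTopologicalGroup : IsTopologicalGroup carrier]
  q : carrier →* (Circle ≃ₜ Circle)
  connective : IsConnectiveCovering q
  incl : G →* carrier
  q_incl : ∀ g, q (incl g) = O2.toHomeo (G.p g)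
  isEmbedding : IsEmbedding fun g : G => (G.p g, incl g)
  exists_eq : ∀ (A : O2) (h : carrier), O2.toHomeo A = q h → ∃ g, G.p g = A ∧ incl g = h

namespace PlanarHomeoGroup

variable {G : PlanarLieGroup.{u}}

instance : CoeSort (PlanarHomeoGroup G) (Type u) := ⟨carrier⟩

attribute [instance] group topology isTopologicalGroup

end PlanarHomeoGroup

variable {G : PlanarLieGroup.{u}}

/-- A `G`-structured marked circle: a space `C` homeomorphic to the circle, with a reduction of the
structure group `ρ : F → Homeo(S¹, C)`, where `F` is a right torsor over the topological group
`Homeo^G(S¹)`, and with a nonempty closed subset `J` which is homeomorphic to a finite disjoint union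
of intervals `[0, 1]`. -/
structure MarkedCircle (H : PlanarHomeoGroup G) where
  C : Type u
  [topC : TopologicalSpace C]
  nonempty_homeo : Nonempty (Circle ≃ₜ C)
  F : Type u
  [topF : TopologicalSpace F]
  nonempty_F : Nonempty F
  act : F → H → F
  act_one : ∀ x, act x 1 = x
  act_mul : ∀ x g h, act x (g * h) = act (act x g) h
  isHomeomorph_act : ∀ x, IsHomeomorph (act x)
  ρ : F → (Circle ≃ₜ C)
  ρ_act : ∀ x h z, ρ (act x h) z = ρ x (H.q h z)
  J : Set C
  nonempty_J : J.Nonempty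
  isClosed_J : IsClosed J
  exists_intervals : ∃ k : ℕ, Nonempty (J ≃ₜ Fin k × unitInterval)

namespace MarkedCircle

variable {H : PlanarHomeoGroup G}

attribute [instance] topC topF

/-- Structured homeomorphisms `(φ, φ̃)` of the underlying structured circles. -/
@[ext]
structure StructuredHomeo (X Y : MarkedCircle H) where
  φ : X.C ≃ₜ Y.C
  φt : X.F ≃ₜ Y.F
  φt_act : ∀ x h, φt (X.act x h) = Y.act (φt x) h
  ρ_φt : ∀ x z, Y.ρ (φt x) z = φ (X.ρ x z)

/-- The pair of maps underlying a structured homeomorphism. -/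
def StructuredHomeo.toProd {X Y : MarkedCircle H} (a : StructuredHomeo X Y) :
    (X.C ≃ₜ Y.C) × (X.F → Y.F) := (a.φ, a.φt)

/-- The natural topology: compact-open convergence of `φ` and pointwise convergence of the
equivariant map `φ̃` (evaluation of `φ̃` at any point identifies the space of all `(φ, φ̃)` with the
torsor of `Y`). -/
instance (X Y : MarkedCircle H) : TopologicalSpace (StructuredHomeo X Y) :=
  TopologicalSpace.induced StructuredHomeo.toProd inferInstance

theorem continuous_toProd {X Y : MarkedCircle H} :
    Continuous (StructuredHomeo.toProd : StructuredHomeo X Y → _) := continuous_induced_dom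

/-- The space of structured homeomorphisms with `φ(J) ⊆ J'`, with the subspace topology. -/
abbrev MarkedHomeo (X Y : MarkedCircle H) : Type u :=
  {a : StructuredHomeo X Y // Set.MapsTo a.φ X.J Y.J}

/-- The identity. -/
def MarkedHomeo.id (X : MarkedCircle H) : MarkedHomeo X X :=
  ⟨⟨Homeomorph.refl _, Homeomorph.refl _, fun _ _ => rfl, fun _ _ => rfl⟩, fun _ h => h⟩

/-- Composition: first `a`, then `b`. -/
def MarkedHomeo.comp {X Y Z : MarkedCircle H} (a : MarkedHomeo X Y) (b : MarkedHomeo Y Z) :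
    MarkedHomeo X Z :=
  ⟨⟨a.1.φ.trans b.1.φ, a.1.φt.trans b.1.φt,
    fun x h => by simp [a.1.φt_act, b.1.φt_act], fun x z => by simp [a.1.ρ_φt, b.1.ρ_φt]⟩,
    fun _ h => b.2 (a.2 h)⟩

theorem continuous_φ (X Y : MarkedCircle H) :
    Continuous fun a : MarkedHomeo X Y => (a.1.φ : C(X.C, Y.C)) :=
  (continuous_induced_dom (f := fun φ : X.C ≃ₜ Y.C => (φ : C(X.C, Y.C)))).comp
    (continuous_fst.comp (continuous_toProd.comp continuous_subtype_val))

theorem continuous_φt (X Y : MarkedCircle H) (x : X.F) :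
    Continuous fun a : MarkedHomeo X Y => a.1.φt x :=
  (continuous_apply x).comp
    (continuous_snd.comp (continuous_toProd.comp continuous_subtype_val))

theorem continuous_of {T : Type*} [TopologicalSpace T] {X Y : MarkedCircle H}
    {f : T → MarkedHomeo X Y} (h1 : Continuous fun t => ((f t).1.φ : C(X.C, Y.C)))
    (h2 : ∀ x, Continuous fun t => (f t).1.φt x) : Continuous f :=
  continuous_induced_rng.2 (continuous_induced_rng.2
    (Continuous.prodMk (f := fun t => (f t).1.φ) (g := fun t => ⇑(f t).1.φt)
      (continuous_induced_rng.2 h1) (continuous_pi h2)))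

theorem continuous_comp_left {X Y Z : MarkedCircle H} (a : MarkedHomeo X Y) :
    Continuous fun b : MarkedHomeo Y Z => a.comp b :=
  continuous_of ((ContinuousMap.continuous_precomp (a.1.φ : C(X.C, Y.C))).comp (continuous_φ Y Z))
    fun x => continuous_φt Y Z (a.1.φt x)

theorem continuous_comp_right {X Y Z : MarkedCircle H} (b : MarkedHomeo Y Z) :
    Continuous fun a : MarkedHomeo X Y => a.comp b :=
  continuous_of ((ContinuousMap.continuous_postcomp (b.1.φ : C(Y.C, Z.C))).comp (continuous_φ X Y))
    fun x => b.1.φt.continuous.comp (continuous_φt X Y x)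

/-- The category of `G`-structured marked circles; morphisms are connected components of the spaces
of structured homeomorphisms with `φ(J) ⊆ J'`. -/
instance : Category.{u} (MarkedCircle H) where
  Hom X Y := ZerothHomotopy (MarkedHomeo X Y)
  id X := ZerothHomotopy.mk (MarkedHomeo.id X)
  comp {X Y Z} := Quotient.map₂ MarkedHomeo.comp (by
    rintro a a' ⟨γ⟩ b b' ⟨δ⟩
    exact ⟨(γ.map (continuous_comp_right b)).trans (δ.map (continuous_comp_left a'))⟩)
  id_comp := by rintro X Y ⟨a⟩; rfl
  comp_id := by rintro X Y ⟨a⟩; rfl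
  assoc := by rintro X Y Z W ⟨a⟩ ⟨b⟩ ⟨c⟩; rfl

theorem finite_pi0 (X : MarkedCircle H) : Finite (ZerothHomotopy X.J) := by
  obtain ⟨k, ⟨e⟩⟩ := X.exists_intervals
  refine Finite.of_surjective (fun a : Fin k => ZerothHomotopy.mk (e.symm (a, 0))) ?_
  rintro ⟨x⟩
  refine ⟨(e x).1, ?_⟩
  let γ : Path (0 : unitInterval) (e x).2 := ⟨⟨fun t => t * (e x).2, by fun_prop⟩, by simp, by simp⟩
  have h : Continuous fun t : unitInterval => e.symm ((e x).1, t) := by fun_prop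
  exact ZerothHomotopy.sound ((γ.map h).cast rfl (by simp))

/-- The map `J → J'` induced by a structured homeomorphism with `φ(J) ⊆ J'`. -/
def MarkedHomeo.onJ {X Y : MarkedCircle H} (a : MarkedHomeo X Y) (x : X.J) : Y.J :=
  ⟨a.1.φ x, a.2 x.2⟩

/-- The map `π₀(J) → π₀(J')` induced by a structured homeomorphism with `φ(J) ⊆ J'`. -/
def MarkedHomeo.onPi0 {X Y : MarkedCircle H} (a : MarkedHomeo X Y) :
    ZerothHomotopy X.J → ZerothHomotopy Y.J :=
  ZerothHomotopy.lift (fun x => ZerothHomotopy.mk (a.onJ x)) (fun _ _ γ =>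
    ZerothHomotopy.sound (γ.map (f := a.onJ)
      ((a.1.φ.continuous.comp continuous_subtype_val).subtype_mk _)))

/-- The functor `(C, J) ↦ π₀(J)` to nonempty finite sets. -/
def pi0 (H : PlanarHomeoGroup G) : MarkedCircle H ⥤ FSet.{u} where
  obj X := ⟨ZerothHomotopy X.J, X.finite_pi0,
    have : Nonempty X.J := X.nonempty_J.to_subtype
    inferInstance⟩
  map {X Y} a := ObjectProperty.homMk (TypeCat.ofHom
    (ZerothHomotopy.lift MarkedHomeo.onPi0 (fun a b γ => by
      funext x
      obtain ⟨x, rfl⟩ := ZerothHomotopy.mk_surjective x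
      exact ZerothHomotopy.sound (γ.map (f := fun c : MarkedHomeo X Y => c.onJ x)
        (((continuous_eval_const x.1).comp (continuous_φ X Y)).subtype_mk _))) a))
  map_id X := by
    apply ObjectProperty.hom_ext
    ext x
    obtain ⟨x, rfl⟩ := ZerothHomotopy.mk_surjective x
    rfl
  map_comp {X Y Z} a b := by
    apply ObjectProperty.hom_ext
    ext x
    obtain ⟨x, rfl⟩ := ZerothHomotopy.mk_surjective x
    obtain ⟨a, rfl⟩ := ZerothHomotopy.mk_surjective a
    obtain ⟨b, rfl⟩ := ZerothHomotopy.mk_surjective b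
    rfl

/-- The point `exp(2πik/(n+1))` of the circle. -/
def root (n : ℕ) (k : Fin (n + 1)) : Circle := Circle.exp (2 * Real.pi * (k : ℕ) / (n + 1))

/-- The space `F_J` of those `x ∈ F` for which the homeomorphism `ρ(x)` sends the `(n+1)`-st roots of
unity into `J`, exactly one of them into each component of `J`. -/
abbrev FrameSpace (X : MarkedCircle H) (n : ℕ) : Type u :=
  {x : X.F // ∃ h : ∀ k, X.ρ x (root n k) ∈ X.J,
    Function.Bijective fun k => ZerothHomotopy.mk (⟨X.ρ x (root n k), h k⟩ : X.J)}

/-- The component of `J` which contains the image of the `k`-th root of unity. -/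
def FrameSpace.component {X : MarkedCircle H} {n : ℕ} (x : X.FrameSpace n) (k : Fin (n + 1)) :
    ZerothHomotopy X.J :=
  ZerothHomotopy.mk ⟨X.ρ x.1 (root n k), x.2.1 k⟩

end MarkedCircle

end

end PlanarCSG

open PlanarCSG

namespace PlanarCSG

noncomputable section

open unitInterval

/-! ### The universal covering of the circle -/

/-- The universal covering `t ↦ exp(2πit)` of the circle. -/
def ez (t : ℝ) : Circle := Circle.exp (2 * Real.pi * t)

theorem ez_add (s t : ℝ) : ez (s + t) = ez s * ez t := by
  rw [ez, mul_add, Circle.exp_add]; rfl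

theorem ez_zero : ez 0 = 1 := by simp [ez]

theorem ez_int (k : ℤ) : ez k = 1 := Circle.exp_two_pi_mul_int k

theorem ez_add_int (t : ℝ) (k : ℤ) : ez (t + k) = ez t := by rw [ez_add, ez_int, mul_one]

theorem ez_eq_iff {s t : ℝ} : ez s = ez t ↔ ∃ k : ℤ, s = t + k := by
  rw [ez, ez, Circle.exp_eq_exp]
  refine exists_congr fun k => ?_
  have := Real.pi_pos
  constructor
  · intro h
    have : 2 * Real.pi * s = 2 * Real.pi * (t + k) := by linarith
    exact mul_left_cancel₀ (by positivity) this
  · rintro rfl; ring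

theorem ez_surjective : Function.Surjective ez := fun z =>
  ⟨Complex.arg z / (2 * Real.pi), by
    have := Real.pi_pos
    rw [ez, mul_div_cancel₀ _ (by positivity), Circle.exp_arg]⟩

theorem isCoveringMap_ez : IsCoveringMap ez :=
  Circle.isCoveringMap_exp.comp_homeomorph
    (Homeomorph.mulLeft₀ (2 * Real.pi) (by have := Real.pi_pos; positivity))

theorem continuous_ez : Continuous ez := isCoveringMap_ez.continuous

theorem isOpenQuotientMap_ez : IsOpenQuotientMap ez :=
  ⟨ez_surjective, continuous_ez, isCoveringMap_ez.isOpenMap⟩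

/-- A continuous function of period `1` takes the same value at two points at distance `1 / 2`. -/
theorem exists_add_half_eq {f : ℝ → ℝ} (hf : Continuous f) (h : f 1 = f 0) :
    ∃ t, f (t + 1 / 2) = f t := by
  have hc : Continuous fun t => f (t + 1 / 2) - f t := by fun_prop
  obtain ⟨t, ht⟩ : ∃ t, f (t + 1 / 2) - f t = 0 := by
    have h0 : f (0 + 1 / 2) - f 0 = -(f (1 / 2 + 1 / 2) - f (1 / 2)) := by
      norm_num [h]
    rcases le_total (f (0 + 1 / 2) - f 0) 0 with h1 | h1
    · exact mem_range_of_exists_le_of_exists_ge hc ⟨0, h1⟩ ⟨1 / 2, by linarith⟩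
    · exact mem_range_of_exists_le_of_exists_ge hc ⟨1 / 2, by linarith⟩ ⟨0, h1⟩
  exact ⟨t, by linarith⟩

theorem half_ne_int (k : ℤ) : (1 / 2 : ℝ) ≠ k := fun h => by
  have h1 : (1 : ℝ) = ((2 * k : ℤ) : ℝ) := by push_cast; linarith
  have h2 : (1 : ℤ) = 2 * k := by exact_mod_cast h1
  omega

theorem not_injective_of_continuous {f : Circle → ℝ} (hf : Continuous f) :
    ¬ Function.Injective f := fun hi => by
  have h1 : ez 1 = ez 0 := by simpa using ez_add_int 0 1
  obtain ⟨t, ht⟩ := exists_add_half_eq (f := fun t => f (ez t)) (hf.comp continuous_ez)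
    (by simp only [h1])
  obtain ⟨k, hk⟩ := ez_eq_iff.1 (hi ht)
  exact half_ne_int k (by linarith)

/-! ### The group of lifts of orientation preserving homeomorphisms of the circle -/

/-- The group of increasing homeomorphisms of the line which commute with the translation by `1`. -/
def liftGroup : Subgroup (ℝ ≃o ℝ) where
  carrier := {l | ∀ t, l (t + 1) = l t + 1}
  mul_mem' {a b} ha hb t := by
    show a (b (t + 1)) = a (b t) + 1
    rw [hb, ha]
  one_mem' t := rfl
  inv_mem' {a} ha t := by
    show a.symm (t + 1) = a.symm t + 1
    rw [OrderIso.symm_apply_eq, ha, OrderIso.apply_symm_apply]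

namespace liftGroup

theorem mul_apply (a b : liftGroup) (t : ℝ) : (a * b).1 t = a.1 (b.1 t) := rfl

theorem one_apply (t : ℝ) : (1 : liftGroup).1 t = t := rfl

theorem inv_apply_self (a : liftGroup) (t : ℝ) : a⁻¹.1 (a.1 t) = t := a.1.symm_apply_apply t

theorem apply_inv_self (a : liftGroup) (t : ℝ) : a.1 (a⁻¹.1 t) = t := a.1.apply_symm_apply t

theorem ext {a b : liftGroup} (h : ∀ t, a.1 t = b.1 t) : a = b :=
  Subtype.ext (DFunLike.ext _ _ h)

theorem add_int_of_add_one {g : ℝ → ℝ} {d : ℝ} (hg : ∀ t, g (t + 1) = g t + d) (t : ℝ) (k : ℤ) :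
    g (t + k) = g t + k * d := by
  induction k using Int.induction_on with
  | zero => simp
  | succ i ih =>
    push_cast at ih ⊢
    rw [← add_assoc, hg, ih]; ring
  | pred i ih =>
    have := hg (t + ((-(i : ℤ) - 1 : ℤ) : ℝ))
    push_cast at ih this ⊢
    rw [show t + (-(i : ℝ) - 1) + 1 = t + -(i : ℝ) by ring, ih] at this
    linarith

theorem apply_add_int (a : liftGroup) (t : ℝ) (k : ℤ) : a.1 (t + k) = a.1 t + k := by
  simpa using add_int_of_add_one (g := a.1) a.2 t k

theorem exists_coe_eq_of_surjective {g : ℝ → ℝ} (hm : StrictMono g) (hs : Function.Surjective g)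
    (hp : ∀ t, g (t + 1) = g t + 1) : ∃ l : liftGroup, ∀ t, l.1 t = g t :=
  ⟨⟨hm.orderIsoOfSurjective g hs, hp⟩, fun _ => rfl⟩

theorem exists_coe_eq {g : ℝ → ℝ} (hm : StrictMono g) (hc : Continuous g)
    (hp : ∀ t, g (t + 1) = g t + 1) : ∃ l : liftGroup, ∀ t, l.1 t = g t := by
  refine exists_coe_eq_of_surjective hm (fun v => ?_) hp
  have hk := fun k : ℤ => add_int_of_add_one hp 0 k
  refine mem_range_of_exists_le_of_exists_ge hc ⟨0 + (⌊v - g 0⌋ : ℤ), ?_⟩ ⟨0 + (⌈v - g 0⌉ : ℤ), ?_⟩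
  · rw [hk]; have := Int.floor_le (v - g 0); linarith
  · rw [hk]; have := Int.le_ceil (v - g 0); linarith

/-- The topology of locally uniform convergence. -/
instance : TopologicalSpace liftGroup :=
  TopologicalSpace.induced (fun l => (⟨l.1, l.1.continuous⟩ : C(ℝ, ℝ))) inferInstance

theorem continuous_eval : Continuous fun x : liftGroup × ℝ => x.1.1 x.2 := by
  have h : Continuous fun l : liftGroup => (⟨l.1, l.1.continuous⟩ : C(ℝ, ℝ)) :=
    continuous_induced_dom
  exact ContinuousEval.continuous_eval.comp (h.prodMap continuous_id)

theorem continuous_of_uncurry {T : Type*} [TopologicalSpace T] {f : T → liftGroup}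
    (h : Continuous fun x : T × ℝ => (f x.1).1 x.2) : Continuous f :=
  continuous_induced_rng.2 (ContinuousMap.continuous_of_continuous_uncurry _ h)

theorem continuous_apply (t : ℝ) : Continuous fun l : liftGroup => l.1 t :=
  continuous_eval.comp (continuous_id.prodMk continuous_const)

theorem continuous_mul : Continuous fun x : liftGroup × liftGroup => x.1 * x.2 := by
  refine continuous_of_uncurry ?_
  have h1 : Continuous fun x : (liftGroup × liftGroup) × ℝ => x.1.2.1 x.2 :=
    continuous_eval.comp ((continuous_snd.comp continuous_fst).prodMk continuous_snd)
  exact continuous_eval.comp ((continuous_fst.comp continuous_fst).prodMk h1)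

/-- The translation by `t`. -/
def transl (t : ℝ) : liftGroup := ⟨OrderIso.addRight t, fun s => by simp; ring⟩

@[simp] theorem transl_apply (t s : ℝ) : (transl t).1 s = s + t := rfl

theorem continuous_transl : Continuous transl :=
  continuous_of_uncurry (by simp only [transl_apply]; fun_prop)

theorem exists_segment (a b : liftGroup) (s : I) :
    ∃ l : liftGroup, ∀ t, l.1 t = (1 - (s : ℝ)) * a.1 t + s * b.1 t := by
  have ha := a.1.continuous
  have hb := b.1.continuous
  refine exists_coe_eq (fun x y hxy => ?_) (by fun_prop) (fun t => ?_)
  · have h1 := a.1.strictMono hxy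
    have h2 := b.1.strictMono hxy
    have hs0 := s.2.1
    rcases s.2.2.eq_or_lt with hs | hs
    · rw [hs]; simpa using h2
    · have := mul_lt_mul_of_pos_left h1 (sub_pos.2 hs)
      have := mul_le_mul_of_nonneg_left h2.le hs0
      linarith
  · rw [a.2, b.2]; ring

/-- The point `(1 - s) a + s b` of the segment from `a` to `b`. -/
def segment (a b : liftGroup) (s : I) : liftGroup := (exists_segment a b s).choose

theorem segment_apply (a b : liftGroup) (s : I) (t : ℝ) :
    (segment a b s).1 t = (1 - (s : ℝ)) * a.1 t + s * b.1 t :=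
  (exists_segment a b s).choose_spec t

theorem segment_zero (a b : liftGroup) : segment a b 0 = a := ext fun t => by simp [segment_apply]

theorem segment_one (a b : liftGroup) : segment a b 1 = b := ext fun t => by simp [segment_apply]

theorem continuous_segment :
    Continuous fun x : (liftGroup × liftGroup) × I => segment x.1.1 x.1.2 x.2 := by
  refine continuous_of_uncurry ?_
  simp only [segment_apply]
  have h1 : Continuous fun x : ((liftGroup × liftGroup) × I) × ℝ => x.1.1.1.1 x.2 :=
    continuous_eval.comp ((continuous_fst.comp (continuous_fst.comp continuous_fst)).prodMk
      continuous_snd)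
  have h2 : Continuous fun x : ((liftGroup × liftGroup) × I) × ℝ => x.1.1.2.1 x.2 :=
    continuous_eval.comp ((continuous_snd.comp (continuous_fst.comp continuous_fst)).prodMk
      continuous_snd)
  fun_prop

/-- The segment from `a` to `b` as a path. -/
def segmentPath (a b : liftGroup) : Path a b where
  toFun := segment a b
  continuous_toFun :=
    continuous_segment.comp (f := fun s : I => ((a, b), s)) (continuous_const.prodMk continuous_id)
  source' := segment_zero a b
  target' := segment_one a b

theorem segment_mem_uIcc (a b : liftGroup) (s : I) (t : ℝ) :
    (segment a b s).1 t ∈ Set.uIcc (a.1 t) (b.1 t) := by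
  rw [segment_apply, ← segment_eq_uIcc]
  exact ⟨1 - s, s, sub_nonneg.2 s.2.2, s.2.1, by ring, rfl⟩

instance : PathConnectedSpace liftGroup := ⟨⟨1⟩, fun a b => ⟨segmentPath a b⟩⟩

theorem exists_conj (ε : ℤˣ) (l : liftGroup) :
    ∃ l' : liftGroup, ∀ t, l'.1 t = ((ε : ℤ) : ℝ) * l.1 (((ε : ℤ) : ℝ) * t) := by
  have hl := l.1.continuous
  refine exists_coe_eq ?_ (by fun_prop) ?_
  · rcases Int.units_eq_one_or ε with rfl | rfl
    · simpa using l.1.strictMono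
    · intro x y hxy
      simpa using l.1.strictMono (neg_lt_neg hxy)
  · intro t
    rcases Int.units_eq_one_or ε with rfl | rfl
    · simpa using apply_add_int l t 1
    · have := apply_add_int l (-(t + 1)) 1
      rw [Int.cast_one, show -(t + 1) + 1 = -t by ring] at this
      simp only [Units.val_neg, Units.val_one, Int.cast_neg, Int.cast_one, neg_mul, one_mul]
      linarith

/-- The conjugate of `l` by `t ↦ ε t`, `ε = ±1`. -/
def conj (ε : ℤˣ) (l : liftGroup) : liftGroup := (exists_conj ε l).choose

theorem conj_apply (ε : ℤˣ) (l : liftGroup) (t : ℝ) :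
    (conj ε l).1 t = ((ε : ℤ) : ℝ) * l.1 (((ε : ℤ) : ℝ) * t) :=
  (exists_conj ε l).choose_spec t

theorem continuous_conj (ε : ℤˣ) : Continuous (conj ε) := by
  refine continuous_of_uncurry ?_
  simp only [conj_apply]
  have : Continuous fun x : liftGroup × ℝ => x.1.1 (((ε : ℤ) : ℝ) * x.2) :=
    continuous_eval.comp (continuous_fst.prodMk (continuous_const.mul continuous_snd))
  fun_prop

/-- The homeomorphism of the circle with the lift `l`. -/
theorem exists_circleHomeo (l : liftGroup) :
    ∃ φ : Circle ≃ₜ Circle, ∀ t, φ (ez t) = ez (l.1 t) := by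
  have key : ∀ l : liftGroup, ∃ f : Circle → Circle, Continuous f ∧ ∀ t, f (ez t) = ez (l.1 t) := by
    intro l
    have h : ∀ t, ez (l.1 (Function.surjInv ez_surjective (ez t))) = ez (l.1 t) := fun t => by
      obtain ⟨k, hk⟩ := ez_eq_iff.1 (Function.surjInv_eq ez_surjective (ez t))
      rw [hk, apply_add_int, ez_add_int]
    refine ⟨fun z => ez (l.1 (Function.surjInv ez_surjective z)),
      isOpenQuotientMap_ez.isQuotientMap.continuous_iff.2 ?_, h⟩
    exact (continuous_ez.comp l.1.continuous).congr fun t => (h t).symm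
  obtain ⟨f, hf, hf'⟩ := key l
  obtain ⟨g, hg, hg'⟩ := key l⁻¹
  refine ⟨⟨⟨f, g, fun z => ?_, fun z => ?_⟩, hf, hg⟩, hf'⟩
  · obtain ⟨t, rfl⟩ := ez_surjective z
    rw [hf', hg', inv_apply_self]
  · obtain ⟨t, rfl⟩ := ez_surjective z
    rw [hg', hf', apply_inv_self]

/-- The homomorphism which sends `l` to the homeomorphism of the circle with the lift `l`. -/
def toHomeo : liftGroup →* (Circle ≃ₜ Circle) where
  toFun l := (exists_circleHomeo l).choose
  map_one' := by
    ext1 z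
    obtain ⟨t, rfl⟩ := ez_surjective z
    exact (exists_circleHomeo 1).choose_spec t
  map_mul' a b := by
    ext1 z
    obtain ⟨t, rfl⟩ := ez_surjective z
    rw [(exists_circleHomeo (a * b)).choose_spec t]
    show _ = (exists_circleHomeo a).choose ((exists_circleHomeo b).choose (ez t))
    rw [(exists_circleHomeo b).choose_spec t, (exists_circleHomeo a).choose_spec]
    rfl

theorem toHomeo_ez (l : liftGroup) (t : ℝ) : toHomeo l (ez t) = ez (l.1 t) :=
  (exists_circleHomeo l).choose_spec t

theorem continuous_toHomeo : Continuous toHomeo := by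
  refine continuous_induced_rng.2 (ContinuousMap.continuous_of_continuous_uncurry _ ?_)
  have hq : IsOpenQuotientMap (Prod.map (id : liftGroup → liftGroup) ez) :=
    IsOpenQuotientMap.id.prodMap isOpenQuotientMap_ez
  refine hq.isQuotientMap.continuous_iff.2 ?_
  refine (continuous_ez.comp continuous_eval).congr fun x => ?_
  exact (toHomeo_ez x.1 x.2).symm

end liftGroup

/-- A lift of a homeomorphism of the circle to the line is increasing or decreasing, of degree
`±1`. -/
theorem exists_eq_of_lifts {φ : Circle ≃ₜ Circle} {g : ℝ → ℝ} (hg : Continuous g)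
    (h : ∀ t, ez (g t) = φ (ez t)) :
    ∃ (ε : ℤˣ) (l : liftGroup), ∀ t, g t = l.1 (((ε : ℤ) : ℝ) * t) := by
  have hshift : ∀ s t, (∃ k : ℤ, g s = g t + k) → ∃ k : ℤ, s = t + k := fun s t hst =>
    ez_eq_iff.1 (φ.injective (by rw [← h, ← h, ez_eq_iff.2 hst]))
  obtain ⟨d, hd⟩ : ∃ d : ℤ, g 1 = g 0 + d :=
    ez_eq_iff.1 (by rw [h, h]; congr 1; simpa using ez_add_int 0 1)
  have hper : ∀ t, g (t + 1) = g t + d := by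
    have := isCoveringMap_ez.eq_of_comp_eq (g₁ := fun t => g (t + 1)) (g₂ := fun t => g t + d)
      (by fun_prop) (by fun_prop)
      (by ext1 t; simpa [h, ez_add_int] using congrArg φ (by simpa using ez_add_int t 1)) 0
      (by simpa using hd)
    exact fun t => congrFun this t
  have hd0 : d ≠ 0 := by
    rintro rfl
    obtain ⟨t, ht⟩ := exists_add_half_eq hg (by simpa using hd)
    obtain ⟨k, hk⟩ := hshift _ _ ⟨0, by simpa using ht⟩
    exact half_ne_int k (by linarith)
  have hinj : Function.Injective g := fun s t hst => by
    obtain ⟨k, rfl⟩ := hshift s t ⟨0, by simpa using hst⟩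
    rw [liftGroup.add_int_of_add_one hper] at hst
    have : (k : ℝ) * d = 0 := by linarith
    have : k = 0 := by
      rcases mul_eq_zero.1 this with h | h
      · exact_mod_cast h
      · exact absurd (by exact_mod_cast h) hd0
    simp [this]
  obtain ⟨ε, hε⟩ : ∃ ε : ℤˣ, StrictMono fun t => g (((ε : ℤ) : ℝ) * t) := by
    rcases hg.strictMono_of_inj hinj with h | h
    · exact ⟨1, by simpa using h⟩
    · exact ⟨-1, fun x y hxy => by simpa using h (neg_lt_neg hxy)⟩
  have hεε : ∀ t : ℝ, ((ε : ℤ) : ℝ) * (((ε : ℤ) : ℝ) * t) = t := fun t => by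
    rcases Int.units_eq_one_or ε with rfl | rfl <;> simp
  have hper' : ∀ t, g (((ε : ℤ) : ℝ) * (t + 1)) = g (((ε : ℤ) : ℝ) * t) + ((ε : ℤ) * d : ℤ) :=
    fun t => by
      rw [mul_add, mul_one, liftGroup.add_int_of_add_one hper]; push_cast; rfl
  have hpos : 1 ≤ (ε : ℤ) * d := by
    have h1 := hε (show (0 : ℝ) < 0 + 1 by norm_num)
    dsimp only at h1
    rw [hper'] at h1
    have : (0 : ℝ) < ((ε : ℤ) * d : ℤ) := by linarith
    have : 0 < (ε : ℤ) * d := by exact_mod_cast this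
    omega
  have hone : (ε : ℤ) * d = 1 := by
    by_contra hne
    have h2 : (2 : ℝ) ≤ ((ε : ℤ) * d : ℤ) := by exact_mod_cast (by omega : 2 ≤ (ε : ℤ) * d)
    have h3 := hper' 0
    obtain ⟨t, ht, ht'⟩ : g (((ε : ℤ) : ℝ) * 0) + 1 ∈ (fun t => g (((ε : ℤ) : ℝ) * t)) '' Set.Icc 0 1 :=
      intermediate_value_Icc zero_le_one (by fun_prop) ⟨by simp, by
        rw [zero_add] at h3; linarith⟩
    obtain ⟨k, hk⟩ := hshift _ _ ⟨1, by simpa using ht'⟩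
    have hk' : t = ((ε : ℤ) * k : ℤ) := by
      have := congrArg (fun x => ((ε : ℤ) : ℝ) * x) hk
      rw [hεε, zero_add] at this
      rw [this]; push_cast; rfl
    have h0 : t ≠ 0 := by
      rintro rfl; linarith
    have h1 : t ≠ 1 := by
      rintro rfl; rw [zero_add] at h3; linarith
    have a1 : 0 < t := lt_of_le_of_ne ht.1 (Ne.symm h0)
    have a2 : t < 1 := lt_of_le_of_ne ht.2 h1
    rw [hk'] at a1 a2
    have b1 : 0 < (ε : ℤ) * k := by exact_mod_cast a1
    have b2 : (ε : ℤ) * k < 1 := by exact_mod_cast a2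
    omega
  obtain ⟨l, hl⟩ := liftGroup.exists_coe_eq hε (by fun_prop) (fun t => by
    rw [hper', hone]; simp)
  exact ⟨ε, l, fun t => by rw [hl, hεε]⟩

theorem exists_lift_homeo (φ : Circle ≃ₜ Circle) :
    ∃ (ε : ℤˣ) (l : liftGroup), ∀ t, φ (ez t) = ez (l.1 (((ε : ℤ) : ℝ) * t)) := by
  obtain ⟨z, hz⟩ := ez_surjective (φ (ez 0))
  obtain ⟨g, ⟨-, hg⟩, -⟩ := isCoveringMap_ez.existsUnique_continuousMap_lifts
    (⟨fun t => φ (ez t), φ.continuous.comp continuous_ez⟩ : C(ℝ, Circle)) 0 z hz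
  have hg' : ∀ t, ez (g t) = φ (ez t) := fun t => congrFun hg t
  obtain ⟨ε, l, hl⟩ := exists_eq_of_lifts g.continuous hg'
  exact ⟨ε, l, fun t => by rw [← hg', hl]⟩

theorem unit_mul_unit_mul (ε : ℤˣ) (t : ℝ) : ((ε : ℤ) : ℝ) * (((ε : ℤ) : ℝ) * t) = t := by
  rcases Int.units_eq_one_or ε with rfl | rfl <;> simp

/-- The orientation character is well defined. -/
theorem lift_homeo_unique {ε ε' : ℤˣ} {l l' : liftGroup}
    (h : ∀ t, ez (l.1 (((ε : ℤ) : ℝ) * t)) = ez (l'.1 (((ε' : ℤ) : ℝ) * t))) :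
    ε = ε' ∧ ∃ k : ℤ, l = liftGroup.transl k * l' := by
  obtain ⟨k, hk⟩ := ez_eq_iff.1 (h 0)
  have key := isCoveringMap_ez.eq_of_comp_eq (g₁ := fun t => l.1 (((ε : ℤ) : ℝ) * t))
    (g₂ := fun t => l'.1 (((ε' : ℤ) : ℝ) * t) + k)
    (by have := l.1.continuous; fun_prop) (by have := l'.1.continuous; fun_prop)
    (by ext1 t; simp [h, ez_add_int]) 0 hk
  have h1 := congrFun key 1
  have h0 := congrFun key 0
  have a := liftGroup.apply_add_int l 0 ε
  have b := liftGroup.apply_add_int l' 0 ε'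
  simp only [mul_one, mul_zero, zero_add] at h0 h1 a b
  have hε : ε = ε' := by
    have : ((ε : ℤ) : ℝ) = ((ε' : ℤ) : ℝ) := by linarith
    exact Units.ext (by exact_mod_cast this)
  subst hε
  refine ⟨rfl, k, liftGroup.ext fun t => ?_⟩
  have := congrFun key (((ε : ℤ) : ℝ) * t)
  rwa [unit_mul_unit_mul] at this

/-! ### Orthogonal transformations -/

theorem O2.act_rotation (s : ℝ) (z : Circle) : O2.act (O2.rotation s) z = ez s * z := by
  apply Circle.ext
  apply Complex.ext <;>
    simp [O2.act, O2.rotation, ez, Circle.coe_exp, Complex.exp_re, Complex.exp_im, add_comm, sub_eq_add_neg]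

theorem O2.act_ez_of_fix {A : O2} (h : O2.act A 1 = 1) (t : ℝ) :
    O2.act A (ez t) = ez (((O2.sign A : ℤ) : ℝ) * t) := by
  have := O2.conj_rotation A t
  have h2 := congrArg (fun B => O2.act B 1) this
  simp only [O2.act_mul, O2.act_rotation, h, mul_one] at h2
  exact h2

theorem O2.exists_rotation_mul (A : O2) : ∃ (s : ℝ) (B : O2), O2.act B 1 = 1 ∧
    O2.sign B = O2.sign A ∧ A = O2.rotation s * B := by
  obtain ⟨s, hs⟩ := ez_surjective (O2.act A 1)
  have hr : O2.rotation (-s) * O2.rotation s = 1 := by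
    rw [← O2.rotation_add, neg_add_cancel]; simpa using O2.rotation_int 0
  refine ⟨s, O2.rotation (-s) * A, ?_, ?_, ?_⟩
  · rw [O2.act_mul, O2.act_rotation, ← hs, ← ez_add, neg_add_cancel, ez_zero]
  · rw [map_mul, O2.sign_rotation, one_mul]
  · rw [← mul_assoc, ← O2.rotation_add, add_neg_cancel]
    rw [show O2.rotation 0 = 1 by simpa using O2.rotation_int 0, one_mul]

theorem O2.act_ez (A : O2) : ∃ s : ℝ, ∀ t, O2.act A (ez t) = ez (((O2.sign A : ℤ) : ℝ) * t + s) := by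
  obtain ⟨s, B, h1, h2, rfl⟩ := O2.exists_rotation_mul A
  refine ⟨s, fun t => ?_⟩
  rw [O2.act_mul, O2.act_rotation, O2.act_ez_of_fix h1, ← ez_add, h2, add_comm]

theorem O2.exists_sign_eq (ε : ℤˣ) : ∃ A : O2, O2.act A 1 = 1 ∧ O2.sign A = ε := by
  rcases Int.units_eq_one_or ε with rfl | rfl
  · exact ⟨1, O2.act_one 1, map_one _⟩
  · refine ⟨⟨!![1, 0; 0, -1], ?_⟩, ?_, ?_⟩
    · rw [Matrix.mem_orthogonalGroup_iff]
      ext a b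
      fin_cases a <;> fin_cases b <;> simp [Matrix.mul_apply, Fin.sum_univ_two]
    · apply Circle.ext
      apply Complex.ext <;> simp [O2.act]
    · refine if_neg ?_
      simp [Matrix.det_fin_two]
      norm_num

theorem O2.toHomeo_injective : Function.Injective O2.toHomeo := fun A B h => by
  have h1 : ∀ z, O2.act A z = O2.act B z := fun z => DFunLike.congr_fun h z
  have a := h1 1
  have b := h1 (Circle.exp (Real.pi / 2))
  rw [Circle.ext_iff, Complex.ext_iff] at a b
  simp [O2.act, Circle.coe_exp] at a b
  apply Subtype.ext
  ext i j
  fin_cases i <;> fin_cases j <;> simp [a, b]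

namespace PlanarLieGroup

variable (G : PlanarLieGroup.{u})

theorem toHomeo_base (w : G.base) (t : ℝ) :
    O2.toHomeo (G.p w) (ez t) = ez (((G.sign (w : G) : ℤ) : ℝ) * t) :=
  O2.act_ez_of_fix w.2 t

end PlanarLieGroup

theorem continuous_homeo_eval (X Y : Type*) [TopologicalSpace X] [TopologicalSpace Y]
    [LocallyCompactPair X Y] : Continuous fun x : (X ≃ₜ Y) × X => x.1 x.2 := by
  have h : Continuous fun φ : X ≃ₜ Y => (φ : C(X, Y)) := continuous_induced_dom
  exact (ContinuousEval.continuous_eval (F := C(X, Y))).comp (h.prodMap continuous_id)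

/-! ### The structure of planar homeomorphism groups -/

namespace PlanarHomeoGroup

variable {G : PlanarLieGroup.{u}} (H : PlanarHomeoGroup G)

theorem continuous_q : Continuous H.q := H.connective.isCoveringMap.continuous

theorem continuous_incl : Continuous H.incl := (continuous_snd.comp H.isEmbedding.continuous :)

theorem q_incl_base (w : G.base) (t : ℝ) :
    H.q (H.incl w) (ez t) = ez (((G.sign (w : G) : ℤ) : ℝ) * t) := by
  rw [H.q_incl, G.toHomeo_base]

theorem q_mul_apply (g h : H) (z : Circle) : H.q (g * h) z = H.q g (H.q h z) := by
  rw [map_mul]; rfl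

/-- The family of homeomorphisms `(1 - s) id + s l`. -/
def contraction : C(I × liftGroup, Circle ≃ₜ Circle) :=
  ⟨fun x => liftGroup.toHomeo (liftGroup.segment 1 x.2 x.1),
    liftGroup.continuous_toHomeo.comp (liftGroup.continuous_segment.comp
      (f := fun x : I × liftGroup => ((1, x.2), x.1))
      ((continuous_const.prodMk continuous_snd).prodMk continuous_fst))⟩

/-- The lift of the contraction to the planar homeomorphism group. -/
def contractionLift : C(I × liftGroup, H) :=
  H.connective.isCoveringMap.liftHomotopy contraction (ContinuousMap.const _ 1) (fun l => by
    simp [contraction, liftGroup.segment_zero])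

theorem q_contractionLift (x : I × liftGroup) : H.q (H.contractionLift x) = contraction x :=
  congrFun (H.connective.isCoveringMap.liftHomotopy_lifts contraction (ContinuousMap.const _ 1) _) x

theorem contractionLift_zero (l : liftGroup) : H.contractionLift (0, l) = 1 :=
  H.connective.isCoveringMap.liftHomotopy_zero contraction (ContinuousMap.const _ 1) _ l

theorem q_contractionLift_one (l : liftGroup) :
    H.q (H.contractionLift (1, l)) = liftGroup.toHomeo l := by
  rw [q_contractionLift]
  simp [contraction, liftGroup.segment_one]

theorem contractionLift_one_one : H.contractionLift (1, 1) = 1 := by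
  have := H.connective.isCoveringMap.eq_of_comp_eq (g₁ := fun s : I => H.contractionLift (s, 1))
    (g₂ := fun _ => 1) (by fun_prop) (by fun_prop) (by
      ext1 s
      simp only [Function.comp_apply, q_contractionLift, map_one]
      have : liftGroup.segment 1 1 s = 1 :=
        liftGroup.ext fun t => by rw [liftGroup.segment_apply]; ring
      simp [contraction, this]) 0 (H.contractionLift_zero 1)
  exact congrFun this 1

/-- The homomorphism from the universal covering of the identity component of `Homeo(S¹)`. -/
def ofLift : liftGroup →* H where
  toFun l := H.contractionLift (1, l)
  map_one' := H.contractionLift_one_one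
  map_mul' a b := by
    have hc : Continuous fun l : liftGroup => H.contractionLift (1, l) := by fun_prop
    have := H.connective.isCoveringMap.eq_of_comp_eq
      (g₁ := fun x : liftGroup × liftGroup => H.contractionLift (1, x.1 * x.2))
      (g₂ := fun x : liftGroup × liftGroup =>
        H.contractionLift (1, x.1) * H.contractionLift (1, x.2))
      (hc.comp liftGroup.continuous_mul)
      ((hc.comp continuous_fst).mul (hc.comp continuous_snd))
      (by ext1 x; simp [q_contractionLift_one]) (1, 1) (by simp [contractionLift_one_one])
    exact congrFun this (a, b)

theorem q_ofLift (l : liftGroup) : H.q (H.ofLift l) = liftGroup.toHomeo l :=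
  H.q_contractionLift_one l

theorem continuous_ofLift : Continuous H.ofLift := by
  have hc : Continuous fun l : liftGroup => H.contractionLift (1, l) := by fun_prop
  exact hc

theorem ofLift_transl (t : ℝ) : H.ofLift (liftGroup.transl t) = H.incl (G.e t) := by
  have h0 : liftGroup.transl 0 = 1 := liftGroup.ext fun t => by simp
  have := H.connective.isCoveringMap.eq_of_comp_eq
    (g₁ := fun t => H.ofLift (liftGroup.transl t)) (g₂ := fun t => H.incl (G.e t))
    (H.continuous_ofLift.comp liftGroup.continuous_transl)
    (H.continuous_incl.comp G.e.continuous) (by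
      ext t z
      obtain ⟨s, rfl⟩ := ez_surjective z
      simp only [Function.comp_apply, q_ofLift, q_incl, G.p_e, liftGroup.toHomeo_ez]
      show _ = ((O2.act (O2.rotation t) (ez s) : Circle) : ℂ)
      rw [O2.act_rotation, ← ez_add, liftGroup.transl_apply, add_comm])
    0 (by simp [h0, G.e_zero])
  exact congrFun this t

theorem ofLift_mul_incl (l : liftGroup) (w : G.base) :
    H.ofLift l * H.incl w = H.incl w * H.ofLift (liftGroup.conj (G.sign (w : G)) l) := by
  have h1 : liftGroup.conj (G.sign (w : G)) 1 = 1 := liftGroup.ext fun t => by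
    rw [liftGroup.conj_apply, liftGroup.one_apply, liftGroup.one_apply, unit_mul_unit_mul]
  have := H.connective.isCoveringMap.eq_of_comp_eq
    (g₁ := fun l => H.ofLift l * H.incl w)
    (g₂ := fun l => H.incl w * H.ofLift (liftGroup.conj (G.sign (w : G)) l))
    (H.continuous_ofLift.mul continuous_const)
    (continuous_const.mul (H.continuous_ofLift.comp (liftGroup.continuous_conj _))) (by
      ext l z
      obtain ⟨s, rfl⟩ := ez_surjective z
      simp only [Function.comp_apply, q_mul_apply, q_incl_base, q_ofLift, liftGroup.toHomeo_ez,
        liftGroup.conj_apply, unit_mul_unit_mul]) 1 (by simp [h1])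
  exact congrFun this l

/-- The element `w ∘ l`. -/
def elt (w : G.base) (l : liftGroup) : H := H.incl w * H.ofLift l

theorem q_elt (w : G.base) (l : liftGroup) (t : ℝ) :
    H.q (H.elt w l) (ez t) = ez (((G.sign (w : G) : ℤ) : ℝ) * l.1 t) := by
  rw [elt, q_mul_apply, q_ofLift, liftGroup.toHomeo_ez, q_incl_base]

theorem continuous_elt (w : G.base) : Continuous (H.elt w) :=
  continuous_const.mul H.continuous_ofLift

theorem elt_mul_elt (w w' : G.base) (l l' : liftGroup) :
    H.elt w' l' * H.elt w l = H.elt (w' * w) (liftGroup.conj (G.sign (w : G)) l' * l) := by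
  rw [elt, elt, elt, map_mul, Subgroup.coe_mul, map_mul, mul_assoc, ← mul_assoc (H.ofLift l'),
    ofLift_mul_incl, mul_assoc, mul_assoc]

theorem elt_one_one : H.elt 1 1 = 1 := by simp [elt]

theorem elt_transl (w : G.base) (t : ℝ) : H.elt w (liftGroup.transl t) = H.incl (w * G.e t) := by
  rw [elt, ofLift_transl, map_mul]

theorem exists_elt (h : H) : ∃ w l, h = H.elt w l := by
  obtain ⟨ε, l, hl⟩ := exists_lift_homeo (H.q h)
  obtain ⟨A, hA, hε⟩ := O2.exists_sign_eq ε
  have key : O2.toHomeo A = H.q (h * (H.ofLift (liftGroup.conj ε l))⁻¹) := by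
    have : O2.toHomeo A * H.q (H.ofLift (liftGroup.conj ε l)) = H.q h := by
      ext z
      obtain ⟨t, rfl⟩ := ez_surjective z
      rw [hl, q_ofLift]
      show ((O2.act A (liftGroup.toHomeo _ (ez t)) : Circle) : ℂ) = _
      rw [liftGroup.toHomeo_ez, O2.act_ez_of_fix hA, hε, liftGroup.conj_apply, unit_mul_unit_mul]
    rw [map_mul, map_inv, ← this, mul_inv_cancel_right]
  obtain ⟨g, hg, hg'⟩ := H.exists_eq A _ key
  refine ⟨⟨g, ?_⟩, liftGroup.conj ε l, ?_⟩
  · show O2.act (G.p g) 1 = 1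
    rw [hg, hA]
  · rw [elt, hg', inv_mul_cancel_right]

theorem elt_mul_turn (w : G.base) (l : liftGroup) (k : ℤ) :
    H.elt (w * G.turn k) l = H.elt w (liftGroup.transl k * l) := by
  rw [elt, elt, map_mul, ofLift_transl, Subgroup.coe_mul, map_mul, mul_assoc]; rfl

theorem elt_eq_elt {w w' : G.base} {l l' : liftGroup} (h : H.elt w l = H.elt w' l') :
    ∃ k : ℤ, w' = w * G.turn k ∧ l = liftGroup.transl k * l' := by
  obtain ⟨hs, -⟩ := lift_homeo_unique (ε := G.sign (w : G)) (ε' := G.sign (w' : G))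
    (l := liftGroup.conj (G.sign (w : G)) l) (l' := liftGroup.conj (G.sign (w' : G)) l')
    (fun t => by
      rw [liftGroup.conj_apply, liftGroup.conj_apply, unit_mul_unit_mul, unit_mul_unit_mul,
        ← q_elt, ← q_elt, h])
  have h1 : ∀ t, ez (l.1 t) = ez (l'.1 t) := fun t => by
    have := H.q_elt w l t
    rw [h, q_elt, ← hs] at this
    obtain ⟨k, hk⟩ := ez_eq_iff.1 this
    rcases Int.units_eq_one_or (G.sign (w : G)) with h | h <;> rw [h] at hk
    · exact (ez_eq_iff.2 ⟨k, by simpa using hk⟩).symm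
    · exact (ez_eq_iff.2 ⟨-k, by push_cast; simp at hk; linarith⟩).symm
  obtain ⟨k, rfl⟩ : ∃ k : ℤ, l = liftGroup.transl k * l' :=
    (lift_homeo_unique (ε := 1) (ε' := 1) (by simpa using h1)).2
  refine ⟨k, ?_, rfl⟩
  rw [← elt_mul_turn, elt, elt, mul_left_inj] at h
  have hp : G.p (w * G.turn k : G.base) = G.p w' := O2.toHomeo_injective (by
    rw [← H.q_incl, ← H.q_incl, h])
  exact Subtype.ext (H.isEmbedding.injective (Prod.ext hp h)).symm

/-- Paths in the planar homeomorphism group lift to paths of homeomorphisms of the line. -/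
theorem exists_path_lift {γ : I → H} (hγ : Continuous γ) {w : G.base} {l₀ : liftGroup}
    (h0 : γ 0 = H.elt w l₀) :
    ∃ l : I → liftGroup, Continuous l ∧ l 0 = l₀ ∧ ∀ s, γ s = H.elt w (l s) := by
  have hK : Continuous fun x : I × ℝ => H.q ((H.incl w)⁻¹ * γ x.1) (ez x.2) :=
    (continuous_homeo_eval Circle Circle).comp
      ((H.continuous_q.comp (continuous_const.mul (hγ.comp continuous_fst))).prodMk
        (continuous_ez.comp continuous_snd))
  have hK0 : ∀ t, H.q ((H.incl w)⁻¹ * γ 0) (ez t) = ez (l₀.1 t) := fun t => by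
    rw [h0, elt, inv_mul_cancel_left, q_ofLift, liftGroup.toHomeo_ez]
  let g := isCoveringMap_ez.liftHomotopy ⟨_, hK⟩ ⟨l₀.1, l₀.1.continuous⟩ hK0
  have hg : ∀ s t, ez (g (s, t)) = H.q ((H.incl w)⁻¹ * γ s) (ez t) := fun s t =>
    congrFun (isCoveringMap_ez.liftHomotopy_lifts ⟨_, hK⟩ ⟨l₀.1, l₀.1.continuous⟩ hK0) (s, t)
  have hg0 : ∀ t, g (0, t) = l₀.1 t :=
    isCoveringMap_ez.liftHomotopy_zero ⟨_, hK⟩ ⟨l₀.1, l₀.1.continuous⟩ hK0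
  have hcont := g.continuous
  have hex : ∀ s, ∃ l : liftGroup, ∀ t, g (s, t) = l.1 t := by
    have hdeg : ∀ s, ∃ (ε : ℤˣ) (l : liftGroup), (∀ t, g (s, t) = l.1 (((ε : ℤ) : ℝ) * t)) ∧
        g (s, 1) - g (s, 0) = ((ε : ℤ) : ℝ) := fun s => by
      obtain ⟨ε, l, hl⟩ := exists_eq_of_lifts (φ := H.q ((H.incl w)⁻¹ * γ s))
        (g := fun t => g (s, t)) (by fun_prop) (hg s)
      refine ⟨ε, l, hl, ?_⟩
      have := liftGroup.apply_add_int l 0 ε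
      rw [hl, hl, mul_one, mul_zero]
      rw [zero_add] at this
      rw [this]; ring
    intro s
    obtain ⟨ε, l, hl, hε⟩ := hdeg s
    rcases Int.units_eq_one_or ε with rfl | rfl
    · exact ⟨l, by simpa using hl⟩
    · exfalso
      have h1 : g (0, 1) - g (0, 0) = 1 := by
        rw [hg0, hg0]
        have := liftGroup.apply_add_int l₀ 0 1
        rw [zero_add, Int.cast_one] at this
        rw [this]; ring
      obtain ⟨s', hs'⟩ : ∃ s', g (s', 1) - g (s', 0) = 0 :=
        mem_range_of_exists_le_of_exists_ge (f := fun s => g (s, 1) - g (s, 0)) (by fun_prop)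
          ⟨s, by rw [hε]; simp⟩ ⟨0, by rw [h1]; exact zero_le_one⟩
      obtain ⟨ε', l', -, hε'⟩ := hdeg s'
      rw [hs'] at hε'
      rcases Int.units_eq_one_or ε' with rfl | rfl <;> simp at hε'
  choose l hl using hex
  have hlc : Continuous l := liftGroup.continuous_of_uncurry (by simpa only [← hl] using hcont)
  have hl0 : l 0 = l₀ := liftGroup.ext fun t => by rw [← hl, hg0]
  refine ⟨l, hlc, hl0, ?_⟩
  have := H.connective.isCoveringMap.eq_of_comp_eq (g₁ := γ) (g₂ := fun s => H.elt w (l s)) hγ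
    ((H.continuous_elt w).comp hlc) (by
      ext s z
      obtain ⟨t, rfl⟩ := ez_surjective z
      simp only [Function.comp_apply]
      rw [elt, H.q_mul_apply (H.incl w) (H.ofLift (l s)), q_ofLift, liftGroup.toHomeo_ez, ← hl, hg,
        ← H.q_mul_apply, mul_inv_cancel_left]) 0 (by rw [h0, hl0])
  exact congrFun this

end PlanarHomeoGroup

/-! ### Piecewise linear homeomorphisms of the line -/

theorem liftGroup.exists_interpolation {N : ℕ} (hN : 0 < N) {X : ℤ → ℝ} (hX : StrictMono X)
    (hp : ∀ j, X (j + N) = X j + 1) : ∃ l : liftGroup, ∀ j : ℤ, l.1 (j / N) = X j := by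
  have hN' : (0 : ℝ) < N := by exact_mod_cast hN
  let f : ℝ → ℝ := fun a => X ⌊a⌋ + Int.fract a * (X (⌊a⌋ + 1) - X ⌊a⌋)
  have hpos : ∀ j, 0 < X (j + 1) - X j := fun j => sub_pos.2 (hX (lt_add_one j))
  have hle : ∀ a, X ⌊a⌋ ≤ f a := fun a =>
    le_add_of_nonneg_right (mul_nonneg (Int.fract_nonneg a) (hpos _).le)
  have hlt : ∀ a, f a < X (⌊a⌋ + 1) := fun a => by
    have := mul_lt_mul_of_pos_right (Int.fract_lt_one a) (hpos ⌊a⌋)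
    show X ⌊a⌋ + _ < _
    linarith
  have hf : StrictMono f := fun a b hab => by
    rcases (Int.floor_mono hab.le).eq_or_lt with h | h
    · have h1 : Int.fract a < Int.fract b := by
        rw [Int.fract, Int.fract, h]; linarith
      have := mul_lt_mul_of_pos_right h1 (hpos ⌊b⌋)
      show X ⌊a⌋ + Int.fract a * (X (⌊a⌋ + 1) - X ⌊a⌋) < X ⌊b⌋ + Int.fract b * _
      rw [h]
      linarith
    · exact (hlt a).trans_le ((hX.monotone h).trans (hle b))
  have hfs : Function.Surjective f := fun v => by
    have hk : ∀ k : ℤ, X (k * N) = X 0 + k := fun k => by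
      induction k using Int.induction_on with
      | zero => simp
      | succ i ih => rw [add_mul, one_mul, hp, ih]; push_cast; ring
      | pred i ih =>
        have := hp ((-(i : ℤ) - 1) * N)
        rw [show (-(i : ℤ) - 1) * N + N = -(i : ℤ) * N by ring, ih] at this
        push_cast at this ⊢
        linarith
    obtain ⟨j, hj, hj'⟩ : ∃ j : ℤ, X j ≤ v ∧ ∀ z, X z ≤ v → z ≤ j := by
      refine Int.exists_greatest_of_bdd ⟨⌈v - X 0⌉ * N, fun z hz => ?_⟩ ⟨⌊v - X 0⌋ * N, ?_⟩
      · refine hX.le_iff_le.1 ?_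
        rw [hk]
        have := Int.le_ceil (v - X 0)
        linarith
      · rw [hk]
        have := Int.floor_le (v - X 0)
        linarith
    have hj2 : v < X (j + 1) := by
      by_contra h
      have := hj' _ (not_lt.1 h)
      omega
    have h0 : 0 ≤ (v - X j) / (X (j + 1) - X j) := div_nonneg (sub_nonneg.2 hj) (hpos j).le
    have h1 : (v - X j) / (X (j + 1) - X j) < 1 := (div_lt_one (hpos j)).2 (by linarith)
    refine ⟨j + (v - X j) / (X (j + 1) - X j), ?_⟩
    have h2 : ⌊(j : ℝ) + (v - X j) / (X (j + 1) - X j)⌋ = j := by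
      rw [Int.floor_eq_iff]; constructor <;> linarith
    show X ⌊_⌋ + (_ - (⌊_⌋ : ℝ)) * _ = v
    rw [h2, add_sub_cancel_left, div_mul_cancel₀ _ (hpos j).ne']
    ring
  obtain ⟨l, hl⟩ := exists_coe_eq_of_surjective (g := fun t => f (t * N))
    (fun a b hab => hf (mul_lt_mul_of_pos_right hab hN'))
    (fun v => by
      obtain ⟨a, ha⟩ := hfs v
      exact ⟨a / N, by simp only [div_mul_cancel₀ _ hN'.ne', ha]⟩)
    (fun t => by
      have h1 : ⌊(t + 1) * (N : ℝ)⌋ = ⌊t * N⌋ + N := by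
        rw [add_mul, one_mul]; exact_mod_cast Int.floor_add_natCast (t * N) N
      have h2 : Int.fract ((t + 1) * (N : ℝ)) = Int.fract (t * N) := by
        rw [add_mul, one_mul]; exact Int.fract_add_natCast _ _
      show X ⌊_⌋ + Int.fract _ * (X (⌊_⌋ + 1) - X ⌊_⌋) = X ⌊_⌋ + Int.fract _ * _ + 1
      rw [h1, h2, hp, show ⌊t * (N : ℝ)⌋ + (N : ℤ) + 1 = ⌊t * (N : ℝ)⌋ + 1 + N by ring, hp]
      ring)
  refine ⟨l, fun j => ?_⟩
  rw [hl, div_mul_cancel₀ _ hN'.ne']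
  show X ⌊_⌋ + Int.fract _ * _ = _
  simp

/-! ### Markings of the circle and labels -/

/-- A subset `S` of the circle is an `n`-marking if it contains the `(n + 1)`-st roots of unity, and
every point of the preimage of `S` in the line can be joined inside this preimage with exactly one
point of `ℤ / (n + 1)`. -/
structure IsMarking (n : ℕ) (S : Set Circle) : Prop where
  root_mem : ∀ j : ℤ, ez (j / (n + 1)) ∈ S
  existsUnique : ∀ t, ez t ∈ S → ∃! j : ℤ, ∀ u ∈ Set.uIcc t (j / (n + 1)), ez u ∈ S

open Classical in
/-- The number of the component of the preimage of a marking which contains the point `t`. -/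
def lab (n : ℕ) (S : Set Circle) (t : ℝ) : ℤ :=
  if h : ∃ j : ℤ, ∀ u ∈ Set.uIcc t (j / (n + 1)), ez u ∈ S then h.choose else 0

namespace IsMarking

variable {n : ℕ} {S : Set Circle}

theorem lab_spec (hS : IsMarking n S) {t : ℝ} (ht : ez t ∈ S) :
    ∀ u ∈ Set.uIcc t (lab n S t / (n + 1)), ez u ∈ S := by
  have h := (hS.existsUnique t ht).exists
  rw [lab, dif_pos h]
  exact h.choose_spec

theorem lab_eq (hS : IsMarking n S) {t : ℝ} {j : ℤ} (h : ∀ u ∈ Set.uIcc t (j / (n + 1)), ez u ∈ S) :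
    lab n S t = j := by
  have ht : ez t ∈ S := h t Set.left_mem_uIcc
  exact (hS.existsUnique t ht).unique (hS.lab_spec ht) h

theorem lab_root (hS : IsMarking n S) (j : ℤ) :
    lab n S (j / (n + 1)) = j := hS.lab_eq fun u hu => by
  rw [Set.uIcc_self, Set.mem_singleton_iff] at hu
  rw [hu]
  exact hS.root_mem j

theorem lab_eq_of_uIcc (hS : IsMarking n S) {s t : ℝ} (h : ∀ u ∈ Set.uIcc s t, ez u ∈ S) :
    lab n S s = lab n S t :=
  hS.lab_eq fun u hu => by
    rcases Set.uIcc_subset_uIcc_union_uIcc (b := t) hu with h1 | h1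
    · exact h u h1
    · exact hS.lab_spec (h t Set.right_mem_uIcc) u h1

theorem mem_of_lab_eq (hS : IsMarking n S) {s t : ℝ} (hs : ez s ∈ S) (ht : ez t ∈ S) (h : lab n S s = lab n S t) :
    ∀ u ∈ Set.uIcc s t, ez u ∈ S := fun u hu => by
  rcases Set.uIcc_subset_uIcc_union_uIcc (b := (lab n S s / (n + 1) : ℝ)) hu with h1 | h1
  · exact hS.lab_spec hs u h1
  · rw [h, Set.uIcc_comm] at h1
    exact hS.lab_spec ht u h1

theorem lab_add_int (hS : IsMarking n S) {t : ℝ} (ht : ez t ∈ S) (k : ℤ) :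
    lab n S (t + k) = lab n S t + k * (n + 1) := hS.lab_eq fun u hu => by
  have hn : (n + 1 : ℝ) ≠ 0 := by positivity
  have h1 : ((lab n S t + k * (n + 1) : ℤ) : ℝ) / (n + 1) = lab n S t / (n + 1) + k := by
    push_cast; field_simp
  rw [h1] at hu
  have h2 : u - k ∈ Set.uIcc t (lab n S t / (n + 1) : ℝ) := by
    rw [Set.mem_uIcc] at hu ⊢
    rcases hu with ⟨a, b⟩ | ⟨a, b⟩
    · left; constructor <;> linarith
    · right; constructor <;> linarith
  have := hS.lab_spec ht _ h2
  rwa [← ez_add_int _ k, sub_add_cancel] at this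

theorem lab_mono (hS : IsMarking n S) {s t : ℝ} (hs : ez s ∈ S) (ht : ez t ∈ S) (hst : s ≤ t) :
    lab n S s ≤ lab n S t := by
  by_contra hlt
  have hab : (lab n S t / (n + 1) : ℝ) < lab n S s / (n + 1) :=
    div_lt_div_of_pos_right (by exact_mod_cast not_le.1 hlt) (by positivity)
  have hs' := hS.lab_spec hs
  have ht' := hS.lab_spec ht
  generalize hb : (lab n S s / (n + 1) : ℝ) = b at *
  generalize ha : (lab n S t / (n + 1) : ℝ) = a at *
  obtain ⟨v, h1, h2⟩ : ∃ v, v ∈ Set.uIcc s b ∧ v ∈ Set.uIcc t a := by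
    refine ⟨max (min s b) (min t a), ?_, ?_⟩ <;> rw [Set.mem_uIcc] <;> grind
  have e1 : lab n S s = lab n S v := hS.lab_eq_of_uIcc fun u hu =>
    hs' u (Set.uIcc_subset_uIcc_left h1 hu)
  have e2 : lab n S t = lab n S v := hS.lab_eq_of_uIcc fun u hu =>
    ht' u (Set.uIcc_subset_uIcc_left h2 hu)
  omega

end IsMarking

/-! ### The class of a homeomorphism in the crossed simplicial group -/

namespace PlanarHomeoGroup

variable {G : PlanarLieGroup.{u}} (H : PlanarHomeoGroup G)

/-- The image of the `(m + 1)`-st roots of unity is contained in `S`. -/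
def MapsRoots (m : ℕ) (S : Set Circle) (h : H) : Prop := ∀ j : ℤ, H.q h (ez (j / (m + 1))) ∈ S

variable {H} {m n k : ℕ} {S S' A : Set Circle} {w : G.base} {l : liftGroup}

/-- The numbers of the components which contain the images of the roots of unity. -/
def LabelsEq (m n : ℕ) (S : Set Circle) (ε : ℤˣ) (l : liftGroup) (f : Para m n) : Prop :=
  ∀ j : ℤ, f j = ε * lab n S (((ε : ℤ) : ℝ) * l.1 (j / (m + 1)))

theorem LabelsEq.lab_eq {ε : ℤˣ} {f : Para m n} (hf : LabelsEq m n S ε l f) (j : ℤ) :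
    lab n S (((ε : ℤ) : ℝ) * l.1 (j / (m + 1))) = ε * f j := by
  rw [hf, DeltaG.sign_mul_sign_mul]

theorem MapsRoots.mem (h : H.MapsRoots m S (H.elt w l)) (j : ℤ) :
    ez (((G.sign (w : G) : ℤ) : ℝ) * l.1 (j / (m + 1))) ∈ S := by
  rw [← q_elt]; exact h j

theorem exists_labelsEq (hS : IsMarking n S) (h : H.MapsRoots m S (H.elt w l)) :
    ∃ f : Para m n, LabelsEq m n S (G.sign (w : G)) l f := by
  have hm : (0 : ℝ) < m + 1 := by positivity
  refine ⟨⟨fun j => G.sign (w : G) * lab n S (((G.sign (w : G) : ℤ) : ℝ) * l.1 (j / (m + 1))),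
    fun a b hab => ?_, fun j => ?_⟩, fun j => rfl⟩
  · have h1 : l.1 (a / (m + 1)) ≤ l.1 (b / (m + 1)) :=
      l.1.monotone (div_le_div_of_nonneg_right (by exact_mod_cast hab) hm.le)
    have ha := h.mem a
    have hb := h.mem b
    rcases Int.units_eq_one_or (G.sign (w : G)) with hw | hw <;> rw [hw] at ha hb ⊢
    · simp only [Units.val_one, Int.cast_one, one_mul] at ha hb ⊢
      exact hS.lab_mono ha hb h1
    · simp only [Units.val_neg, Units.val_one, Int.cast_neg, Int.cast_one, neg_mul, one_mul]
        at ha hb ⊢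
      exact neg_le_neg (hS.lab_mono hb ha (neg_le_neg h1))
  · have h1 : (((j + (m + 1) : ℤ) : ℝ) / (m + 1)) = j / (m + 1) + (1 : ℤ) := by
      push_cast; field_simp
    rw [h1, liftGroup.apply_add_int, mul_add, ← Int.cast_mul, mul_one, hS.lab_add_int (h.mem j)]
    rw [mul_add, DeltaG.sign_mul_sign_mul]

variable (H m n S) in
/-- The morphism `[m] ⟶ [n]` of `ΔG` defined by an element of the planar homeomorphism group which
maps the roots of unity to a marking. -/
def cl (h : H) : DeltaG.Hom G m n :=
  have : Nonempty (DeltaG.Hom G m n) := ⟨DeltaG.ofOrderHom (OrderHom.const _ 0)⟩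
  Classical.epsilon fun v => ∃ w l f, h = H.elt w l ∧ LabelsEq m n S (G.sign (w : G)) l f ∧
    v = DeltaG.cls w f

theorem cl_elt (hS : IsMarking n S) (h : H.MapsRoots m S (H.elt w l)) {f : Para m n}
    (hf : LabelsEq m n S (G.sign (w : G)) l f) : H.cl m n S (H.elt w l) = DeltaG.cls w f := by
  obtain ⟨w', l', f', h1, h2, h3⟩ := Classical.epsilon_spec
    (p := fun v => ∃ w' l' f', H.elt w l = H.elt w' l' ∧
      LabelsEq m n S (G.sign (w' : G)) l' f' ∧ v = DeltaG.cls w' f') ⟨_, w, l, f, rfl, hf, rfl⟩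
  refine Eq.trans h3 (Eq.symm ?_)
  obtain ⟨k, rfl, rfl⟩ := H.elt_eq_elt h1
  refine DeltaG.cls_eq_iff.2 ⟨k, rfl, Para.ext' fun j => ?_⟩
  have hs : G.sign ((w * G.turn k : G.base) : G) = G.sign (w : G) := by
    rw [Subgroup.coe_mul, map_mul, G.sign_turn, mul_one]
  rw [hs] at h2
  rw [h1] at h
  have hmem := h.mem j
  rw [hs] at hmem
  rw [Para.shift_apply, hf, h2, liftGroup.mul_apply, liftGroup.transl_apply, mul_add,
    ← Int.cast_mul, hS.lab_add_int hmem, mul_add, mul_assoc, DeltaG.sign_mul_sign_mul]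

theorem exists_cl_eq (hS : IsMarking n S) (h : H) (hh : H.MapsRoots m S h) :
    ∃ w l f, h = H.elt w l ∧ LabelsEq m n S (G.sign (w : G)) l f ∧
      H.cl m n S h = DeltaG.cls w f := by
  obtain ⟨w, l, rfl⟩ := H.exists_elt h
  obtain ⟨f, hf⟩ := exists_labelsEq hS hh
  exact ⟨w, l, f, rfl, hf, cl_elt hS hh hf⟩

theorem uIcc_image (ε : ℤˣ) (l : liftGroup) {s t u : ℝ}
    (hu : u ∈ Set.uIcc (((ε : ℤ) : ℝ) * l.1 s) (((ε : ℤ) : ℝ) * l.1 t)) :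
    ∃ v ∈ Set.uIcc s t, u = ((ε : ℤ) : ℝ) * l.1 v := by
  have hc := l.1.continuous
  have := intermediate_value_uIcc (f := fun v => ((ε : ℤ) : ℝ) * l.1 v) (a := s) (b := t)
    (by fun_prop) hu
  obtain ⟨v, hv, rfl⟩ := this
  exact ⟨v, hv, rfl⟩

/-- If `w ∘ l` maps `A` to `S`, then the label of the image of a point of `A` depends only on the
component of `A`. -/
theorem lab_image_eq (hS : IsMarking n S) (hA : Set.MapsTo (H.q (H.elt w l)) A S) {s t : ℝ}
    (h : ∀ u ∈ Set.uIcc s t, ez u ∈ A) :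
    lab n S (((G.sign (w : G) : ℤ) : ℝ) * l.1 s) =
      lab n S (((G.sign (w : G) : ℤ) : ℝ) * l.1 t) :=
  hS.lab_eq_of_uIcc fun u hu => by
    obtain ⟨v, hv, rfl⟩ := uIcc_image _ _ hu
    rw [← q_elt]
    exact hA (h v hv)

theorem cl_mul (hS : IsMarking n S) (hS' : IsMarking k S') {h h' : H} (hh : H.MapsRoots m S h)
    (hh' : Set.MapsTo (H.q h') S S') :
    H.cl m k S' (h' * h) = DeltaG.comp (H.cl m n S h) (H.cl n k S' h') := by
  have hr' : H.MapsRoots n S' h' := fun j => hh' (hS.root_mem j)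
  have hr : H.MapsRoots m S' (h' * h) := fun j => by
    rw [q_mul_apply]; exact hh' (hh j)
  obtain ⟨w, l, f, rfl, hf, e⟩ := exists_cl_eq hS h hh
  obtain ⟨w', l', f', rfl, hf', e'⟩ := exists_cl_eq hS' h' hr'
  rw [e, e', DeltaG.comp_cls]
  rw [elt_mul_elt] at hr ⊢
  refine cl_elt hS' hr fun j => ?_
  have hs : G.sign ((w' * w : G.base) : G) = G.sign (w : G) * G.sign (w' : G) := by
    rw [Subgroup.coe_mul, map_mul, mul_comm]
  have key := lab_image_eq hS' hh' (hS.lab_spec (hh.mem j))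
  rw [hf.lab_eq] at key
  rw [Para.comp_apply, Para.conj_apply, hf', hs, ← key, liftGroup.mul_apply, liftGroup.conj_apply,
    Units.val_mul, Int.cast_mul, mul_assoc, mul_assoc]
  rw [mul_left_comm (((G.sign (w : G) : ℤˣ) : ℤ) : ℝ), unit_mul_unit_mul]

theorem cl_one (hS : IsMarking n S) : H.cl n n S 1 = DeltaG.idHom n := by
  rw [← H.elt_one_one]
  refine cl_elt hS (fun j => ?_) fun j => ?_
  · rw [elt_one_one, map_one]; exact hS.root_mem j
  · simp [hS.lab_root]

theorem cl_path (hS : IsMarking n S) {γ : I → H} (hγ : Continuous γ)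
    (h : ∀ s, H.MapsRoots m S (γ s)) : H.cl m n S (γ 0) = H.cl m n S (γ 1) := by
  obtain ⟨w, l₀, f, h0, hf, e⟩ := exists_cl_eq hS (γ 0) (h 0)
  obtain ⟨l, hl, rfl, hγl⟩ := exists_path_lift H hγ h0
  have h1 := h 1
  rw [hγl] at h1
  rw [e, hγl 1]
  refine (cl_elt hS h1 fun j => ?_).symm
  rw [hf]
  congr 1
  refine hS.lab_eq_of_uIcc fun u hu => ?_
  have hc : Continuous fun s => ((G.sign (w : G) : ℤ) : ℝ) * (l s).1 (j / (m + 1)) :=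
    continuous_const.mul ((liftGroup.continuous_apply _).comp hl)
  obtain ⟨s, rfl⟩ : u ∈ Set.range fun s => ((G.sign (w : G) : ℤ) : ℝ) * (l s).1 (j / (m + 1)) := by
    rcases Set.mem_uIcc.1 hu with ⟨a, b⟩ | ⟨a, b⟩
    · exact mem_range_of_exists_le_of_exists_ge hc ⟨0, a⟩ ⟨1, b⟩
    · exact mem_range_of_exists_le_of_exists_ge hc ⟨1, a⟩ ⟨0, b⟩
  have hs := h s
  rw [hγl] at hs
  exact hs.mem j

/-- Homeomorphisms with the same class can be joined by a path. -/
theorem exists_path_of_cl_eq (hS : IsMarking n S) (hA : ∀ j : ℤ, ez (j / (m + 1)) ∈ A)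
    (hA' : ∀ t, ez t ∈ A → ∃ j : ℤ, ∀ u ∈ Set.uIcc t (j / (m + 1)), ez u ∈ A) {h h' : H}
    (hh : Set.MapsTo (H.q h) A S) (hh' : Set.MapsTo (H.q h') A S)
    (e : H.cl m n S h = H.cl m n S h') :
    ∃ γ : Path h h', ∀ s, Set.MapsTo (H.q (γ s)) A S ∧ H.cl m n S (γ s) = H.cl m n S h := by
  obtain ⟨w, l, f, rfl, hf, ef⟩ := exists_cl_eq hS h fun j => hh (hA j)
  obtain ⟨w', l', f', rfl, hf', ef'⟩ := exists_cl_eq hS h' fun j => hh' (hA j)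
  rw [ef, ef', DeltaG.cls_eq_iff] at e
  obtain ⟨k, rfl, rfl⟩ := e
  have hs : G.sign ((w * G.turn k : G.base) : G) = G.sign (w : G) := by
    rw [Subgroup.coe_mul, map_mul, G.sign_turn, mul_one]
  have hlab : ∀ t, ez t ∈ A → lab n S (((G.sign (w : G) : ℤ) : ℝ) * l.1 t) =
      lab n S (((G.sign (w : G) : ℤ) : ℝ) * (liftGroup.transl k * l').1 t) := fun t ht => by
    obtain ⟨j, hj⟩ := hA' t ht
    have e1 := lab_image_eq hS hh' hj
    rw [hs] at e1
    have m1 := hh' ht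
    have m2 := hh' (hA j)
    rw [q_elt, hs] at m1 m2
    rw [lab_image_eq hS hh hj, hf.lab_eq, liftGroup.mul_apply, liftGroup.transl_apply, mul_add,
      ← Int.cast_mul, hS.lab_add_int m1, e1, Para.shift_apply]
    rw [hs] at hf'
    rw [hf'.lab_eq]
    ring
  have hmem : ∀ s t, ez t ∈ A → ∀ u ∈ Set.uIcc (((G.sign (w : G) : ℤ) : ℝ) * l.1 t)
      (((G.sign (w : G) : ℤ) : ℝ) * (liftGroup.segment l (liftGroup.transl k * l') s).1 t),
      ez u ∈ S := fun s t ht u hu => by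
    have m1 := hh ht
    have m2 := hh' ht
    rw [elt_mul_turn] at m2
    rw [q_elt] at m1 m2
    refine hS.mem_of_lab_eq m1 m2 (hlab t ht) u (Set.uIcc_subset_uIcc_left ?_ hu)
    have := liftGroup.segment_mem_uIcc l (liftGroup.transl k * l') s t
    rcases Int.units_eq_one_or (G.sign (w : G)) with h | h <;> rw [h]
    · simpa using this
    · rw [Set.mem_uIcc] at this ⊢
      simpa [or_comm, and_comm] using this
  have hmaps : ∀ s, Set.MapsTo
      (H.q (H.elt w (liftGroup.segment l (liftGroup.transl k * l') s))) A S := fun s z hz => by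
    obtain ⟨t, rfl⟩ := ez_surjective z
    rw [q_elt]
    exact hmem s t hz _ Set.right_mem_uIcc
  refine ⟨⟨⟨fun s => H.elt w (liftGroup.segment l (liftGroup.transl k * l') s), ?_⟩, ?_, ?_⟩,
    fun s => ⟨hmaps s, ?_⟩⟩
  · exact (H.continuous_elt w).comp (liftGroup.segmentPath l (liftGroup.transl k * l')).continuous
  · exact congrArg (H.elt w) (liftGroup.segment_zero _ _)
  · rw [elt_mul_turn]
    exact congrArg (H.elt w) (liftGroup.segment_one _ _)
  · rw [ef]
    refine cl_elt hS (fun j => hmaps s (hA j)) fun j => ?_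
    rw [hf]
    congr 1
    exact hS.lab_eq_of_uIcc (hmem s _ (hA j))

end PlanarHomeoGroup

/-! ### Components of closed markings -/

/-- A marking which is closed and such that no component is a point. -/
structure IsFatMarking (n : ℕ) (S : Set Circle) : Prop extends IsMarking n S where
  isClosed : IsClosed S
  exists_ne : ∀ t, ez t ∈ S → ∃ t', t' ≠ t ∧ ∀ u ∈ Set.uIcc t t', ez u ∈ S

namespace IsFatMarking

variable {n : ℕ} {S : Set Circle}

theorem exists_Icc (hS : IsFatMarking n S) (j : ℤ) :
    ∃ a b : ℝ, a < b ∧ ∀ t, t ∈ Set.Icc a b ↔ ez t ∈ S ∧ lab n S t = j := by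
  have hm := hS.toIsMarking
  let K : Set ℝ := {t | ez t ∈ S ∧ lab n S t = j}
  have hmem : ∀ t ∈ K, ∀ u ∈ Set.uIcc t (j / (n + 1)), ez u ∈ S := fun t ht u hu => by
    have := hm.lab_spec ht.1
    rw [ht.2] at this
    exact this u hu
  have hr : (j / (n + 1) : ℝ) ∈ K := ⟨hm.root_mem j, hm.lab_root j⟩
  have hba : BddAbove K := ⟨((j + 1 : ℤ) / (n + 1) : ℝ), fun t ht => by
    by_contra h
    have := hm.lab_mono (hm.root_mem (j + 1)) ht.1 (not_le.1 h).le
    rw [hm.lab_root, ht.2] at this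
    omega⟩
  have hbb : BddBelow K := ⟨((j - 1 : ℤ) / (n + 1) : ℝ), fun t ht => by
    by_contra h
    have := hm.lab_mono ht.1 (hm.root_mem (j - 1)) (not_le.1 h).le
    rw [hm.lab_root, ht.2] at this
    omega⟩
  have hcl : IsClosed {t | ez t ∈ S} := hS.isClosed.preimage continuous_ez
  have hsup : ez (sSup K) ∈ S :=
    closure_minimal (fun t ht => ht.1) hcl (csSup_mem_closure ⟨_, hr⟩ hba)
  have hinf : ez (sInf K) ∈ S :=
    closure_minimal (fun t ht => ht.1) hcl (csInf_mem_closure ⟨_, hr⟩ hbb)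
  have hsr : (j / (n + 1) : ℝ) ≤ sSup K := le_csSup hba hr
  have hir : sInf K ≤ (j / (n + 1) : ℝ) := csInf_le hbb hr
  have key : ∀ t ∈ Set.Icc (sInf K) (sSup K), ez t ∈ S := fun t ht => by
    rcases ht.2.eq_or_lt with rfl | h2
    · exact hsup
    rcases ht.1.eq_or_lt with rfl | h1
    · exact hinf
    obtain ⟨c, hc, hc'⟩ := exists_lt_of_csInf_lt ⟨_, hr⟩ h1
    obtain ⟨d, hd, hd'⟩ := exists_lt_of_lt_csSup ⟨_, hr⟩ h2
    rcases le_total t (j / (n + 1)) with h | h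
    · exact hmem c hc t (Set.mem_uIcc.2 (Or.inl ⟨hc'.le, h⟩))
    · exact hmem d hd t (Set.mem_uIcc.2 (Or.inr ⟨h, hd'.le⟩))
  have hiff : ∀ t, t ∈ Set.Icc (sInf K) (sSup K) ↔ ez t ∈ S ∧ lab n S t = j := fun t => by
    refine ⟨fun ht => ⟨key t ht, hm.lab_eq fun u hu => key u ?_⟩,
      fun ht => ⟨csInf_le hbb ht, le_csSup hba ht⟩⟩
    exact Set.uIcc_subset_Icc ht ⟨hir, hsr⟩ hu
  refine ⟨sInf K, sSup K, ?_, hiff⟩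
  obtain ⟨t', hne, ht'⟩ := hS.exists_ne _ (hm.root_mem j)
  have h2 : t' ∈ K := ⟨ht' t' Set.right_mem_uIcc, by rw [← hm.lab_eq_of_uIcc ht', hm.lab_root]⟩
  have h3 := csInf_le hbb h2
  have h4 := le_csSup hba h2
  rcases lt_or_gt_of_ne hne with h | h <;> linarith

/-- The left end of the `j`-th component. -/
def lo (hS : IsFatMarking n S) (j : ℤ) : ℝ := (hS.exists_Icc j).choose

/-- The right end of the `j`-th component. -/
def hi (hS : IsFatMarking n S) (j : ℤ) : ℝ := (hS.exists_Icc j).choose_spec.choose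

theorem lo_lt_hi (hS : IsFatMarking n S) (j : ℤ) :
    hS.lo j < hS.hi j := (hS.exists_Icc j).choose_spec.choose_spec.1

theorem mem_Icc_iff (hS : IsFatMarking n S) {j : ℤ} {t : ℝ} :
    t ∈ Set.Icc (hS.lo j) (hS.hi j) ↔ ez t ∈ S ∧ lab n S t = j :=
  (hS.exists_Icc j).choose_spec.choose_spec.2 t

theorem hi_lt_lo (hS : IsFatMarking n S) {i j : ℤ} (h : i < j) : hS.hi i < hS.lo j := by
  have h1 := hS.mem_Icc_iff.1 (Set.right_mem_Icc.2 (hS.lo_lt_hi i).le)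
  have h2 := hS.mem_Icc_iff.1 (Set.left_mem_Icc.2 (hS.lo_lt_hi j).le)
  by_contra hle
  have := hS.lab_mono h2.1 h1.1 (not_lt.1 hle)
  omega

theorem lo_hi_add (hS : IsFatMarking n S) (j : ℤ) :
    hS.lo (j + (n + 1)) = hS.lo j + 1 ∧ hS.hi (j + (n + 1)) = hS.hi j + 1 := by
  have h1 : Set.Icc (hS.lo (j + (n + 1))) (hS.hi (j + (n + 1))) =
      Set.Icc (hS.lo j + 1) (hS.hi j + 1) := by
    ext t
    have h2 : t ∈ Set.Icc (hS.lo j + 1) (hS.hi j + 1) ↔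
        t + (-1 : ℤ) ∈ Set.Icc (hS.lo j) (hS.hi j) := by
      simp only [Set.mem_Icc]; push_cast
      constructor <;> rintro ⟨a, b⟩ <;> constructor <;> linarith
    rw [h2, hS.mem_Icc_iff, hS.mem_Icc_iff, ez_add_int]
    refine and_congr_right fun h => ?_
    rw [hS.lab_add_int h]
    omega
  have h3 := (Set.Icc_eq_Icc_iff (hS.lo_lt_hi (j + (n + 1))).le).1 h1
  exact h3

/-- The midpoint of the `j`-th component. -/
def mid (hS : IsFatMarking n S) (j : ℤ) : ℝ := (hS.lo j + hS.hi j) / 2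

/-- Half of the length of the `j`-th component. -/
def rad (hS : IsFatMarking n S) (j : ℤ) : ℝ := (hS.hi j - hS.lo j) / 2

theorem rad_pos (hS : IsFatMarking n S) (j : ℤ) : 0 < hS.rad j := by
  have := hS.lo_lt_hi j
  rw [rad]; linarith

theorem mid_mono (hS : IsFatMarking n S) : Monotone hS.mid := (monotone_int_of_le_succ fun j => by
  have h1 := hS.lo_lt_hi j
  have h2 := hS.hi_lt_lo (lt_add_one j)
  have h3 := hS.lo_lt_hi (j + 1)
  rw [mid, mid]; linarith)

theorem mid_add (hS : IsFatMarking n S) (j : ℤ) : hS.mid (j + (n + 1)) = hS.mid j + 1 := by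
  obtain ⟨h1, h2⟩ := hS.lo_hi_add j
  rw [mid, mid, h1, h2]; ring

theorem rad_add (hS : IsFatMarking n S) (j : ℤ) : hS.rad (j + (n + 1)) = hS.rad j := by
  obtain ⟨h1, h2⟩ := hS.lo_hi_add j
  rw [rad, rad, h1, h2]; ring

theorem mem_of_abs_le (hS : IsFatMarking n S) {j : ℤ} {t : ℝ} (h : |t - hS.mid j| ≤ hS.rad j) :
    ez t ∈ S ∧ lab n S t = j := by
  refine hS.mem_Icc_iff.1 ?_
  rw [abs_le, mid, rad] at h
  constructor <;> linarith [h.1, h.2]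

/-- The sequence of all ends of components. -/
def node (hS : IsFatMarking n S) (i : ℤ) : ℝ := if i % 2 = 0 then hS.lo (i / 2) else hS.hi (i / 2)

theorem node_even (hS : IsFatMarking n S) (j : ℤ) : hS.node (2 * j) = hS.lo j := by
  rw [node, if_pos (by omega), show 2 * j / 2 = j by omega]

theorem node_odd (hS : IsFatMarking n S) (j : ℤ) : hS.node (2 * j + 1) = hS.hi j := by
  rw [node, if_neg (by omega), show (2 * j + 1) / 2 = j by omega]

theorem node_strictMono (hS : IsFatMarking n S) :
    StrictMono hS.node := strictMono_int_of_lt_succ fun i => by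
  rcases Int.even_or_odd' i with ⟨j, rfl | rfl⟩
  · rw [node_even, node_odd]; exact hS.lo_lt_hi j
  · rw [show 2 * j + 1 + 1 = 2 * (j + 1) by ring, node_even, node_odd]
    exact hS.hi_lt_lo (lt_add_one j)

theorem node_add (hS : IsFatMarking n S) (i : ℤ) :
    hS.node (i + (2 * (n + 1) : ℕ)) = hS.node i + 1 := by
  push_cast
  rcases Int.even_or_odd' i with ⟨j, rfl | rfl⟩
  · rw [show 2 * j + 2 * ((n : ℤ) + 1) = 2 * (j + (n + 1)) by ring, node_even, node_even,
      (hS.lo_hi_add j).1]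
  · rw [show 2 * j + 1 + 2 * ((n : ℤ) + 1) = 2 * (j + (n + 1)) + 1 by ring, node_odd, node_odd,
      (hS.lo_hi_add j).2]

end IsFatMarking

theorem exists_small_factor {N : ℕ} (hN : 0 < N) {D R : ℤ → ℝ} (hR : ∀ i, 0 < R i)
    (hD : ∀ i, D (i + N) = D i) (hR' : ∀ i, R (i + N) = R i) :
    ∃ δ : ℝ, 0 < δ ∧ δ < 1 ∧ ∀ i, δ * D i ≤ R i := by
  have h1 : ∀ i ∈ Finset.Ico (0 : ℤ) N, ∀ᶠ δ in 𝓝[>] (0 : ℝ), δ * D i < R i := fun i _ => by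
    have : Filter.Tendsto (fun δ => δ * D i) (𝓝[>] (0 : ℝ)) (𝓝 (0 * D i)) :=
      ((continuous_id.mul continuous_const).tendsto 0).mono_left nhdsWithin_le_nhds
    exact this.eventually_lt_const (by simpa using hR i)
  obtain ⟨δ, h2, h3⟩ := (((Filter.eventually_all_finset _).2 h1).and
    (Ioo_mem_nhdsGT (zero_lt_one' ℝ))).exists
  refine ⟨δ, h3.1, h3.2, fun i => ?_⟩
  have hper : ∀ {F : ℤ → ℝ}, (∀ i, F (i + N) = F i) → F (i % N) = F i := fun {F} hF => by
    have hp : Function.Periodic F (N : ℤ) := hF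
    have := hp.int_mul (i / N) (i % N)
    rw [← this]
    congr 1
    push_cast
    linarith [Int.emod_add_mul_ediv i N, mul_comm (N : ℤ) (i / N)]
  have hN' : (0 : ℤ) < N := by exact_mod_cast hN
  have := h2 (i % N) (Finset.mem_Ico.2 ⟨Int.emod_nonneg _ hN'.ne', Int.emod_lt_of_pos _ hN'⟩)
  rw [hper hD, hper hR'] at this
  exact this.le

namespace PlanarHomeoGroup

variable {G : PlanarLieGroup.{u}} {H : PlanarHomeoGroup G} {m n : ℕ} {S A : Set Circle}

/-- Every morphism `[m] ⟶ [n]` is the class of a homeomorphism. -/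
theorem exists_cl_eq_of_isFatMarking (hA : IsFatMarking m A) (hS : IsFatMarking n S)
    (v : DeltaG.Hom G m n) : ∃ h : H, Set.MapsTo (H.q h) A S ∧ H.cl m n S h = v := by
  obtain ⟨w, f, rfl⟩ := DeltaG.exists_cls v
  set ε := G.sign (w : G) with hε
  have hN : 0 < 2 * (m + 1) := by positivity
  let y : ℤ → ℝ := fun j => ((ε : ℤ) : ℝ) * hS.mid (ε * f j)
  have hy : Monotone y := fun a b hab => by
    have := f.mono hab
    rcases Int.units_eq_one_or ε with h | h <;> simp only [y, h]
    · simpa using hS.mid_mono this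
    · simpa using hS.mid_mono (neg_le_neg this)
  have hfadd : ∀ j, ε * f (j + (m + 1)) = ε * f j + ε * (n + 1) := fun j => by
    rw [f.map_add, mul_add]
  have hyadd : ∀ j, y (j + (m + 1)) = y j + 1 := fun j => by
    simp only [y, hfadd]
    rcases Int.units_eq_one_or ε with h | h <;> simp only [h]
    · simpa using hS.mid_add (f j)
    · have := hS.mid_add (-f j + -(n + 1))
      rw [neg_add_cancel_right] at this
      simp only [Units.val_neg, Units.val_one, Int.cast_neg, Int.cast_one, neg_mul, one_mul]
      linarith
  let r : ℤ → ℝ := fun j => hS.rad (ε * f j)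
  have hradd : ∀ j, r (j + (m + 1)) = r j := fun j => by
    simp only [r, hfadd]
    rcases Int.units_eq_one_or ε with h | h <;> simp only [h]
    · simpa using hS.rad_add (f j)
    · have := hS.rad_add (-f j + -(n + 1))
      rw [neg_add_cancel_right] at this
      simp only [Units.val_neg, Units.val_one, neg_mul, one_mul]
      linarith
  have hhalf : ∀ i : ℤ, (i + (2 * (m + 1) : ℕ)) / 2 = i / 2 + (m + 1) := fun i => by omega
  obtain ⟨δ, hδ0, hδ1, hδ⟩ := exists_small_factor hN (D := fun i => |hA.node i - y (i / 2)|)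
    (R := fun i => r (i / 2)) (fun i => hS.rad_pos _)
    (fun i => by simp only [hhalf, hA.node_add, hyadd]; congr 1; ring)
    (fun i => by simp only [hhalf, hradd])
  obtain ⟨l₁, h₁⟩ := liftGroup.exists_interpolation hN hA.node_strictMono hA.node_add
  obtain ⟨l₂, h₂⟩ := liftGroup.exists_interpolation hN
    (X := fun i => (1 - δ) * y (i / 2) + δ * hA.node i)
    (fun a b hab => by
      have e1 : y (a / 2) ≤ y (b / 2) := hy (by omega)
      have e2 := mul_lt_mul_of_pos_left (hA.node_strictMono hab) hδ0
      have e3 := mul_le_mul_of_nonneg_left e1 (sub_nonneg.2 hδ1.le)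
      dsimp only
      linarith)
    (fun i => by simp only [hhalf, hA.node_add, hyadd]; ring)
  have hl : ∀ i, |(l₂ * l₁⁻¹).1 (hA.node i) - y (i / 2)| ≤ r (i / 2) := fun i => by
    have e1 : (l₂ * l₁⁻¹).1 (hA.node i) - y (i / 2) = δ * (hA.node i - y (i / 2)) := by
      rw [liftGroup.mul_apply, ← h₁ i, liftGroup.inv_apply_self, h₂, h₁]; ring
    rw [e1, abs_mul, abs_of_pos hδ0]
    exact hδ i
  have key : ∀ t, ez t ∈ A → ez (((ε : ℤ) : ℝ) * (l₂ * l₁⁻¹).1 t) ∈ S ∧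
      lab n S (((ε : ℤ) : ℝ) * (l₂ * l₁⁻¹).1 t) = ε * f (lab m A t) := fun t ht => by
    have hI := hA.mem_Icc_iff.2 ⟨ht, rfl⟩
    have e1 := hl (2 * lab m A t)
    have e2 := hl (2 * lab m A t + 1)
    rw [hA.node_even, show 2 * lab m A t / 2 = lab m A t by omega] at e1
    rw [hA.node_odd, show (2 * lab m A t + 1) / 2 = lab m A t by omega] at e2
    have e3 := (l₂ * l₁⁻¹).1.monotone hI.1
    have e4 := (l₂ * l₁⁻¹).1.monotone hI.2
    refine hS.mem_of_abs_le ?_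
    have e5 : |(l₂ * l₁⁻¹).1 t - y (lab m A t)| ≤ r (lab m A t) := by
      rw [abs_le] at e1 e2 ⊢
      constructor <;> linarith [e1.1, e2.2]
    have e6 : ((ε : ℤ) : ℝ) * (l₂ * l₁⁻¹).1 t - hS.mid (ε * f (lab m A t)) =
        ((ε : ℤ) : ℝ) * ((l₂ * l₁⁻¹).1 t - y (lab m A t)) := by
      simp only [y]
      rw [mul_sub, unit_mul_unit_mul]
    have e7 : |((ε : ℤ) : ℝ)| = 1 := by
      rcases Int.units_eq_one_or ε with h | h <;> simp [h]
    rw [e6, abs_mul, e7, one_mul]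
    exact e5
  have hmaps : Set.MapsTo (H.q (H.elt w (l₂ * l₁⁻¹))) A S := fun z hz => by
    obtain ⟨t, rfl⟩ := ez_surjective z
    rw [q_elt]
    exact (key t hz).1
  refine ⟨H.elt w (l₂ * l₁⁻¹), hmaps, ?_⟩
  refine cl_elt hS.toIsMarking (fun j => hmaps (hA.root_mem j)) fun j => ?_
  rw [← hε, (key _ (hA.root_mem j)).2, hA.lab_root, DeltaG.sign_mul_sign_mul]

end PlanarHomeoGroup

/-! ### The action of the crossed simplicial group on vertices -/

/-- The residue class of an integer modulo `n + 1`. -/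
def modFin (n : ℕ) (j : ℤ) : Fin (n + 1) := ⟨(j % (n + 1)).toNat, by
  have h1 := Int.emod_lt_of_pos j (show (0 : ℤ) < n + 1 by positivity)
  omega⟩

theorem modFin_val (n : ℕ) (j : ℤ) : ((modFin n j : ℕ) : ℤ) = j % (n + 1) :=
  Int.toNat_of_nonneg (Int.emod_nonneg j (by positivity))

theorem modFin_add_mul (n : ℕ) (j : ℤ) :
    j = ((modFin n j : ℕ) : ℤ) + j / (n + 1) * (n + 1) := by
  rw [modFin_val, mul_comm]; exact (Int.emod_add_mul_ediv j (n + 1)).symm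

theorem modFin_coe (n : ℕ) (k : Fin (n + 1)) : modFin n ((k : ℕ) : ℤ) = k := by
  apply Fin.ext
  have h := modFin_val n ((k : ℕ) : ℤ)
  rw [Int.emod_eq_of_lt (by positivity) (by exact_mod_cast k.2)] at h
  exact_mod_cast h

/-- The map `{0, …, m} → {0, …, n}` induced by a morphism of `ΔG`. -/
def DeltaG.vertexMap {G : PlanarLieGroup.{u}} {m n : ℕ} (v : DeltaG.Hom G m n) (k : Fin (m + 1)) :
    Fin (n + 1) := lam (DeltaG.incl G) (m := m) (n := n) v k

theorem DeltaG.vertexMap_cls {G : PlanarLieGroup.{u}} {m n : ℕ} (w : G.base) (f : Para m n)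
    (k : Fin (m + 1)) :
    DeltaG.vertexMap (DeltaG.cls w f) k = modFin n (G.sign (w : G) * f ((k : ℕ) : ℤ)) := by
  set ε := G.sign (w : G) with hε
  set q : ℤ := (ε * f ((k : ℕ) : ℤ)) / (n + 1) with hq
  obtain ⟨v', h1, h2⟩ := DeltaG.exists_inverse (n := 0) w (ε * q)
  refine lam_eq (DeltaG.incl G) (g := ⟨DeltaG.autHom 0 w (ε * q), v', h1, h2⟩) ?_
  show DeltaG.comp (DeltaG.cls 1 (Para.ofOrderHom _)) (DeltaG.cls w f) =
    DeltaG.comp (DeltaG.autHom 0 w (ε * q)) (DeltaG.ofOrderHom _)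
  rw [DeltaG.autHom_comp_ofOrderHom, DeltaG.comp_cls, mul_one, ← hε]
  refine congrArg (DeltaG.cls w) (Para.ext_fin fun a => ?_)
  obtain rfl : a = 0 := Subsingleton.elim (α := Fin 1) _ _
  have e1 := Para.ofOrderHom_apply (vertex m k).toOrderHom 0
  have e2 := (Para.ofOrderHom (vertex n (modFin n (ε * f ((k : ℕ) : ℤ)))).toOrderHom).map_add_mul 0 q
  have e3 := Para.ofOrderHom_apply (vertex n (modFin n (ε * f ((k : ℕ) : ℤ)))).toOrderHom 0
  have e4 := modFin_add_mul n (ε * f ((k : ℕ) : ℤ))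
  simp only [Para.comp_apply, Para.conj_apply, Para.trans_apply, DeltaG.sign_mul_sign_mul] at *
  simp only [Subgroup.coe_one, map_one, Units.val_one, one_mul]
  rw [e1]
  have h0 : ((0 : Fin (0 + 1)) : ℕ) = 0 := rfl
  simp only [h0, mul_zero, zero_add, CharP.cast_eq_zero, mul_one] at e2 e3 ⊢
  rw [e2, e3]
  show f ((k : ℕ) : ℤ) = ε * (((modFin n _ : ℕ) : ℤ) + q * (n + 1))
  rw [← hq] at e4
  rw [← e4, DeltaG.sign_mul_sign_mul]

theorem lam_bijective {D : Type w} [Category.{u} D] (i : SimplexCategory ⥤ D)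
    [IsCrossedSimplicialGroup i] {n : ℕ} (g : Gen i n) : Function.Bijective (lam i g.hom) :=
  Function.bijective_iff_has_inverse.2 ⟨lam i g.inv,
    fun k => by rw [← lam_comp, g.hom_inv_id, lam_id],
    fun k => by rw [← lam_comp, g.inv_hom_id, lam_id]⟩

/-! ### The geometry of marked circles -/

namespace MarkedCircle

variable {G : PlanarLieGroup.{u}} {H : PlanarHomeoGroup G}

theorem root_eq (n : ℕ) (k : Fin (n + 1)) : root n k = ez (((k : ℕ) : ℤ) / (n + 1)) := by
  rw [root, ez]; congr 1; push_cast; ring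

theorem ez_eq_root (n : ℕ) (j : ℤ) : ez (j / (n + 1)) = root n (modFin n j) := by
  rw [root_eq, ez_eq_iff]
  refine ⟨j / (n + 1), ?_⟩
  have hn : (n + 1 : ℝ) ≠ 0 := by positivity
  have h := modFin_add_mul n j
  have h' : (j : ℝ) = (((modFin n j : ℕ) : ℤ) : ℝ) + ((j / (n + 1) : ℤ) : ℝ) * (n + 1) := by
    exact_mod_cast h
  rw [div_add' _ _ _ hn, ← h']

variable (X : MarkedCircle H)

/-- The unique `h` with `x h = y`. -/
def gap (x y : X.F) : H := (X.isHomeomorph_act x).homeomorph.symm y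

theorem act_gap (x y : X.F) : X.act x (X.gap x y) = y :=
  (X.isHomeomorph_act x).homeomorph.apply_symm_apply y

theorem gap_act (x : X.F) (h : H) : X.gap x (X.act x h) = h :=
  (X.isHomeomorph_act x).homeomorph.symm_apply_apply h

theorem continuous_gap (x : X.F) : Continuous (X.gap x) :=
  (X.isHomeomorph_act x).homeomorph.symm.continuous

theorem continuous_act (x : X.F) : Continuous (X.act x) := (X.isHomeomorph_act x).continuous

theorem gap_self (x : X.F) : X.gap x x = 1 := by
  conv_lhs => rw [← X.act_one x]
  rw [X.act_one x]
  nth_rewrite 2 [← X.act_one x]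
  rw [gap_act]

theorem gap_mul_gap (x y z : X.F) : X.gap x y * X.gap y z = X.gap x z := by
  rw [← X.gap_act x (_ * _), X.act_mul, act_gap, act_gap]

theorem gap_act_right (x y : X.F) (h : H) : X.gap x (X.act y h) = X.gap x y * h := by
  rw [← X.gap_mul_gap x y, gap_act]

theorem ρ_gap (x y : X.F) (z : Circle) : X.ρ y z = X.ρ x (H.q (X.gap x y) z) := by
  rw [← X.ρ_act, act_gap]

theorem continuous_ρ_apply (z : Circle) : Continuous fun x => X.ρ x z := by
  obtain ⟨x₀⟩ := X.nonempty_F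
  refine Continuous.congr ?_ fun x => (X.ρ_gap x₀ x z).symm
  exact (X.ρ x₀).continuous.comp ((continuous_homeo_eval Circle Circle).comp
    ((H.continuous_q.comp (X.continuous_gap x₀)).prodMk continuous_const))

/-- The preimage of `J` in the standard circle. -/
def pre (x : X.F) : Set Circle := X.ρ x ⁻¹' X.J

theorem mapsTo_pre (x y : X.F) : Set.MapsTo (H.q (X.gap x y)) (X.pre y) (X.pre x) := fun z hz => by
  show X.ρ x _ ∈ X.J
  rw [← ρ_gap]
  exact hz

theorem J_ne_univ : X.J ≠ Set.univ := fun h => by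
  obtain ⟨k, ⟨e⟩⟩ := X.exists_intervals
  obtain ⟨φ⟩ := X.nonempty_homeo
  have hmem : ∀ z, φ z ∈ X.J := fun z => by rw [h]; trivial
  let ψ : Circle → X.J := fun z => ⟨φ z, hmem z⟩
  have hψ : Continuous ψ := φ.continuous.subtype_mk _
  refine not_injective_of_continuous (f := fun z => ((e (ψ z)).2 : ℝ)) (by fun_prop) ?_
  intro a b hab
  have h1 : (e (ψ a)).1 = (e (ψ b)).1 :=
    PreconnectedSpace.constant inferInstance (f := fun z => (e (ψ z)).1) (by fun_prop)
  have h2 : ψ a = ψ b := e.injective (Prod.ext h1 (Subtype.ext hab))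
  exact φ.injective (congrArg Subtype.val h2)

variable {X}

theorem mk_eq_mk_of_uIcc {x : X.F} {s t : ℝ} (h : ∀ u ∈ Set.uIcc s t, ez u ∈ X.pre x) :
    ZerothHomotopy.mk (⟨X.ρ x (ez s), h s Set.left_mem_uIcc⟩ : X.J) =
      ZerothHomotopy.mk (⟨X.ρ x (ez t), h t Set.right_mem_uIcc⟩ : X.J) := by
  have hmem : ∀ a : I, (1 - (a : ℝ)) * s + a * t ∈ Set.uIcc s t := fun a => by
    rw [← segment_eq_uIcc]
    exact ⟨1 - a, a, sub_nonneg.2 a.2.2, a.2.1, by ring, rfl⟩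
  refine ZerothHomotopy.sound ⟨⟨fun a : I => ⟨X.ρ x (ez ((1 - (a : ℝ)) * s + a * t)),
    h _ (hmem a)⟩, ?_⟩, ?_, ?_⟩
  · refine Continuous.subtype_mk ((X.ρ x).continuous.comp (continuous_ez.comp ?_)) _
    fun_prop
  · simp
  · simp

theorem exists_uIcc_of_mk_eq {x : X.F} {t : ℝ} {z : X.J} (ht : ez t ∈ X.pre x)
    (h : ZerothHomotopy.mk (⟨X.ρ x (ez t), ht⟩ : X.J) = ZerothHomotopy.mk z) :
    ∃ t', X.ρ x (ez t') = z ∧ ∀ u ∈ Set.uIcc t t', ez u ∈ X.pre x := by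
  obtain ⟨γ⟩ : Joined (⟨X.ρ x (ez t), ht⟩ : X.J) z := Quotient.exact h
  have hc : Continuous fun s => (X.ρ x).symm (γ s : X.C) :=
    (X.ρ x).symm.continuous.comp (continuous_subtype_val.comp γ.continuous)
  obtain ⟨Γ, hΓ, h0⟩ := isCoveringMap_ez.exists_path_lifts ⟨_, hc⟩ t (by simp)
  have hΓ' : ∀ s, X.ρ x (ez (Γ s)) = γ s := fun s => by
    have := congrFun hΓ s
    simp only [Function.comp_apply] at this
    rw [this]
    simp
  refine ⟨Γ 1, by rw [hΓ', γ.target], fun u hu => ?_⟩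
  obtain ⟨s, rfl⟩ : u ∈ Set.range Γ := by
    rw [← h0] at hu
    rcases Set.mem_uIcc.1 hu with ⟨a, b⟩ | ⟨a, b⟩
    · exact mem_range_of_exists_le_of_exists_ge Γ.continuous ⟨0, a⟩ ⟨1, b⟩
    · exact mem_range_of_exists_le_of_exists_ge Γ.continuous ⟨1, a⟩ ⟨0, b⟩
  show X.ρ x (ez (Γ s)) ∈ X.J
  rw [hΓ']
  exact (γ s).2

theorem FrameSpace.root_mem {n : ℕ} (x : X.FrameSpace n) (j : ℤ) :
    ez (j / (n + 1)) ∈ X.pre x.1 := by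
  rw [ez_eq_root]; exact x.2.1 _

theorem FrameSpace.isFatMarking {n : ℕ} (x : X.FrameSpace n) : IsFatMarking n (X.pre x.1) where
  root_mem := x.root_mem
  existsUnique t ht := by
    obtain ⟨k, hk⟩ := x.2.2.2 (ZerothHomotopy.mk ⟨X.ρ x.1 (ez t), ht⟩)
    obtain ⟨t', h1, h2⟩ := exists_uIcc_of_mk_eq ht hk.symm
    obtain ⟨c, rfl⟩ := ez_eq_iff.1 (((X.ρ x.1).injective h1).trans (root_eq n k))
    have hn : (n + 1 : ℝ) ≠ 0 := by positivity
    refine ⟨((k : ℕ) : ℤ) + c * (n + 1), ?_, ?_⟩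
    · have e : ((((k : ℕ) : ℤ) + c * (n + 1) : ℤ) : ℝ) / (n + 1) = ((k : ℕ) : ℤ) / (n + 1) + c := by
        push_cast; field_simp
      simp only [e]
      exact h2
    · have key : ∀ a b : ℤ, a < b →
          ¬ ∀ u ∈ Set.uIcc (a / (n + 1) : ℝ) (b / (n + 1)), ez u ∈ X.pre x.1 := by
        intro a b hab hu
        have e1 := mk_eq_mk_of_uIcc hu
        have e2 : modFin n a = modFin n b := by
          apply x.2.2.1
          simp only [← ez_eq_root]
          exact e1
        have e3 := modFin_add_mul n a
        have e4 := modFin_add_mul n b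
        rw [e2] at e3
        have e5 : a / (n + 1) + 1 ≤ b / ((n : ℤ) + 1) := by
          by_contra hlt
          have : b / ((n : ℤ) + 1) ≤ a / (n + 1) := by omega
          have := mul_le_mul_of_nonneg_right this (show (0 : ℤ) ≤ n + 1 by positivity)
          omega
        have e6 : a + (n + 1) ≤ b := by
          have := mul_le_mul_of_nonneg_right e5 (show (0 : ℤ) ≤ n + 1 by positivity)
          rw [add_mul, one_mul] at this
          omega
        have e7 : (a / (n + 1) : ℝ) + 1 ≤ b / (n + 1) := by
          rw [div_add_one hn]
          exact div_le_div_of_nonneg_right (by exact_mod_cast e6) (by positivity)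
        refine X.J_ne_univ (Set.eq_univ_of_forall fun z => ?_)
        obtain ⟨y, rfl⟩ := (X.ρ x.1).surjective z
        obtain ⟨t, rfl⟩ := ez_surjective y
        have h3 := Int.fract_nonneg (t - a / (n + 1))
        have h4 := Int.fract_lt_one (t - a / (n + 1))
        have h5 := hu (a / (n + 1) + Int.fract (t - a / (n + 1)))
          (Set.mem_uIcc.2 (Or.inl ⟨by linarith, by linarith⟩))
        rw [← ez_add_int _ ⌊t - a / (n + 1)⌋, add_assoc, Int.fract_add_floor,
          add_sub_cancel] at h5
        exact h5
      intro j hj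
      have e : ((((k : ℕ) : ℤ) + c * (n + 1) : ℤ) : ℝ) / (n + 1) = ((k : ℕ) : ℤ) / (n + 1) + c := by
        push_cast; field_simp
      have hu : ∀ u ∈ Set.uIcc (j / (n + 1) : ℝ)
          ((((k : ℕ) : ℤ) + c * (n + 1) : ℤ) / (n + 1)), ez u ∈ X.pre x.1 := fun u hu => by
        rcases Set.uIcc_subset_uIcc_union_uIcc (b := t) hu with h3 | h3
        · rw [Set.uIcc_comm] at h3
          exact hj u h3
        · rw [e] at h3
          exact h2 u h3
      rcases lt_trichotomy j (((k : ℕ) : ℤ) + c * (n + 1)) with h3 | h3 | h3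
      · exact absurd hu (key _ _ h3)
      · exact h3
      · rw [Set.uIcc_comm] at hu
        exact absurd hu (key _ _ h3)
  isClosed := X.isClosed_J.preimage (X.ρ x.1).continuous
  exists_ne t ht := by
    obtain ⟨k, ⟨e⟩⟩ := X.exists_intervals
    obtain ⟨s, hs⟩ := exists_ne (e ⟨X.ρ x.1 (ez t), ht⟩).2
    have hj : ZerothHomotopy.mk (⟨X.ρ x.1 (ez t), ht⟩ : X.J) =
        ZerothHomotopy.mk (e.symm ((e ⟨X.ρ x.1 (ez t), ht⟩).1, s)) := by
      have hc : Continuous fun a : I => e.symm ((e ⟨X.ρ x.1 (ez t), ht⟩).1, a) := by fun_prop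
      have hI : PathConnectedSpace I :=
        isPathConnected_iff_pathConnectedSpace.1 ((convex_Icc 0 1).isPathConnected ⟨0, by simp⟩)
      have := (hI.joined (e ⟨X.ρ x.1 (ez t), ht⟩).2 s).somePath.map hc
      exact ZerothHomotopy.sound (this.cast (by simp) rfl)
    obtain ⟨t', h1, h2⟩ := exists_uIcc_of_mk_eq ht hj
    refine ⟨t', ?_, h2⟩
    rintro rfl
    have h3 : (⟨X.ρ x.1 (ez t'), ht⟩ : X.J) =
        e.symm ((e ⟨X.ρ x.1 (ez t'), ht⟩).1, s) := Subtype.ext h1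
    apply hs
    have h4 := congrArg (fun y => (e y).2) h3
    simp only [Homeomorph.apply_symm_apply] at h4
    exact h4.symm

theorem FrameSpace.isMarking {n : ℕ} (x : X.FrameSpace n) : IsMarking n (X.pre x.1) :=
  x.isFatMarking.toIsMarking

theorem FrameSpace.mk_eq_component {n : ℕ} (x : X.FrameSpace n) {t : ℝ} (ht : ez t ∈ X.pre x.1) :
    ZerothHomotopy.mk (⟨X.ρ x.1 (ez t), ht⟩ : X.J) =
      x.component (modFin n (lab n (X.pre x.1) t)) := by
  rw [mk_eq_mk_of_uIcc (x.isMarking.lab_spec ht)]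
  simp only [component, ez_eq_root]

/-- The components of `J` which contain the images of the roots of unity, in terms of the action of
`ΔG` on vertices. -/
theorem FrameSpace.mk_eq_component_lam {m n : ℕ} (x : X.FrameSpace n) {h : H}
    (hh : H.MapsRoots m (X.pre x.1) h) (k : Fin (m + 1)) :
    ∃ hmem : X.ρ (X.act x.1 h) (root m k) ∈ X.J,
      ZerothHomotopy.mk (⟨X.ρ (X.act x.1 h) (root m k), hmem⟩ : X.J) =
        x.component (DeltaG.vertexMap (H.cl m n (X.pre x.1) h) k) := by
  have hmem : X.ρ (X.act x.1 h) (root m k) ∈ X.J := by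
    rw [X.ρ_act, root_eq]; exact hh _
  refine ⟨hmem, ?_⟩
  obtain ⟨w, l, f, rfl, hf, e⟩ := PlanarHomeoGroup.exists_cl_eq x.isMarking h hh
  rw [e, DeltaG.vertexMap_cls, ← hf.lab_eq]
  rw [← x.mk_eq_component (hh.mem _)]
  congr 2
  rw [X.ρ_act, root_eq, H.q_elt]

theorem FrameSpace.act_mem {n : ℕ} (x : X.FrameSpace n) {h : H}
    (hh : H.MapsRoots n (X.pre x.1) h) (g : Gen (DeltaG.incl G) n)
    (hg : g.hom = H.cl n n (X.pre x.1) h) :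
    ∃ y : X.FrameSpace n, y.1 = X.act x.1 h := by
  refine ⟨⟨X.act x.1 h, fun k => (x.mk_eq_component_lam hh k).1, ?_⟩, rfl⟩
  have h1 : (fun k => ZerothHomotopy.mk (⟨X.ρ (X.act x.1 h) (root n k),
      (x.mk_eq_component_lam hh k).1⟩ : X.J)) = x.component ∘ lam (DeltaG.incl G) g.hom := by
    funext k
    rw [(x.mk_eq_component_lam hh k).2, ← hg]
    rfl
  rw [h1]
  exact Function.Bijective.comp (g := x.component) x.2.2 (lam_bijective _ g)

variable (X) in
/-- The number of components of `J`, minus one. -/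
def num : ℕ := Nat.card (ZerothHomotopy X.J) - 1

theorem card_pi0 (X : MarkedCircle H) : Nat.card (ZerothHomotopy X.J) = X.num + 1 := by
  have := X.finite_pi0
  have : Nonempty X.J := X.nonempty_J.to_subtype
  have h : 0 < Nat.card (ZerothHomotopy X.J) := Nat.card_pos
  rw [num]; omega

theorem nonempty_frameSpace (X : MarkedCircle H) : Nonempty (X.FrameSpace X.num) := by
  classical
  have := X.finite_pi0
  have := Fintype.ofFinite (ZerothHomotopy X.J)
  obtain ⟨x₀⟩ := X.nonempty_F
  have hex : ∀ c : ZerothHomotopy X.J, ∃ (t : ℝ) (ht : X.ρ x₀ (ez t) ∈ X.J),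
      0 ≤ t ∧ t < 1 ∧ ZerothHomotopy.mk (⟨_, ht⟩ : X.J) = c := fun c => by
    obtain ⟨⟨z, hz⟩, rfl⟩ := ZerothHomotopy.mk_surjective c
    obtain ⟨y, rfl⟩ := (X.ρ x₀).surjective z
    obtain ⟨t, rfl⟩ := ez_surjective y
    have h1 : ez (Int.fract t) = ez t := by
      rw [← ez_add_int _ ⌊t⌋, Int.fract_add_floor]
    refine ⟨Int.fract t, by rw [h1]; exact hz, Int.fract_nonneg t, Int.fract_lt_one t, ?_⟩
    simp only [h1]
  choose t ht ht0 ht1 htc using hex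
  have hinj : Function.Injective t := fun c c' h => by
    rw [← htc c, ← htc c']
    simp only [h]
  have hcard : (Finset.univ.image t).card = X.num + 1 := by
    rw [Finset.card_image_of_injective _ hinj, Finset.card_univ, ← Nat.card_eq_fintype_card,
      card_pi0]
  set N := X.num with hN
  let emb := (Finset.univ.image t).orderEmbOfFin hcard
  have hemb : ∀ k, ∃ c, t c = emb k := fun k => by
    have := Finset.orderEmbOfFin_mem (Finset.univ.image t) hcard k
    obtain ⟨c, -, hc⟩ := Finset.mem_image.1 this
    exact ⟨c, hc⟩
  have hemb' : ∀ c, ∃ k, emb k = t c := fun c => by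
    have : t c ∈ Set.range emb := by
      rw [Finset.range_orderEmbOfFin]; simp
    exact this
  have h01 : ∀ k, 0 ≤ emb k ∧ emb k < 1 := fun k => by
    obtain ⟨c, hc⟩ := hemb k
    rw [← hc]; exact ⟨ht0 c, ht1 c⟩
  let Y : ℤ → ℝ := fun j => emb (modFin N j) + ((j / (N + 1) : ℤ) : ℝ)
  have hY : StrictMono Y := fun a b hab => by
    have hq : a / ((N : ℤ) + 1) ≤ b / (N + 1) := Int.ediv_le_ediv (by positivity) hab.le
    rcases hq.eq_or_lt with h | h
    · have e1 := modFin_add_mul N a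
      have e2 := modFin_add_mul N b
      rw [h] at e1
      have e3 : modFin N a < modFin N b := by
        rw [Fin.lt_def]
        omega
      have := emb.strictMono e3
      simp only [Y, h]
      linarith
    · have h1 := (h01 (modFin N a)).2
      have h2 := (h01 (modFin N b)).1
      have h3 : ((a / ((N : ℤ) + 1) : ℤ) : ℝ) + 1 ≤ ((b / ((N : ℤ) + 1) : ℤ) : ℝ) := by
        exact_mod_cast h
      simp only [Y]
      linarith
  have hYp : ∀ j, Y (j + (N + 1 : ℕ)) = Y j + 1 := fun j => by
    have hm : (N : ℤ) + 1 ≠ 0 := by positivity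
    have h1 : (j + (N + 1)) / ((N : ℤ) + 1) = j / (N + 1) + 1 := by
      simpa using Int.add_mul_ediv_right j 1 hm
    have h2 : modFin N (j + (N + 1)) = modFin N j := by
      apply Fin.ext
      have := modFin_val N (j + (N + 1))
      rw [Int.add_emod_right, ← modFin_val] at this
      exact_mod_cast this
    simp only [Y]
    push_cast
    rw [h1, h2]
    push_cast
    ring
  obtain ⟨l, hl⟩ := liftGroup.exists_interpolation (Nat.succ_pos N) hY hYp
  have hval : ∀ k : Fin (N + 1), X.ρ (X.act x₀ (H.ofLift l)) (root N k) = X.ρ x₀ (ez (emb k)) := by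
    intro k
    rw [X.ρ_act, root_eq, H.q_ofLift, liftGroup.toHomeo_ez]
    have := hl ((k : ℕ) : ℤ)
    push_cast at this ⊢
    rw [this]
    have h0 : ((k : ℕ) : ℤ) / ((N : ℤ) + 1) = 0 :=
      Int.ediv_eq_zero_of_lt (by positivity) (by exact_mod_cast k.2)
    simp only [Y, modFin_coe, h0, Int.cast_zero, add_zero]
  have hmem : ∀ k, X.ρ (X.act x₀ (H.ofLift l)) (root N k) ∈ X.J := fun k => by
    obtain ⟨c, hc⟩ := hemb k
    rw [hval, ← hc]
    exact ht c
  refine ⟨⟨X.act x₀ (H.ofLift l), hmem, ?_⟩⟩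
  refine (Fintype.bijective_iff_surjective_and_card _).2 ⟨fun c => ?_, ?_⟩
  · obtain ⟨k, hk⟩ := hemb' c
    refine ⟨k, ?_⟩
    rw [← htc c]
    simp only [hval, hk]
  · rw [Fintype.card_fin, ← Nat.card_eq_fintype_card, card_pi0]

end MarkedCircle

/-! ### Structured sets and the crossed simplicial group -/

namespace StructuredSet

variable {D : Type w} [Category.{u} D] (i : SimplexCategory ⥤ D) [IsCrossedSimplicialGroup i]

/-- The structured set with the underlying set `{0, …, n}`. -/
def standard (n : ℕ) : StructuredSet i where
  carrier := ULift (Fin (n + 1))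
  n := n
  Frame := Gen i n
  nonempty_frame := ⟨1⟩
  act f g := f * g
  act_one := mul_one
  act_mul f g h := (mul_assoc f g h).symm
  existsUnique_act f f' := ⟨f⁻¹ * f', mul_inv_cancel_left f f', fun g hg => by
    rw [← hg, inv_mul_cancel_left]⟩
  ρ f := (Equiv.ofBijective _ (lam_bijective i f)).trans Equiv.ulift.symm
  ρ_act f g k := congrArg ULift.up (lam_comp i g.hom f.hom k)

/-- The functor which sends a structured set with `n + 1` elements to `[n]`. -/
def toObject : StructuredSet i ⥤ D where
  obj X := ob i X.n
  map {X Y} ψ := Hom.app ψ Y.someFrame X.someFrame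
  map_id X := id_app X _
  map_comp {X Y Z} ψ ψ' := comp_app ψ ψ' Z.someFrame Y.someFrame X.someFrame

variable {i}

theorem hom_ext_of_app {X Y : StructuredSet i} {ψ ψ' : X ⟶ Y} (f : Y.Frame) (f' : X.Frame)
    (h : Hom.app ψ f f' = Hom.app ψ' f f') : ψ = ψ' := by
  refine Hom.ext (funext fun a => funext fun b => ?_)
  have h1 := Hom.app_act ψ f (Y.diff f a) f' (X.diff f' b)
  have h2 := Hom.app_act ψ' f (Y.diff f a) f' (X.diff f' b)
  rw [act_diff, act_diff] at h1 h2
  rw [h1, h2, h]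

instance : (toObject i).Faithful where
  map_injective h := hom_ext_of_app _ _ h

theorem diff_act (X : StructuredSet i) (f f' : X.Frame) (g : Gen i X.n) :
    X.diff f (X.act f' g) = X.diff f f' * g :=
  X.diff_eq (by rw [X.act_mul, act_diff])

instance : (toObject i).Full where
  map_surjective {X Y} (v : ob i X.n ⟶ ob i Y.n) := by
    refine ⟨(⟨fun f f' => (X.diff X.someFrame f').hom ≫ v ≫ (Y.diff Y.someFrame f).inv, ?_⟩ :
      Hom X Y), ?_⟩
    · intro f g f' g'
      rw [diff_act, diff_act]
      change (g'.hom ≫ (X.diff X.someFrame f').hom) ≫ v ≫ ((Y.diff Y.someFrame f).inv ≫ g.inv) = _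
      simp only [Category.assoc]
    · change (X.diff X.someFrame X.someFrame).hom ≫ v ≫ (Y.diff Y.someFrame Y.someFrame).inv = v
      rw [X.diff_eq (X.act_one _), Y.diff_eq (Y.act_one _)]
      change 𝟙 _ ≫ v ≫ 𝟙 _ = v
      simp

instance : (toObject i).EssSurj where
  mem_essImage d := by
    obtain ⟨n, rfl⟩ := (IsCrossedSimplicialGroup.bijective_obj (i := i)).2 d
    exact ⟨standard i n.len, ⟨Iso.refl _⟩⟩

instance : (toObject i).IsEquivalence where

theorem nonempty_iso_of_eq {X Y : StructuredSet i} (h : X.n = Y.n) : Nonempty (X ≅ Y) :=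
  ⟨(toObject i).preimageIso (eqToIso (congrArg (ob i) h))⟩

end StructuredSet

/-! ### Frames of marked circles -/

namespace MarkedCircle

variable {G : PlanarLieGroup.{u}} {H : PlanarHomeoGroup G} {X Y Z : MarkedCircle H} {k m n : ℕ}

theorem mapsRoots_gap (x y : X.FrameSpace n) :
    H.MapsRoots n (X.pre x.1) (X.gap x.1 y.1) := fun j => X.mapsTo_pre x.1 y.1 (y.root_mem j)

/-- The class in `ΔG` of the unique element which maps the frame `x` to the frame `y`. -/
def frameCl (x y : X.FrameSpace n) : DeltaG.Hom G n n := H.cl n n (X.pre x.1) (X.gap x.1 y.1)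

theorem frameCl_comp (x y z : X.FrameSpace n) :
    DeltaG.comp (frameCl y z) (frameCl x y) = frameCl x z := by
  rw [frameCl, frameCl, frameCl, ← X.gap_mul_gap x.1 y.1 z.1]
  exact (PlanarHomeoGroup.cl_mul y.isMarking x.isMarking (mapsRoots_gap y z)
    (X.mapsTo_pre x.1 y.1)).symm

theorem frameCl_self (x : X.FrameSpace n) : frameCl x x = DeltaG.idHom n := by
  rw [frameCl, gap_self]
  exact PlanarHomeoGroup.cl_one x.isMarking

/-- The class of the unique element which maps `x` to `y`, as an automorphism. -/
def frameIso (x y : X.FrameSpace n) : Gen (DeltaG.incl G) n where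
  hom := frameCl x y
  inv := frameCl y x
  hom_inv_id := (frameCl_comp y x y).trans (frameCl_self y)
  inv_hom_id := (frameCl_comp x y x).trans (frameCl_self x)

theorem frameCl_eq_of_mk_eq (x : X.FrameSpace n) {y z : X.FrameSpace n}
    (h : ZerothHomotopy.mk y = ZerothHomotopy.mk z) : frameCl x y = frameCl x z := by
  obtain ⟨γ⟩ : Joined y z := Quotient.exact h
  have := PlanarHomeoGroup.cl_path (m := n) x.isMarking (γ := fun s => X.gap x.1 (γ s).1)
    ((X.continuous_gap x.1).comp (continuous_subtype_val.comp γ.continuous))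
    (fun s => mapsRoots_gap x (γ s))
  simp only [γ.source, γ.target] at this
  exact this

theorem mk_eq_of_frameCl_eq {x y z : X.FrameSpace n} (h : frameCl x y = frameCl x z) :
    ZerothHomotopy.mk y = ZerothHomotopy.mk z := by
  have hn : (n + 1 : ℝ) ≠ 0 := by positivity
  have hmaps : ∀ y : X.FrameSpace n, Set.MapsTo (H.q (X.gap x.1 y.1))
      (Set.range fun j : ℤ => ez (j / (n + 1))) (X.pre x.1) := by
    rintro y - ⟨j, rfl⟩
    exact mapsRoots_gap x y j
  obtain ⟨γ, hγ⟩ := PlanarHomeoGroup.exists_path_of_cl_eq (m := n)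
    (A := Set.range fun j : ℤ => ez (j / (n + 1))) x.isMarking (fun j => ⟨j, rfl⟩) (by
      rintro t ⟨j, hj⟩
      obtain ⟨c, rfl⟩ := ez_eq_iff.1 hj.symm
      refine ⟨j + c * (n + 1), fun u hu => ⟨j + c * (n + 1), ?_⟩⟩
      have e : ((j + c * (n + 1) : ℤ) : ℝ) / (n + 1) = j / (n + 1) + c := by push_cast; field_simp
      rw [e, Set.uIcc_self, Set.mem_singleton_iff] at hu
      rw [hu]
      dsimp only
      rw [e]) (hmaps y) (hmaps z) h
  have hmem : ∀ s, ∃ y : X.FrameSpace n, y.1 = X.act x.1 (γ s) := fun s =>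
    x.act_mem (fun j => (hγ s).1 ⟨j, rfl⟩) (frameIso x y) (hγ s).2.symm
  choose δ hδ using hmem
  refine ZerothHomotopy.sound ⟨⟨δ, ?_⟩, ?_, ?_⟩
  · refine continuous_induced_rng.2 ?_
    exact ((X.continuous_act x.1).comp γ.continuous).congr fun s => (hδ s).symm
  · exact Subtype.ext ((hδ 0).trans (by rw [γ.source, act_gap]))
  · exact Subtype.ext ((hδ 1).trans (by rw [γ.target, act_gap]))

theorem mapsRoots_incl (x : X.FrameSpace n) (w : G.base) (j : ℤ) :
    H.MapsRoots n (X.pre x.1) (H.incl (w * G.e (j / (n + 1)))) := fun i => by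
  rw [← H.elt_transl, H.q_elt, liftGroup.transl_apply]
  have h : ((G.sign (w : G) : ℤ) : ℝ) * ((i : ℝ) / (n + 1) + j / (n + 1)) =
      ((G.sign (w : G) * (i + j) : ℤ) : ℝ) / (n + 1) := by push_cast; ring
  rw [h]
  exact x.root_mem _

theorem cl_incl (x : X.FrameSpace n) (w : G.base) (j : ℤ) :
    H.cl n n (X.pre x.1) (H.incl (w * G.e (j / (n + 1)))) = DeltaG.autHom n w j := by
  have h := mapsRoots_incl x w j
  rw [← H.elt_transl] at h ⊢
  refine PlanarHomeoGroup.cl_elt x.isMarking h fun i => ?_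
  have h : ((G.sign (w : G) : ℤ) : ℝ) * ((i : ℝ) / (n + 1) + j / (n + 1)) =
      ((G.sign (w : G) * (i + j) : ℤ) : ℝ) / (n + 1) := by push_cast; ring
  rw [liftGroup.transl_apply, h, x.isMarking.lab_root, DeltaG.sign_mul_sign_mul]
  rfl

theorem exists_act_incl (x : X.FrameSpace n) (g : Gen (DeltaG.incl G) n) (w : G.base) (j : ℤ)
    (hg : g.hom = DeltaG.autHom n w j) : ∃ y : X.FrameSpace n,
      y.1 = X.act x.1 (H.incl (w * G.e (j / (n + 1)))) ∧ frameCl x y = g.hom := by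
  obtain ⟨y, hy⟩ := x.act_mem (mapsRoots_incl x w j) g (hg.trans (cl_incl x w j).symm)
  refine ⟨y, hy, ?_⟩
  rw [frameCl, hy, gap_act]
  exact (cl_incl x w j).trans hg.symm

theorem exists_frameCl_eq (x : X.FrameSpace n) (g : Gen (DeltaG.incl G) n) :
    ∃ y : X.FrameSpace n, frameCl x y = g.hom := by
  obtain ⟨w, j, hg⟩ := DeltaG.eq_autHom_of_inverse (G := G) (n := n) g.hom_inv_id g.inv_hom_id
  obtain ⟨y, -, hy⟩ := exists_act_incl x g w j hg
  exact ⟨y, hy⟩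

theorem component_eq (x y : X.FrameSpace n) (k : Fin (n + 1)) :
    y.component k = x.component (DeltaG.vertexMap (frameCl x y) k) := by
  obtain ⟨h1, h2⟩ := x.mk_eq_component_lam (mapsRoots_gap x y) k
  rw [frameCl, ← h2]
  simp only [FrameSpace.component, X.act_gap]

theorem continuous_component (k : Fin (n + 1)) :
    Continuous fun x : X.FrameSpace n => (⟨X.ρ x.1 (root n k), x.2.1 k⟩ : X.J) :=
  ((X.continuous_ρ_apply (root n k)).comp continuous_subtype_val).subtype_mk _

variable (X) in
/-- The structured frames of a marked circle. -/
abbrev Frames : Type u := ZerothHomotopy (X.FrameSpace X.num)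

/-- The right action of `Aut [n]` on frames. -/
def frameAct (f : X.Frames) (g : Gen (DeltaG.incl G) X.num) : X.Frames :=
  ZerothHomotopy.mk (exists_frameCl_eq (Quotient.out f) g).choose

theorem frameAct_mk {x y : X.FrameSpace X.num} {g : Gen (DeltaG.incl G) X.num}
    (h : frameCl x y = g.hom) : frameAct (ZerothHomotopy.mk x) g = ZerothHomotopy.mk y := by
  have h1 := (exists_frameCl_eq (Quotient.out (ZerothHomotopy.mk x)) g).choose_spec
  refine mk_eq_of_frameCl_eq (x := Quotient.out (ZerothHomotopy.mk x)) (h1.trans ?_)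
  have h2 : frameCl (Quotient.out (ZerothHomotopy.mk x)) x = DeltaG.idHom _ := by
    rw [← frameCl_self (Quotient.out (ZerothHomotopy.mk x))]
    exact frameCl_eq_of_mk_eq _ (Quotient.out_eq (ZerothHomotopy.mk x)).symm
  rw [← frameCl_comp _ x y, h2, DeltaG.comp_id, h]

variable (X) in
/-- The structured set of components of a marked circle. -/
def toStructuredSet : StructuredSet (DeltaG.incl G) where
  carrier := ZerothHomotopy X.J
  n := X.num
  Frame := X.Frames
  nonempty_frame := have := X.nonempty_frameSpace; inferInstance
  act := frameAct
  act_one f := by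
    obtain ⟨x, rfl⟩ := ZerothHomotopy.mk_surjective f
    exact frameAct_mk (frameCl_self x)
  act_mul f g h := by
    obtain ⟨x, rfl⟩ := ZerothHomotopy.mk_surjective f
    obtain ⟨y, hy⟩ := exists_frameCl_eq x g
    obtain ⟨z, hz⟩ := exists_frameCl_eq y h
    rw [frameAct_mk hy, frameAct_mk hz]
    refine frameAct_mk ?_
    rw [← frameCl_comp x y z, hy, hz]
    rfl
  existsUnique_act f f' := by
    obtain ⟨x, rfl⟩ := ZerothHomotopy.mk_surjective f
    obtain ⟨x', rfl⟩ := ZerothHomotopy.mk_surjective f'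
    refine ⟨frameIso x x', frameAct_mk rfl, fun g hg => Iso.ext ?_⟩
    obtain ⟨y, hy⟩ := exists_frameCl_eq x g
    exact hy.symm.trans (frameCl_eq_of_mk_eq x ((frameAct_mk hy).symm.trans hg))
  ρ := ZerothHomotopy.lift (fun x => Equiv.ofBijective x.component x.2.2) (fun x y γ => by
    ext k
    exact ZerothHomotopy.sound (γ.map (continuous_component k)))
  ρ_act f g k := by
    obtain ⟨x, rfl⟩ := ZerothHomotopy.mk_surjective f
    obtain ⟨y, hy⟩ := exists_frameCl_eq x g
    rw [frameAct_mk hy]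
    change y.component k = x.component (lam _ g.hom k)
    rw [component_eq x y k, hy]
    rfl

/-! ### The functor to structured sets -/

/-- The morphism of `ΔG` defined by a structured homeomorphism and frames. -/
def mor (a : MarkedHomeo X Y) (y : Y.FrameSpace n) (x : X.FrameSpace m) : DeltaG.Hom G m n :=
  H.cl m n (Y.pre y.1) (Y.gap y.1 (a.1.φt x.1))

theorem mapsTo_mor (a : MarkedHomeo X Y) (y : Y.F) (x : X.F) :
    Set.MapsTo (H.q (Y.gap y (a.1.φt x))) (X.pre x) (Y.pre y) := fun z hz => by
  show Y.ρ y _ ∈ Y.J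
  rw [← Y.ρ_gap, a.1.ρ_φt]
  exact a.2 hz

theorem mapsRoots_mor (a : MarkedHomeo X Y) (y : Y.F) (x : X.FrameSpace m) :
    H.MapsRoots m (Y.pre y) (Y.gap y (a.1.φt x.1)) := fun j => mapsTo_mor a y x.1 (x.root_mem j)

theorem mor_comp (a : MarkedHomeo X Y) (b : MarkedHomeo Y Z) (z : Z.FrameSpace k)
    (y : Y.FrameSpace n) (x : X.FrameSpace m) :
    DeltaG.comp (mor a y x) (mor b z y) = mor (a.comp b) z x := by
  have h : Z.gap z.1 ((a.comp b).1.φt x.1) =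
      Z.gap z.1 (b.1.φt y.1) * Y.gap y.1 (a.1.φt x.1) := by
    rw [← Z.gap_act_right, ← b.1.φt_act, Y.act_gap]
    rfl
  rw [mor, mor, mor, h]
  exact (PlanarHomeoGroup.cl_mul y.isMarking z.isMarking (mapsRoots_mor a y.1 x)
    (mapsTo_mor b z.1 y.1)).symm

theorem mor_frame_right (a : MarkedHomeo X Y) (y : Y.FrameSpace n) (x x' : X.FrameSpace m) :
    DeltaG.comp (frameCl x x') (mor a y x) = mor a y x' := mor_comp (MarkedHomeo.id X) a y x x'

theorem mor_frame_left (a : MarkedHomeo X Y) (y y' : Y.FrameSpace n) (x : X.FrameSpace m) :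
    DeltaG.comp (mor a y x) (frameCl y' y) = mor a y' x := mor_comp a (MarkedHomeo.id Y) y' y x

theorem mor_eq_of_mk_eq {a a' : MarkedHomeo X Y} (h : ZerothHomotopy.mk a = ZerothHomotopy.mk a')
    (y : Y.FrameSpace n) (x : X.FrameSpace m) : mor a y x = mor a' y x := by
  obtain ⟨γ⟩ : Joined a a' := Quotient.exact h
  have := PlanarHomeoGroup.cl_path (m := m) y.isMarking (γ := fun s => Y.gap y.1 ((γ s).1.φt x.1))
    ((Y.continuous_gap y.1).comp ((continuous_φt X Y x.1).comp γ.continuous))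
    (fun s => mapsRoots_mor (γ s) y.1 x)
  simp only [γ.source, γ.target] at this
  exact this

theorem frameCl_eq_id {x y : X.FrameSpace n} (h : ZerothHomotopy.mk x = ZerothHomotopy.mk y) :
    frameCl x y = DeltaG.idHom n := by
  rw [← frameCl_self x]; exact frameCl_eq_of_mk_eq x h.symm

/-- The morphism of `ΔG` defined by the class of a structured homeomorphism and classes of frames. -/
def morCl (α : ZerothHomotopy (MarkedHomeo X Y)) (f : Y.Frames) (f' : X.Frames) :
    DeltaG.Hom G X.num Y.num := mor (Quotient.out α) (Quotient.out f) (Quotient.out f')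

theorem morCl_mk (a : MarkedHomeo X Y) (y : Y.FrameSpace Y.num) (x : X.FrameSpace X.num) :
    morCl (ZerothHomotopy.mk a) (ZerothHomotopy.mk y) (ZerothHomotopy.mk x) = mor a y x := by
  rw [morCl, mor_eq_of_mk_eq (a' := a) (Quotient.out_eq (ZerothHomotopy.mk a)),
    ← mor_frame_right a _ x, ← mor_frame_left a y,
    frameCl_eq_id (x := Quotient.out (ZerothHomotopy.mk y)) (y := y)
      (Quotient.out_eq (ZerothHomotopy.mk y)),
    frameCl_eq_id (x := x) (y := Quotient.out (ZerothHomotopy.mk x))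
      (Quotient.out_eq (ZerothHomotopy.mk x)).symm, DeltaG.id_comp, DeltaG.comp_id]

/-- The morphism of structured sets defined by a structured homeomorphism. -/
def toStructuredHom (α : X ⟶ Y) : StructuredSet.Hom X.toStructuredSet Y.toStructuredSet where
  app f f' := morCl α f f'
  app_act f g f' g' := by
    obtain ⟨a, rfl⟩ := ZerothHomotopy.mk_surjective α
    obtain ⟨y, rfl⟩ := ZerothHomotopy.mk_surjective f
    obtain ⟨x, rfl⟩ := ZerothHomotopy.mk_surjective f'
    obtain ⟨y', hy⟩ := exists_frameCl_eq y g
    obtain ⟨x', hx⟩ := exists_frameCl_eq x g'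
    change morCl _ (frameAct (ZerothHomotopy.mk y) g) (frameAct (ZerothHomotopy.mk x) g') = _
    rw [frameAct_mk hy, frameAct_mk hx, morCl_mk, morCl_mk, ← mor_frame_right a y' x,
      ← mor_frame_left a y]
    have h1 : g = frameIso y y' := Iso.ext hy.symm
    rw [hx, h1]
    rfl

variable (H) in
/-- The functor from marked circles to structured sets. -/
def toStructuredSetFunctor : MarkedCircle H ⥤ StructuredSet (DeltaG.incl G) where
  obj X := X.toStructuredSet
  map α := toStructuredHom α
  map_id X := by
    refine StructuredSet.Hom.ext (funext fun f => funext fun f' => ?_)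
    obtain ⟨y, rfl⟩ := ZerothHomotopy.mk_surjective f
    obtain ⟨x, rfl⟩ := ZerothHomotopy.mk_surjective f'
    change morCl (ZerothHomotopy.mk (MarkedHomeo.id X)) _ _ = (X.toStructuredSet.diff _ _).hom
    rw [morCl_mk, X.toStructuredSet.diff_eq (g := frameIso y x) (frameAct_mk rfl)]
    rfl
  map_comp {X Y Z} α β := by
    refine StructuredSet.Hom.ext (funext fun f => funext fun f' => ?_)
    obtain ⟨a, rfl⟩ := ZerothHomotopy.mk_surjective α
    obtain ⟨b, rfl⟩ := ZerothHomotopy.mk_surjective β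
    obtain ⟨z, rfl⟩ := ZerothHomotopy.mk_surjective f
    obtain ⟨x, rfl⟩ := ZerothHomotopy.mk_surjective f'
    obtain ⟨y⟩ := Y.nonempty_frameSpace
    refine Eq.trans ?_ (StructuredSet.comp_app (X := X.toStructuredSet) (Y := Y.toStructuredSet)
      (Z := Z.toStructuredSet) (toStructuredHom (ZerothHomotopy.mk a))
      (toStructuredHom (ZerothHomotopy.mk b)) (ZerothHomotopy.mk z) (ZerothHomotopy.mk y)
      (ZerothHomotopy.mk x)).symm
    change morCl (ZerothHomotopy.mk (a.comp b)) _ _ = DeltaG.comp (morCl _ _ _) (morCl _ _ _)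
    rw [morCl_mk, morCl_mk, morCl_mk, mor_comp]

end MarkedCircle

namespace MarkedCircle

variable {G : PlanarLieGroup.{u}} {H : PlanarHomeoGroup G} {X Y : MarkedCircle H}

/-! ### The equivalence -/

theorem MarkedHomeo.ext_of_φt {a a' : MarkedHomeo X Y} (x : X.F) (h : a.1.φt x = a'.1.φt x) :
    a = a' := by
  refine Subtype.ext (StructuredHomeo.ext ?_ ?_)
  · ext z
    obtain ⟨c, rfl⟩ := (X.ρ x).surjective z
    rw [← a.1.ρ_φt, ← a'.1.ρ_φt, h]
  · ext z
    rw [← X.act_gap x z, a.1.φt_act, a'.1.φt_act, h]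

/-- The structured homeomorphism which maps `x` to `y h`. -/
def ofElement (x : X.F) (y : Y.F) (h : H) (hh : Set.MapsTo (H.q h) (X.pre x) (Y.pre y)) :
    MarkedHomeo X Y :=
  ⟨{ φ := ((X.ρ x).symm.trans (H.q h)).trans (Y.ρ y)
     φt := ((X.isHomeomorph_act x).homeomorph.symm.trans (Homeomorph.mulLeft h)).trans
       (Y.isHomeomorph_act y).homeomorph
     φt_act := fun z k => by
       change Y.act y (h * X.gap x (X.act z k)) = Y.act (Y.act y (h * X.gap x z)) k
       rw [X.gap_act_right, ← mul_assoc, Y.act_mul y]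
     ρ_φt := fun z c => by
       change Y.ρ (Y.act y (h * X.gap x z)) c = Y.ρ y (H.q h ((X.ρ x).symm (X.ρ z c)))
       rw [Y.ρ_act, H.q_mul_apply, X.ρ_gap x z, Homeomorph.symm_apply_apply] },
    fun z hz => by
      refine hh ?_
      show X.ρ x ((X.ρ x).symm z) ∈ X.J
      rwa [Homeomorph.apply_symm_apply]⟩

theorem ofElement_φt (x : X.F) (y : Y.F) (h : H)
    (hh : Set.MapsTo (H.q h) (X.pre x) (Y.pre y)) (z : X.F) :
    (ofElement x y h hh).1.φt z = Y.act y (h * X.gap x z) := rfl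

theorem ofElement_φt_self (x : X.F) (y : Y.F) (h : H)
    (hh : Set.MapsTo (H.q h) (X.pre x) (Y.pre y)) :
    (ofElement x y h hh).1.φt x = Y.act y h := by
  rw [ofElement_φt, gap_self, mul_one]

theorem continuous_ofElement {T : Type*} [TopologicalSpace T] (x : X.F) (y : Y.F) {f : T → H}
    (hf : Continuous f) (hh : ∀ s, Set.MapsTo (H.q (f s)) (X.pre x) (Y.pre y)) :
    Continuous fun s => ofElement x y (f s) (hh s) := by
  refine continuous_of ?_ fun z => ?_
  · refine ContinuousMap.continuous_of_continuous_uncurry _ ?_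
    change Continuous fun p : T × X.C => Y.ρ y (H.q (f p.1) ((X.ρ x).symm p.2))
    exact (Y.ρ y).continuous.comp ((continuous_homeo_eval Circle Circle).comp
      ((H.continuous_q.comp (hf.comp continuous_fst)).prodMk
        ((X.ρ x).symm.continuous.comp continuous_snd)))
  · simp only [ofElement_φt]
    exact (Y.continuous_act y).comp (hf.mul continuous_const)

theorem mk_eq_of_mor_eq {m n : ℕ} {a a' : MarkedHomeo X Y} (y : Y.FrameSpace n)
    (x : X.FrameSpace m) (h : mor a y x = mor a' y x) :
    ZerothHomotopy.mk a = ZerothHomotopy.mk a' := by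
  obtain ⟨γ, hγ⟩ := PlanarHomeoGroup.exists_path_of_cl_eq (A := X.pre x.1) y.isMarking x.root_mem
    (fun t ht => (x.isMarking.existsUnique t ht).exists) (mapsTo_mor a y.1 x.1)
    (mapsTo_mor a' y.1 x.1) h
  refine ZerothHomotopy.sound ⟨⟨fun s => ofElement x.1 y.1 (γ s) (hγ s).1,
    continuous_ofElement x.1 y.1 γ.continuous _⟩, ?_, ?_⟩
  · refine MarkedHomeo.ext_of_φt x.1 ?_
    change (ofElement x.1 y.1 (γ 0) (hγ 0).1).1.φt x.1 = _
    rw [ofElement_φt_self, γ.source, act_gap]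
  · refine MarkedHomeo.ext_of_φt x.1 ?_
    change (ofElement x.1 y.1 (γ 1) (hγ 1).1).1.φt x.1 = _
    rw [ofElement_φt_self, γ.target, act_gap]

instance : (toStructuredSetFunctor H).Faithful where
  map_injective {X Y} α α' h := by
    obtain ⟨a, rfl⟩ := ZerothHomotopy.mk_surjective α
    obtain ⟨a', rfl⟩ := ZerothHomotopy.mk_surjective α'
    obtain ⟨x⟩ := X.nonempty_frameSpace
    obtain ⟨y⟩ := Y.nonempty_frameSpace
    refine mk_eq_of_mor_eq y x ?_
    rw [← morCl_mk, ← morCl_mk]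
    exact congrArg (fun ψ : StructuredSet.Hom X.toStructuredSet Y.toStructuredSet =>
      ψ.app (ZerothHomotopy.mk y) (ZerothHomotopy.mk x)) h

instance : (toStructuredSetFunctor H).Full where
  map_surjective {X Y} (ψ : StructuredSet.Hom X.toStructuredSet Y.toStructuredSet) := by
    obtain ⟨x⟩ := X.nonempty_frameSpace
    obtain ⟨y⟩ := Y.nonempty_frameSpace
    obtain ⟨h, hh, e⟩ := PlanarHomeoGroup.exists_cl_eq_of_isFatMarking (H := H) x.isFatMarking
      y.isFatMarking (ψ.app (ZerothHomotopy.mk y) (ZerothHomotopy.mk x))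
    refine ⟨ZerothHomotopy.mk (ofElement x.1 y.1 h hh), StructuredSet.hom_ext_of_app
      (X := X.toStructuredSet) (Y := Y.toStructuredSet) (ZerothHomotopy.mk y)
      (ZerothHomotopy.mk x) ?_⟩
    refine Eq.trans ?_ e
    change morCl _ _ _ = _
    rw [morCl_mk, mor, ofElement_φt_self, gap_act]

theorem card_zerothHomotopy {J : Type*} [TopologicalSpace J] {k : ℕ} (e : J ≃ₜ Fin k × I) :
    Nat.card (ZerothHomotopy J) = k := by
  have hb : Function.Bijective fun a : Fin k => ZerothHomotopy.mk (e.symm (a, 0)) := by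
    constructor
    · intro a b hab
      obtain ⟨γ⟩ : Joined (e.symm (a, 0)) (e.symm (b, 0)) := Quotient.exact hab
      have h1 : (e (γ 0)).1 = (e (γ 1)).1 :=
        PreconnectedSpace.constant inferInstance (f := fun s => (e (γ s)).1) (by fun_prop)
      simpa using h1
    · rintro ⟨x⟩
      refine ⟨(e x).1, ?_⟩
      let γ : Path (0 : I) (e x).2 := ⟨⟨fun t => t * (e x).2, by fun_prop⟩, by simp, by simp⟩
      have h : Continuous fun t : I => e.symm ((e x).1, t) := by fun_prop
      exact ZerothHomotopy.sound ((γ.map h).cast rfl (by simp))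
  rw [← Nat.card_congr (Equiv.ofBijective _ hb), Nat.card_fin]

/-- The parametrization of the standard set of `n + 1` arcs. -/
def arc (n : ℕ) (x : Fin (n + 1) × I) : ULift.{u} Circle :=
  ⟨ez ((((x.1 : ℕ) : ℝ) + (x.2 : ℝ) / 2) / (n + 1))⟩

theorem isClosedEmbedding_arc (n : ℕ) : IsClosedEmbedding (arc.{u} n) := by
  refine Continuous.isClosedEmbedding ?_ ?_
  · refine continuous_uliftUp.comp (continuous_ez.comp ?_)
    have : Continuous fun x : Fin (n + 1) × I => ((x.1 : ℕ) : ℝ) :=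
      (continuous_of_discreteTopology (f := fun a : Fin (n + 1) => ((a : ℕ) : ℝ))).comp
        continuous_fst
    fun_prop
  · rintro ⟨a, s⟩ ⟨b, t⟩ h
    obtain ⟨c, hc⟩ := ez_eq_iff.1 (congrArg ULift.down h)
    dsimp only at hc
    have hn : (n + 1 : ℝ) ≠ 0 := by positivity
    rw [div_add' _ _ _ hn, div_left_inj' hn] at hc
    have hs0 := s.2.1
    have hs1 := s.2.2
    have ht0 := t.2.1
    have ht1 := t.2.2
    have h1 : ((a : ℕ) : ℤ) < (b : ℕ) + c * (n + 1) + 1 := by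
      have : (((a : ℕ) : ℤ) : ℝ) < (((b : ℕ) + c * (n + 1) + 1 : ℤ) : ℝ) := by
        push_cast; linarith
      exact_mod_cast this
    have h2 : ((b : ℕ) : ℤ) + c * (n + 1) < (a : ℕ) + 1 := by
      have : (((b : ℕ) + c * (n + 1) : ℤ) : ℝ) < (((a : ℕ) + 1 : ℤ) : ℝ) := by
        push_cast; linarith
      exact_mod_cast this
    have h3 : ((a : ℕ) : ℤ) = (b : ℕ) + c * (n + 1) := by omega
    have ha := a.2
    have hb := b.2
    have hc0 : c = 0 := by
      by_contra hne
      rcases lt_or_gt_of_ne hne with h | h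
      · have := mul_le_mul_of_nonneg_right (show c ≤ -1 by omega) (show (0 : ℤ) ≤ n + 1 by positivity)
        omega
      · have := mul_le_mul_of_nonneg_right (show 1 ≤ c by omega) (show (0 : ℤ) ≤ n + 1 by positivity)
        omega
    subst hc0
    have hab : a = b := Fin.ext (by omega)
    subst hab
    have hst : (s : ℝ) = t := by push_cast at hc; linarith
    rw [Subtype.ext hst]

variable (H) in
/-- The standard marked circle with `n + 1` arcs. -/
def standard (n : ℕ) : MarkedCircle H where
  C := ULift.{u} Circle
  nonempty_homeo := ⟨Homeomorph.ulift.symm⟩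
  F := H
  nonempty_F := ⟨1⟩
  act x h := x * h
  act_one := mul_one
  act_mul x g h := (mul_assoc x g h).symm
  isHomeomorph_act x := (Homeomorph.mulLeft x).isHomeomorph
  ρ x := (H.q x).trans Homeomorph.ulift.symm
  ρ_act x h z := by simp [map_mul]
  J := Set.range (arc.{u} n)
  nonempty_J := Set.range_nonempty _
  isClosed_J := (isClosedEmbedding_arc n).isClosed_range
  exists_intervals := ⟨n + 1, ⟨(isClosedEmbedding_arc n).isEmbedding.toHomeomorph.symm⟩⟩

theorem num_standard (n : ℕ) : (standard H n).num = n := by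
  have h : Nat.card (ZerothHomotopy (standard H n).J) = n + 1 :=
    card_zerothHomotopy (isClosedEmbedding_arc n).isEmbedding.toHomeomorph.symm
  rw [num, h]
  rfl

instance : (toStructuredSetFunctor H).EssSurj where
  mem_essImage S := ⟨standard H S.n, StructuredSet.nonempty_iso_of_eq (num_standard S.n)⟩

instance : (toStructuredSetFunctor H).IsEquivalence where

theorem map_toStructuredHom (α : X ⟶ Y) (c : ZerothHomotopy X.J) :
    StructuredSet.Hom.map (toStructuredHom α) c = ((pi0 H).map α).hom c := by
  obtain ⟨a, rfl⟩ := ZerothHomotopy.mk_surjective α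
  obtain ⟨x⟩ := X.nonempty_frameSpace
  obtain ⟨y⟩ := Y.nonempty_frameSpace
  obtain ⟨k, rfl⟩ := x.2.2.2 c
  rw [StructuredSet.Hom.map, StructuredSet.Hom.mapAt_eq _ _ (ZerothHomotopy.mk y) _
    (ZerothHomotopy.mk x)]
  have h1 : (X.toStructuredSet.ρ (ZerothHomotopy.mk x)).symm (x.component k) = k :=
    (Equiv.ofBijective x.component x.2.2).symm_apply_apply k
  change y.component (lam (DeltaG.incl G) (morCl (ZerothHomotopy.mk a) (ZerothHomotopy.mk y)
    (ZerothHomotopy.mk x)) ((X.toStructuredSet.ρ (ZerothHomotopy.mk x)).symm (x.component k))) =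
      ZerothHomotopy.mk (a.onJ ⟨X.ρ x.1 (root X.num k), x.2.1 k⟩)
  rw [h1, morCl_mk]
  obtain ⟨h2, h3⟩ := y.mk_eq_component_lam (mapsRoots_mor a y.1 x) k
  refine h3.symm.trans (congrArg ZerothHomotopy.mk (Subtype.ext ?_))
  change Y.ρ _ _ = a.1.φ _
  rw [Y.act_gap, a.1.ρ_φt]

variable (H) in
/-- The underlying set of the structured set of a marked circle is the set of components of `J`. -/
def forgetIso :
    toStructuredSetFunctor H ⋙ StructuredSet.forget (DeltaG.incl G) ≅ pi0 H :=
  NatIso.ofComponents (fun _ => Iso.refl _) (fun {X Y} α => by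
    apply ObjectProperty.hom_ext
    ext c
    exact map_toStructuredHom α c)

end MarkedCircle

/-! ### The topological group of homeomorphisms of the circle -/

theorem continuous_homeo_of_uncurry {T X Y : Type*} [TopologicalSpace T] [TopologicalSpace X]
    [TopologicalSpace Y] {f : T → (X ≃ₜ Y)} (h : Continuous fun x : T × X => f x.1 x.2) :
    Continuous f :=
  continuous_induced_rng.2 (ContinuousMap.continuous_of_continuous_uncurry _ h)

theorem continuous_homeo_mul :
    Continuous fun x : (Circle ≃ₜ Circle) × (Circle ≃ₜ Circle) => x.1 * x.2 := by
  have hc := continuous_homeo_eval Circle Circle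
  refine continuous_homeo_of_uncurry ?_
  exact hc.comp ((continuous_fst.comp continuous_fst).prodMk
    (hc.comp ((continuous_snd.comp continuous_fst).prodMk continuous_snd)))

theorem continuous_homeo_inv : Continuous fun φ : Circle ≃ₜ Circle => φ⁻¹ := by
  refine continuous_induced_rng.2 (ContinuousMap.continuous_compactOpen.2 fun K hK U hU => ?_)
  have h1 : Continuous fun φ : Circle ≃ₜ Circle => (φ : C(Circle, Circle)) := continuous_induced_dom
  have h2 := (ContinuousMap.isOpen_setOfPred_mapsTo hU.isClosed_compl.isCompact
    hK.isClosed.isOpen_compl).preimage h1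
  convert h2 using 1
  ext φ
  constructor
  · intro h z hz hK
    have := h hK
    exact hz (by simpa using this)
  · intro h z hz
    by_contra hU
    exact h (x := φ⁻¹ z) hU (by simpa using hz)

/-- The orientation character of a homeomorphism of the circle. -/
def orient (φ : Circle ≃ₜ Circle) : ℤˣ := (exists_lift_homeo φ).choose

/-- A lift of a homeomorphism of the circle. -/
def liftOf (φ : Circle ≃ₜ Circle) : liftGroup := (exists_lift_homeo φ).choose_spec.choose

theorem apply_ez (φ : Circle ≃ₜ Circle) (t : ℝ) :
    φ (ez t) = ez ((liftOf φ).1 (((orient φ : ℤ) : ℝ) * t)) :=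
  (exists_lift_homeo φ).choose_spec.choose_spec t

theorem orient_eq {φ : Circle ≃ₜ Circle} {ε : ℤˣ} {l : liftGroup}
    (h : ∀ t, φ (ez t) = ez (l.1 (((ε : ℤ) : ℝ) * t))) :
    orient φ = ε ∧ ∃ k : ℤ, liftOf φ = liftGroup.transl k * l :=
  lift_homeo_unique fun t => by rw [← apply_ez, h]

/-- The displacement of the point `z` under a homeomorphism of the circle. -/
def displ (φ : Circle ≃ₜ Circle) (z : Circle) : ℝ :=
  (liftOf φ).1 (((orient φ : ℤ) : ℝ) * Function.surjInv ez_surjective z) - (liftOf φ).1 0 -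
    ((orient φ : ℤ) : ℝ) * Function.surjInv ez_surjective z

theorem displ_ez {φ : Circle ≃ₜ Circle} {ε : ℤˣ} {l : liftGroup}
    (h : ∀ t, φ (ez t) = ez (l.1 (((ε : ℤ) : ℝ) * t))) (t : ℝ) :
    displ φ (ez t) = l.1 (((ε : ℤ) : ℝ) * t) - l.1 0 - ((ε : ℤ) : ℝ) * t := by
  obtain ⟨h1, k, h2⟩ := orient_eq h
  obtain ⟨c, hc⟩ := ez_eq_iff.1 (Function.surjInv_eq ez_surjective (ez t))
  have h3 := liftGroup.apply_add_int l (((ε : ℤ) : ℝ) * t) (ε * c)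
  rw [displ, h1, h2, hc]
  simp only [liftGroup.mul_apply, liftGroup.transl_apply]
  push_cast at h3
  rw [mul_add, h3]
  ring

theorem continuous_displ_right (φ : Circle ≃ₜ Circle) : Continuous (displ φ) := by
  refine isOpenQuotientMap_ez.isQuotientMap.continuous_iff.2 ?_
  have hl := (liftOf φ).1.continuous
  refine Continuous.congr (f := fun t => (liftOf φ).1 (((orient φ : ℤ) : ℝ) * t) -
    (liftOf φ).1 0 - ((orient φ : ℤ) : ℝ) * t) (by fun_prop) fun t => ?_
  exact (displ_ez (apply_ez φ) t).symm

/-- The angle between the images of the point `z` under two homeomorphisms. -/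
def angle (φ₀ φ : Circle ≃ₜ Circle) (z : Circle) : ℝ :=
  Complex.arg ((φ z / φ₀ z : Circle) : ℂ) / (2 * Real.pi)

theorem ez_angle (φ₀ φ : Circle ≃ₜ Circle) (z : Circle) : ez (angle φ₀ φ z) = φ z / φ₀ z := by
  have := Real.pi_pos
  rw [ez, angle, mul_div_cancel₀ _ (by positivity), Circle.exp_arg]

theorem continuous_div_apply (φ₀ : Circle ≃ₜ Circle) :
    Continuous fun x : (Circle ≃ₜ Circle) × Circle => ((x.1 x.2 / φ₀ x.2 : Circle) : ℂ) :=
  continuous_subtype_val.comp ((continuous_homeo_eval Circle Circle).div'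
    (φ₀.continuous.comp continuous_snd))

theorem continuousAt_angle {φ₀ φ : Circle ≃ₜ Circle} {z : Circle}
    (h : ((φ z / φ₀ z : Circle) : ℂ) ∈ Complex.slitPlane) :
    ContinuousAt (fun x : (Circle ≃ₜ Circle) × Circle => angle φ₀ x.1 x.2) (φ, z) := by
  have h1 : ContinuousAt (fun x : (Circle ≃ₜ Circle) × Circle =>
      Complex.arg ((x.1 x.2 / φ₀ x.2 : Circle) : ℂ)) (φ, z) :=
    ContinuousAt.comp (g := Complex.arg) (Complex.continuousAt_arg h)
      (continuous_div_apply φ₀).continuousAt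
  exact h1.div_const _

theorem eventually_slitPlane (φ₀ : Circle ≃ₜ Circle) :
    ∀ᶠ φ in 𝓝 φ₀, ∀ z, ((φ z / φ₀ z : Circle) : ℂ) ∈ Complex.slitPlane := by
  have h1 : Continuous fun φ : Circle ≃ₜ Circle =>
      (⟨fun z => ((φ z / φ₀ z : Circle) : ℂ),
        continuous_subtype_val.comp (φ.continuous.div' φ₀.continuous)⟩ : C(Circle, ℂ)) :=
    ContinuousMap.continuous_of_continuous_uncurry _ (continuous_div_apply φ₀)
  have h2 := (ContinuousMap.isOpen_setOfPred_mapsTo (isCompact_univ (X := Circle))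
    Complex.isOpen_slitPlane).preimage h1
  refine Filter.mem_of_superset (h2.mem_nhds fun z _ => ?_) fun φ hφ z => hφ (Set.mem_univ z)
  show ((φ₀ z / φ₀ z : Circle) : ℂ) ∈ _
  simp

theorem orient_displ_eq {φ₀ φ : Circle ≃ₜ Circle}
    (h : ∀ z, ((φ z / φ₀ z : Circle) : ℂ) ∈ Complex.slitPlane) :
    orient φ = orient φ₀ ∧ ∀ z, displ φ z = displ φ₀ z + angle φ₀ φ z - angle φ₀ φ 1 := by
  have hc : Continuous (angle φ₀ φ) := continuous_iff_continuousAt.2 fun z =>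
    (continuousAt_angle (h z)).comp (f := fun z => (φ, z)) (by fun_prop)
  have hl := (liftOf φ₀).1.continuous
  have hz := continuous_ez
  have hlift : ∀ t, ez ((liftOf φ₀).1 (((orient φ₀ : ℤ) : ℝ) * t) + angle φ₀ φ (ez t)) =
      φ (ez t) := fun t => by
    rw [ez_add, ← apply_ez, ez_angle, mul_div_cancel]
  obtain ⟨ε, l, hε⟩ := exists_eq_of_lifts (φ := φ) (by fun_prop) hlift
  have h1 : ∀ t, φ (ez t) = ez (l.1 (((ε : ℤ) : ℝ) * t)) := fun t => by rw [← hε, hlift]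
  have hee : orient φ₀ = ε := by
    have a := hε 1
    have b := hε 0
    have e1 : ez 1 = ez 0 := by simpa using ez_add_int 0 1
    have c := liftGroup.apply_add_int (liftOf φ₀) 0 (orient φ₀)
    have d := liftGroup.apply_add_int l 0 ε
    simp only [mul_one, mul_zero, zero_add, e1] at a b c d
    have : ((orient φ₀ : ℤ) : ℝ) = ((ε : ℤ) : ℝ) := by linarith
    exact Units.ext (by exact_mod_cast this)
  refine ⟨(orient_eq h1).1.trans hee.symm, fun z => ?_⟩
  obtain ⟨t, rfl⟩ := ez_surjective z
  have b := hε 0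
  rw [displ_ez h1, displ_ez (apply_ez φ₀), ← hε, hee]
  rw [mul_zero, mul_zero, ez_zero] at b
  linarith

theorem continuous_orient : Continuous orient :=
  continuous_iff_continuousAt.2 fun φ₀ => by
    refine ContinuousAt.congr (f := fun _ => orient φ₀) continuousAt_const ?_
    filter_upwards [eventually_slitPlane φ₀] with φ hφ
    exact (orient_displ_eq hφ).1.symm

theorem continuous_displ : Continuous fun x : (Circle ≃ₜ Circle) × Circle => displ x.1 x.2 :=
  continuous_iff_continuousAt.2 fun ⟨φ₀, z₀⟩ => by
    have h0 : ∀ z, ((φ₀ z / φ₀ z : Circle) : ℂ) ∈ Complex.slitPlane := fun z => by simp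
    refine ContinuousAt.congr (f := fun x : (Circle ≃ₜ Circle) × Circle =>
      displ φ₀ x.2 + angle φ₀ x.1 x.2 - angle φ₀ x.1 1) ?_ ?_
    · refine (((continuous_displ_right φ₀).comp continuous_snd).continuousAt.add
        (continuousAt_angle (h0 z₀))).sub ?_
      exact ContinuousAt.comp (g := fun x : (Circle ≃ₜ Circle) × Circle => angle φ₀ x.1 x.2)
        (f := fun x : (Circle ≃ₜ Circle) × Circle => (x.1, (1 : Circle))) (x := (φ₀, z₀))
        (continuousAt_angle (h0 1)) (continuous_fst.prodMk continuous_const).continuousAt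
    · have := continuous_fst.continuousAt (x := (φ₀, z₀)) |>.eventually (eventually_slitPlane φ₀)
      filter_upwards [this] with x hx
      exact ((orient_displ_eq hx).2 x.2).symm

/-! ### The orthogonal transformation with the same value at `1` and the same orientation -/

theorem O2.eq_of_act_one_eq {A B : O2} (h : O2.act A 1 = O2.act B 1)
    (hs : O2.sign A = O2.sign B) : A = B := by
  obtain ⟨a, ha⟩ := O2.act_ez A
  obtain ⟨b, hb⟩ := O2.act_ez B
  refine O2.toHomeo_injective ?_
  ext1 z
  obtain ⟨t, rfl⟩ := ez_surjective z
  show O2.act A (ez t) = O2.act B (ez t)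
  have h1 := ha 0
  have h2 := hb 0
  simp only [mul_zero, zero_add, ez_zero] at h1 h2
  rw [ha, hb, ez_add, ez_add, ← h1, ← h2, h, hs]

theorem O2.orient_toHomeo (A : O2) : orient (O2.toHomeo A) = O2.sign A := by
  obtain ⟨s, hs⟩ := O2.act_ez A
  exact (orient_eq (l := liftGroup.transl s) hs).1

theorem O2.continuous_toHomeo : Continuous O2.toHomeo := by
  refine continuous_homeo_of_uncurry ?_
  change Continuous fun x : O2 × Circle => O2.act x.1 x.2
  refine Continuous.subtype_mk ?_ _
  have h : Continuous fun x : O2 × Circle => (x.2 : ℂ) := continuous_subtype_val.comp continuous_snd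
  have hA : ∀ a b, Continuous fun x : O2 × Circle => x.1.1 a b := fun a b =>
    (continuous_subtype_val.comp continuous_fst).matrix_elem a b
  have hre := Complex.continuous_re.comp h
  have him := Complex.continuous_im.comp h
  have hpair := (((hA 0 0).mul hre).add ((hA 0 1).mul him)).prodMk
    (((hA 1 0).mul hre).add ((hA 1 1).mul him))
  exact Complex.equivRealProdCLM.symm.continuous.comp hpair

/-- The orthogonal matrix with the first column `z` and the determinant `ε`. -/
def O2.ofColumn (z : Circle) (ε : ℤˣ) : O2 :=
  ⟨!![(z : ℂ).re, -((ε : ℤ) : ℝ) * (z : ℂ).im; (z : ℂ).im, ((ε : ℤ) : ℝ) * (z : ℂ).re], by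
    rw [Matrix.mem_orthogonalGroup_iff]
    have hz : (z : ℂ).re * (z : ℂ).re + (z : ℂ).im * (z : ℂ).im = 1 := by
      have := Circle.normSq_coe z
      rwa [Complex.normSq_apply] at this
    rcases Int.units_eq_one_or ε with rfl | rfl <;> ext a b <;> fin_cases a <;> fin_cases b <;>
      simp [Matrix.mul_apply, Fin.sum_univ_two] <;> linarith⟩

theorem O2.act_ofColumn (z : Circle) (ε : ℤˣ) : O2.act (O2.ofColumn z ε) 1 = z := by
  apply Circle.ext
  apply Complex.ext <;> simp [O2.act, O2.ofColumn]

theorem O2.sign_ofColumn (z : Circle) (ε : ℤˣ) : O2.sign (O2.ofColumn z ε) = ε := by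
  have hz : (z : ℂ).re * (z : ℂ).re + (z : ℂ).im * (z : ℂ).im = 1 := by
    have := Circle.normSq_coe z
    rwa [Complex.normSq_apply] at this
  have h : (O2.ofColumn z ε).1.det = ((ε : ℤ) : ℝ) := by
    simp only [O2.ofColumn, Matrix.det_fin_two_of]
    linear_combination ((ε : ℤ) : ℝ) * hz
  have h2 := O2.sign_cast (O2.ofColumn z ε)
  rw [h] at h2
  exact Units.ext (by exact_mod_cast h2)

theorem O2.continuous_ofColumn : Continuous fun x : Circle × ℤˣ => O2.ofColumn x.1 x.2 := by
  refine Continuous.subtype_mk ?_ _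
  have h : Continuous fun x : Circle × ℤˣ => (x.1 : ℂ) := continuous_subtype_val.comp continuous_fst
  have hε : Continuous fun x : Circle × ℤˣ => ((x.2 : ℤ) : ℝ) :=
    (continuous_of_discreteTopology (f := fun ε : ℤˣ => ((ε : ℤ) : ℝ))).comp continuous_snd
  refine continuous_matrix fun a b => ?_
  fin_cases a <;> fin_cases b <;> simp <;> fun_prop

/-- The retraction of `Homeo(S¹)` to `O(2)`. -/
def retract (φ : Circle ≃ₜ Circle) : O2 := O2.ofColumn (φ 1) (orient φ)

theorem continuous_retract : Continuous retract :=
  O2.continuous_ofColumn.comp (((continuous_homeo_eval Circle Circle).comp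
    (continuous_id.prodMk continuous_const)).prodMk continuous_orient)

theorem retract_toHomeo (A : O2) : retract (O2.toHomeo A) = A :=
  O2.eq_of_act_one_eq (O2.act_ofColumn _ _)
    ((O2.sign_ofColumn _ _).trans (O2.orient_toHomeo A))

/-! ### Pullbacks of coverings -/

/-- A pullback of a covering map is a covering map. -/
theorem IsCoveringMap.of_pullback {E X E' Y : Type*} [TopologicalSpace E] [TopologicalSpace X]
    [TopologicalSpace E'] [TopologicalSpace Y] {p : E → X} (hp : IsCoveringMap p) {r : Y → X}
    (hr : Continuous r) {q : E' → Y} {f : E' → E} (hcomm : ∀ x, p (f x) = r (q x))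
    (hind : IsInducing fun x => (q x, f x))
    (hex : ∀ y x, p x = r y → ∃ x', q x' = y ∧ f x' = x)
    (huniq : ∀ x x', q x = q x' → f x = f x' → x = x') : IsCoveringMap q := fun y => by
  have hq : Continuous q := continuous_fst.comp hind.continuous
  have hf : Continuous f := continuous_snd.comp hind.continuous
  obtain ⟨hdisc, U, hyU, hU, hpU, e, he⟩ := hp (r y)
  have hex' : ∀ z : (r ⁻¹' U) × (p ⁻¹' {r y}),
      ∃ x', q x' = z.1 ∧ f x' = e.symm (⟨r z.1, z.1.2⟩, z.2) := fun z =>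
    hex z.1 _ (by rw [← he, Homeomorph.apply_symm_apply])
  choose s hs1 hs2 using hex'
  have hsmem : ∀ z, s z ∈ q ⁻¹' (r ⁻¹' U) := fun z => by
    show r (q (s z)) ∈ U
    rw [hs1]; exact z.1.2
  have hfmem : ∀ x : q ⁻¹' (r ⁻¹' U), f x ∈ p ⁻¹' U := fun x => by
    show p (f x) ∈ U
    rw [hcomm]; exact x.2
  suffices h : IsEvenlyCovered q y (p ⁻¹' {r y}) from h.to_isEvenlyCovered_preimage
  refine ⟨hdisc, r ⁻¹' U, hyU, hU.preimage hr, (hU.preimage hr).preimage hq,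
      { toFun := fun x => (⟨q x, x.2⟩, (e ⟨f x, hfmem x⟩).2)
        invFun := fun z => ⟨s z, hsmem z⟩
        left_inv := fun x => Subtype.ext (huniq _ _ (hs1 _) ?_)
        right_inv := fun z => Prod.ext (Subtype.ext (hs1 z)) ?_
        continuous_toFun := ?_
        continuous_invFun := ?_ }, fun x => rfl⟩
  · rw [hs2]
    have : ((⟨r (q x), x.2⟩, (e ⟨f x, hfmem x⟩).2) : U × (p ⁻¹' {r y})) = e ⟨f x, hfmem x⟩ :=
      Prod.ext (Subtype.ext (by rw [he]; exact (hcomm x).symm)) rfl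
    simp only [this, Homeomorph.symm_apply_apply]
  · simp only [hs2, Subtype.coe_eta, Homeomorph.apply_symm_apply]
  · refine Continuous.prodMk ((hq.comp continuous_subtype_val).subtype_mk _) ?_
    exact continuous_snd.comp (e.continuous.comp ((hf.comp continuous_subtype_val).subtype_mk _))
  · refine Continuous.subtype_mk (hind.continuous_iff.2 ?_) _
    refine Continuous.prodMk (f := fun z => q (s z)) (g := fun z => f (s z)) ?_ ?_
    · simp only [hs1]
      exact continuous_subtype_val.comp continuous_fst
    · simp only [hs2]
      exact continuous_subtype_val.comp (e.symm.continuous.comp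
        (((hr.comp (continuous_subtype_val.comp continuous_fst)).subtype_mk _).prodMk
          continuous_snd))

/-! ### The displacement as a cocycle -/

theorem orient_mul (φ ψ : Circle ≃ₜ Circle) : orient (φ * ψ) = orient φ * orient ψ ∧
    ∀ z, displ (φ * ψ) z + displ φ (ψ 1) = displ φ (ψ z) + ((orient φ : ℤ) : ℝ) * displ ψ z := by
  have h : ∀ t, (φ * ψ) (ez t) = ez ((liftOf φ * liftGroup.conj (orient φ) (liftOf ψ)).1
      (((orient φ * orient ψ : ℤˣ) : ℤ) * t)) := fun t => by
    show φ (ψ (ez t)) = _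
    rw [apply_ez ψ, apply_ez φ, liftGroup.mul_apply, liftGroup.conj_apply]
    push_cast
    rw [mul_assoc, unit_mul_unit_mul]
  refine ⟨(orient_eq h).1, fun z => ?_⟩
  obtain ⟨t, rfl⟩ := ez_surjective z
  have h1 := apply_ez ψ 0
  rw [ez_zero] at h1
  rw [displ_ez h, h1, apply_ez ψ, displ_ez (apply_ez φ), displ_ez (apply_ez φ),
    displ_ez (apply_ez ψ)]
  simp only [liftGroup.mul_apply, liftGroup.conj_apply]
  push_cast
  rw [mul_assoc, unit_mul_unit_mul]
  simp only [mul_zero]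
  ring

theorem displ_toHomeo (A : O2) (z : Circle) : displ (O2.toHomeo A) z = 0 := by
  obtain ⟨s, hs⟩ := O2.act_ez A
  obtain ⟨t, rfl⟩ := ez_surjective z
  rw [displ_ez (l := liftGroup.transl s) hs]
  simp

theorem displ_one_left (z : Circle) : displ 1 z = 0 := by
  rw [← map_one O2.toHomeo, displ_toHomeo]

theorem displ_one_right (φ : Circle ≃ₜ Circle) : displ φ 1 = 0 := by
  rw [← ez_zero, displ_ez (apply_ez φ)]
  simp

theorem act_retract_one (φ : Circle ≃ₜ Circle) : O2.act (retract φ) 1 = φ 1 := O2.act_ofColumn _ _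

theorem sign_retract (φ : Circle ≃ₜ Circle) : O2.sign (retract φ) = orient φ := O2.sign_ofColumn _ _

theorem apply_eq_displ (φ : Circle ≃ₜ Circle) (z : Circle) :
    φ z = ez (displ φ z) * O2.act (retract φ) z := by
  obtain ⟨t, rfl⟩ := ez_surjective z
  obtain ⟨s, hs⟩ := O2.act_ez (retract φ)
  have h0 := hs 0
  have h1 := apply_ez φ 0
  rw [ez_zero, mul_zero] at h1
  rw [ez_zero, act_retract_one, mul_zero, zero_add, h1] at h0
  rw [hs, apply_ez, displ_ez (apply_ez φ), sign_retract, ez_add _ s, ← h0, ← ez_add, ← ez_add]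
  congr 1
  ring

theorem retract_mul (φ ψ : Circle ≃ₜ Circle) :
    retract (φ * ψ) = O2.rotation (displ φ (ψ 1)) * retract φ * retract ψ := by
  refine O2.eq_of_act_one_eq ?_ ?_
  · rw [act_retract_one, O2.act_mul, O2.act_mul, act_retract_one, O2.act_rotation,
      ← apply_eq_displ]
    rfl
  · rw [sign_retract, map_mul, map_mul, O2.sign_rotation, sign_retract, sign_retract, one_mul,
      (orient_mul φ ψ).1]

/-! ### Existence of the planar homeomorphism group -/

/-- The pullback of `p : G → O(2)` along the retraction of `Homeo(S¹)` to `O(2)`. -/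
@[ext]
structure RetractPullback (G : PlanarLieGroup.{u}) where
  homeo : Circle ≃ₜ Circle
  elem : G
  p_elem : G.p elem = retract homeo

namespace RetractPullback

variable {G : PlanarLieGroup.{u}}

instance : TopologicalSpace (RetractPullback G) :=
  TopologicalSpace.induced (fun x => (x.homeo, x.elem)) inferInstance

theorem isInducing_prod : IsInducing fun x : RetractPullback G => (x.homeo, x.elem) := ⟨rfl⟩

theorem continuous_homeo : Continuous (homeo (G := G)) :=
  continuous_fst.comp isInducing_prod.continuous

theorem continuous_elem : Continuous (elem (G := G)) :=
  continuous_snd.comp isInducing_prod.continuous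

theorem sign_elem (x : RetractPullback G) : G.sign x.elem = orient x.homeo := by
  rw [← sign_retract, ← x.p_elem]
  rfl

instance : Mul (RetractPullback G) :=
  ⟨fun x y => ⟨x.homeo * y.homeo, G.e (displ x.homeo (y.homeo 1)) * x.elem * y.elem, by
    rw [map_mul, map_mul, G.p_e, x.p_elem, y.p_elem, retract_mul]⟩⟩

instance : One (RetractPullback G) :=
  ⟨⟨1, 1, by rw [map_one, ← map_one O2.toHomeo, retract_toHomeo]⟩⟩

theorem retract_inv (φ : Circle ≃ₜ Circle) :
    (retract φ)⁻¹ * O2.rotation (-displ φ (φ⁻¹ 1)) = retract φ⁻¹ := by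
  have h2 := retract_mul φ φ⁻¹
  have h3 := O2.rotation_add (displ φ (φ⁻¹ 1)) (-displ φ (φ⁻¹ 1))
  have h4 : O2.rotation 0 = 1 := by simpa using O2.rotation_int 0
  rw [mul_inv_cancel, ← map_one O2.toHomeo, retract_toHomeo, mul_assoc] at h2
  rw [add_neg_cancel, h4] at h3
  have h5 := mul_left_cancel (h3.symm.trans h2)
  rw [h5, inv_mul_cancel_left]

instance : Inv (RetractPullback G) :=
  ⟨fun x => ⟨x.homeo⁻¹, x.elem⁻¹ * G.e (-displ x.homeo (x.homeo⁻¹ 1)), by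
    rw [map_mul, map_inv, G.p_e, x.p_elem, retract_inv]⟩⟩

theorem mul_homeo (x y : RetractPullback G) : (x * y).homeo = x.homeo * y.homeo := rfl

theorem mul_elem (x y : RetractPullback G) :
    (x * y).elem = G.e (displ x.homeo (y.homeo 1)) * x.elem * y.elem := rfl

instance : Group (RetractPullback G) :=
  Group.ofLeftAxioms
    (fun x y z => by
      refine RetractPullback.ext (mul_assoc _ _ _) ?_
      have h := (orient_mul x.homeo y.homeo).2 (z.homeo 1)
      simp only [mul_elem, mul_homeo]
      calc G.e (displ (x.homeo * y.homeo) (z.homeo 1)) *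
            (G.e (displ x.homeo (y.homeo 1)) * x.elem * y.elem) * z.elem =
          G.e (displ (x.homeo * y.homeo) (z.homeo 1) + displ x.homeo (y.homeo 1)) *
            x.elem * y.elem * z.elem := by simp only [G.e_add, mul_assoc]
        _ = G.e (displ x.homeo (y.homeo (z.homeo 1))) * (x.elem * G.e (displ y.homeo (z.homeo 1))) *
            y.elem * z.elem := by
          rw [h, G.e_add, G.mul_e x.elem, sign_elem]
          simp only [mul_assoc]
        _ = _ := by simp only [mul_assoc]; rfl)
    (fun x => by
      refine RetractPullback.ext (one_mul _) ?_
      show G.e (displ 1 (x.homeo 1)) * 1 * x.elem = x.elem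
      rw [displ_one_left, G.e_zero, one_mul, one_mul])
    (fun x => by
      refine RetractPullback.ext (inv_mul_cancel _) ?_
      have h := (orient_mul x.homeo⁻¹ x.homeo).2 (x.homeo⁻¹ 1)
      have h1 : x.homeo (x.homeo⁻¹ 1) = 1 := x.homeo.apply_symm_apply 1
      have h2 := (orient_mul x.homeo⁻¹ x.homeo).1
      have h3 : orient 1 = 1 := by rw [← map_one O2.toHomeo, O2.orient_toHomeo, map_one]
      rw [inv_mul_cancel, displ_one_left, h1, displ_one_right, zero_add, zero_add] at h
      rw [inv_mul_cancel, h3] at h2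
      show G.e (displ x.homeo⁻¹ (x.homeo 1)) * (x.elem⁻¹ * G.e (-displ x.homeo (x.homeo⁻¹ 1))) * x.elem = 1
      have h4 : G.sign x.elem⁻¹ = orient x.homeo⁻¹ := by
        rw [map_inv, sign_elem]
        exact inv_eq_of_mul_eq_one_left h2.symm
      rw [G.mul_e, h4, h, ← mul_assoc, ← G.e_add, mul_neg, add_neg_cancel, G.e_zero, one_mul,
        inv_mul_cancel])

theorem continuous_displ_apply {T : Type*} [TopologicalSpace T] {f g : T → (Circle ≃ₜ Circle)}
    (hf : Continuous f) (hg : Continuous g) : Continuous fun t => displ (f t) (g t 1) := by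
  have h : Continuous fun t => g t 1 :=
    (continuous_homeo_eval Circle Circle).comp (hg.prodMk continuous_const)
  exact continuous_displ.comp (hf.prodMk h)

instance : IsTopologicalGroup (RetractPullback G) where
  continuous_mul := by
    have hx : Continuous fun a : RetractPullback G × RetractPullback G => a.1.homeo :=
      continuous_homeo.comp continuous_fst
    have hy : Continuous fun a : RetractPullback G × RetractPullback G => a.2.homeo :=
      continuous_homeo.comp continuous_snd
    have h1 : Continuous fun a : RetractPullback G × RetractPullback G => a.1.homeo * a.2.homeo :=
      continuous_homeo_mul.comp (hx.prodMk hy)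
    have h2 : Continuous fun a : RetractPullback G × RetractPullback G =>
        G.e (displ a.1.homeo (a.2.homeo 1)) * a.1.elem * a.2.elem :=
      ((G.e.continuous.comp (continuous_displ_apply hx hy)).mul
        (continuous_elem.comp continuous_fst)).mul (continuous_elem.comp continuous_snd)
    exact isInducing_prod.continuous_iff.2 (h1.prodMk h2)
  continuous_inv := by
    have hx : Continuous fun a : RetractPullback G => a.homeo⁻¹ :=
      continuous_homeo_inv.comp continuous_homeo
    have hd : Continuous fun a : RetractPullback G => -displ a.homeo (a.homeo⁻¹ 1) :=
      (continuous_displ_apply continuous_homeo hx).neg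
    have h2 : Continuous fun a : RetractPullback G =>
        a.elem⁻¹ * G.e (-displ a.homeo (a.homeo⁻¹ 1)) :=
      continuous_elem.inv.mul (G.e.continuous.comp hd)
    exact isInducing_prod.continuous_iff.2 (hx.prodMk h2)

/-- The projection to `Homeo(S¹)`. -/
def toHomeo : RetractPullback G →* (Circle ≃ₜ Circle) where
  toFun := homeo
  map_one' := rfl
  map_mul' _ _ := rfl

/-- The inclusion of `G`. -/
def incl : G →* RetractPullback G where
  toFun g := ⟨O2.toHomeo (G.p g), g, (retract_toHomeo _).symm⟩
  map_one' := RetractPullback.ext (by simp only [map_one]; rfl) rfl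
  map_mul' g h := by
    refine RetractPullback.ext (by simp only [map_mul]; rfl) ?_
    simp only [mul_elem, displ_toHomeo, G.e_zero, one_mul]

theorem isCoveringMap_toHomeo : IsCoveringMap (toHomeo (G := G)) :=
  IsCoveringMap.of_pullback G.connective.isCoveringMap continuous_retract
    (f := elem) p_elem isInducing_prod
    (fun φ g h => ⟨⟨φ, g, h⟩, rfl, rfl⟩) (fun _ _ => RetractPullback.ext)

theorem continuous_p : Continuous G.p := G.connective.isCoveringMap.continuous

theorem continuous_incl : Continuous (incl (G := G)) :=
  isInducing_prod.continuous_iff.2 ((O2.continuous_toHomeo.comp continuous_p).prodMk continuous_id)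

theorem exists_segment_retract {φ : Circle ≃ₜ Circle} (h : orient φ = 1) :
    ∃ γ : Path φ (O2.toHomeo (retract φ)), ∀ s, retract (γ s) = retract φ := by
  have h1 : ∀ t, φ (ez t) = ez ((liftOf φ).1 t) := fun t => by
    rw [apply_ez, h]
    simp
  have h2 : ∀ l : liftGroup, orient (liftGroup.toHomeo l) = 1 := fun l =>
    (orient_eq (l := l) fun t => by rw [liftGroup.toHomeo_ez]; simp).1
  have h3 : ∀ l : liftGroup, l.1 0 = (liftOf φ).1 0 →
      retract (liftGroup.toHomeo l) = retract φ := fun l hl => by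
    refine O2.eq_of_act_one_eq ?_ ?_
    · rw [act_retract_one, act_retract_one, ← ez_zero, liftGroup.toHomeo_ez, h1, hl]
    · rw [sign_retract, sign_retract, h2, h]
  have h4 : liftGroup.toHomeo (liftOf φ) = φ := by
    ext1 z
    obtain ⟨t, rfl⟩ := ez_surjective z
    rw [liftGroup.toHomeo_ez, h1]
  have h5 : liftGroup.toHomeo (liftGroup.transl ((liftOf φ).1 0)) = O2.toHomeo (retract φ) := by
    ext1 z
    obtain ⟨t, rfl⟩ := ez_surjective z
    obtain ⟨s, hs⟩ := O2.act_ez (retract φ)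
    have h0 := hs 0
    rw [ez_zero, act_retract_one, mul_zero, zero_add, ← ez_zero, h1] at h0
    show _ = O2.act (retract φ) (ez t)
    rw [hs, liftGroup.toHomeo_ez, liftGroup.transl_apply, ez_add, h0, sign_retract, h, ez_add]
    simp
  refine ⟨((liftGroup.segmentPath (liftOf φ) (liftGroup.transl ((liftOf φ).1 0))).map
    liftGroup.continuous_toHomeo).cast h4.symm h5.symm, fun s => h3 _ ?_⟩
  show (liftGroup.segment _ _ s).1 0 = _
  rw [liftGroup.segment_apply, liftGroup.transl_apply]
  ring

theorem isConnected_preimage_toHomeo :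
    IsConnected (toHomeo (G := G) ⁻¹' connectedComponent 1) := by
  have hone : (1 : RetractPullback G) ∈ toHomeo (G := G) ⁻¹' connectedComponent 1 := by
    rw [Set.mem_preimage, map_one]
    exact mem_connectedComponent
  refine ⟨⟨1, hone⟩, isPreconnected_of_forall 1 fun x hx => ?_⟩
  have horient : orient x.homeo = 1 := by
    have := isPreconnected_connectedComponent.constant continuous_orient.continuousOn hx
      (mem_connectedComponent (x := (1 : Circle ≃ₜ Circle)))
    rw [show orient x.homeo = orient 1 from this, ← map_one O2.toHomeo, O2.orient_toHomeo, map_one]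
  obtain ⟨γ, hγ⟩ := exists_segment_retract horient
  let δ : I → RetractPullback G := fun s => ⟨γ s, x.elem, by rw [hγ, x.p_elem]⟩
  have hδ : Continuous δ := isInducing_prod.continuous_iff.2 (γ.continuous.prodMk continuous_const)
  have hδ0 : δ 0 = x := RetractPullback.ext γ.source rfl
  have hδ1 : δ 1 = incl x.elem := RetractPullback.ext (γ.target.trans (by rw [← x.p_elem]; rfl)) rfl
  have hpx : G.p x.elem ∈ connectedComponent (1 : O2) := by
    rw [x.p_elem]
    have := continuous_retract.image_connectedComponent_subset 1 (Set.mem_image_of_mem _ hx)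
    rwa [← map_one O2.toHomeo, retract_toHomeo] at this
  refine ⟨incl '' (G.p ⁻¹' connectedComponent 1) ∪ Set.range δ, Set.union_subset ?_ ?_,
    Or.inl ⟨1, ?_, map_one _⟩, Or.inr ⟨0, hδ0⟩,
    IsPreconnected.union (incl x.elem) ⟨_, hpx, rfl⟩ ⟨1, hδ1⟩
      (G.connective.isConnected_preimage.isPreconnected.image _ continuous_incl.continuousOn)
      (isPreconnected_range hδ)⟩
  · rintro - ⟨g, hg, rfl⟩
    have := O2.continuous_toHomeo.image_connectedComponent_subset 1 (Set.mem_image_of_mem _ hg)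
    rwa [map_one] at this
  · rintro - ⟨s, rfl⟩
    have h1 : γ s ∈ connectedComponent x.homeo :=
      (isPreconnected_range γ.continuous).subset_connectedComponent ⟨0, γ.source⟩ ⟨s, rfl⟩
    rwa [← connectedComponent_eq (show x.homeo ∈ connectedComponent 1 from hx)] at h1
  · rw [Set.mem_preimage, map_one]
    exact mem_connectedComponent

end RetractPullback

open RetractPullback in
/-- The pullback of `G` along the retraction of `Homeo(S¹)` to `O(2)` is a planar homeomorphism
group of `G`. -/
def planarHomeoGroup (G : PlanarLieGroup.{u}) : PlanarHomeoGroup G where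
  carrier := RetractPullback G
  q := toHomeo
  connective := ⟨isCoveringMap_toHomeo, isConnected_preimage_toHomeo⟩
  incl := incl
  q_incl _ := rfl
  isEmbedding := Function.LeftInverse.isEmbedding (f := fun x : O2 × RetractPullback G => x.2.elem)
    (fun _ => rfl) (continuous_elem.comp continuous_snd) (continuous_p.prodMk continuous_incl)
  exists_eq A x h := by
    have hA : G.p x.elem = A := by
      rw [x.p_elem, ← retract_toHomeo A, h]
      rfl
    exact ⟨x.elem, hA, RetractPullback.ext ((congrArg O2.toHomeo hA).trans h) rfl⟩

end

end PlanarCSG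

theorem mainTheorem6 (G : PlanarLieGroup.{u}) :
    Nonempty (PlanarHomeoGroup G) ∧
    ∀ H : PlanarHomeoGroup G,
      (∃ (π : MarkedCircle H ⥤ StructuredSet (DeltaG.incl G))
          (α : π ⋙ StructuredSet.forget (DeltaG.incl G) ≅ MarkedCircle.pi0 H),
        π.IsEquivalence ∧
        ∀ X : MarkedCircle H,
          ∃ β : (π.obj X).Frame ≃ ZerothHomotopy (X.FrameSpace (π.obj X).n),
            ∀ (f : (π.obj X).Frame) (x : X.FrameSpace (π.obj X).n),
              β f = ZerothHomotopy.mk x →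
              (∀ k, (α.hom.app X).hom ((π.obj X).ρ f k) = x.component k) ∧
              ∀ (g : Gen (DeltaG.incl G) (π.obj X).n) (w : G.base) (j : ℤ),
                g.hom = DeltaG.autHom (π.obj X).n w j →
                ∃ y : X.FrameSpace (π.obj X).n,
                  y.1 = X.act x.1 (H.incl (w * G.e (j / ((π.obj X).n + 1)))) ∧
                  β ((π.obj X).act f g) = ZerothHomotopy.mk y) ∧
      Nonempty (MarkedCircle H ≌ DeltaG G) := by
  refine ⟨⟨planarHomeoGroup G⟩, fun H => ?_⟩
  refine ⟨⟨MarkedCircle.toStructuredSetFunctor H, MarkedCircle.forgetIso H, inferInstance,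
    fun X => ⟨Equiv.refl _, ?_⟩⟩, ⟨(MarkedCircle.toStructuredSetFunctor H).asEquivalence.trans
      (StructuredSet.toObject (DeltaG.incl G)).asEquivalence⟩⟩
  rintro _ x rfl
  refine ⟨fun k => rfl, fun g w j hg => ?_⟩
  obtain ⟨y, hy, hy'⟩ := MarkedCircle.exists_act_incl x g w j hg
  exact ⟨y, hy, MarkedCircle.frameAct_mk hy'⟩
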